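/- **Setting.** A join query consists of a finite attribute set $\mathcal A$ and relations $R_1,\dots,R_m$ with schemas $\mathrm{attr}(R_i)\subseteq\mathcal A$ that cover $\mathcal A$; an input consists of nonempty finite relations. $\bowtie_i R_i$ is the set of tuples $t$ over $\mathcal A$ with $\pi_{\mathrm{attr}(R_i)}(t)\in R_i$ for all $i$; $\mathrm{IN}=\sum_i|R_i|$ and $\mathrm{OUT}=|\bowtie_i R_i|$. $\tilde O(f)$ means at most $C\log^k(\mathrm{IN}+2)\cdot f$ with $C,k$ depending on the query (and below on $K$ or the fixed sequence of transforms) but not on the data. Steps are counted with unit cost per tuple: projections, selections, intersections and building an index cost one step per tuple scanned; a join is evaluated by an indexed nested loop that costs one step per index lookup, per matching row visited and per tuple emitted. Choosing transforms and solving linear programs whose size depends only on the query is not charged. *Degrees.* $\deg(v,R,A)=|\{t\in R:\pi_A(t)=v\}|$, $d_{R,A}=\max_v\deg(v,R,A)$. A degree configuration $c$ assigns to every relation $R$ and $A\subseteq\mathrm{attr}(R)$ a bucket index $c(R,A)\in\mathbb N$ (for the bucket $[2^l,2^{l+1})$), antitone in $A$, with $c(R,\mathrm{attr}(R))=0$ and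 $c(R,\emptyset)=\lfloor\log_2|R|\rfloor$; $R(c)$ is the set of $t\in R$ with all $\deg(\pi_A(t),R,A)$ in the prescribed buckets. *DBP.* For a cover $C$ of $X$, i.e. a set of pairs $(R,A)$ with $A\subseteq\mathrm{attr}(R)\cap X$ and $\bigcup_C A=X$, let $O_C$ be the minimum of $\sum_{a\in X}v_a$ subject to $\sum_{a\in A'}v_a\ge\log(d_{\pi_A(R),A\setminus A'}/2)$ for all $(R,A)\in C$, $A'\subseteq A$ (logarithms to base $\mathrm{IN}$). $\mathrm{DBP}(\mathcal R,X)=\min_C O_C$, and $\mathrm{DBP}(\mathcal R)=\mathrm{DBP}(\mathcal R,\mathcal A)$. *Transforms*, on a problem $\pi_{\mathcal O}(\bowtie_{R\in\mathcal R}R)$. **Heavy** on an attribute $X$: for each value $x$ of $X$ that lies in all relations containing $X$, solve the problem with $X=x$ selected and projected out; return the union of the results, each combined with $x$ if $X\in\mathcal O$. **Light** on a set $X$: compute $R_X=\bowtie_{R\in\mathcal R}\pi_X R$ by joining the $\pi_A(R)$, $(R,A)\in C$, for a cover $C$ with minimal $O_C$, filtering with all $\pi_X(R)$; replace the relations with schema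 inside $X$ by $R_X$. **Split** on a set $S$, with $\mathcal R\subseteq G_1\cup G_2$ where attributes common to $G_1$ and $G_2$ lie in $S\subseteq\mathrm{attr}(G_1)$: compute $R_S=\pi_S(\bowtie G_1)$. If $\mathcal O\subseteq\mathrm{attr}(G_2)$, return $\pi_{\mathcal O}(\bowtie (G_2\cup\{R_S\}))$. If $S\subseteq\mathcal O$, compute $O_2=\pi_{\mathcal O}(\bowtie (G_2\cup\{R_S\}))$, $R_S'=R_S\cap\pi_S(O_2)$, $O_1=\pi_{\mathcal O}(\bowtie(G_1\cup\{R'_S\}))$, and return $R'_S\bowtie O_1\bowtie O_2$. Subproblems are solved recursively until one relation is left. An applicable sequence of transforms is a finite tree of transforms whose input conditions hold and which ends in single relations. *DARTS* (with parameter $K$, the constant in front of $\mathrm{OUT}$) computes degrees, forms all configurations $c$ and all $R(c)$, processes each configuration with no empty $R(c)$ by an applicable sequence of transforms, with $\mathcal O=\mathcal A$, and returns the union of the results. The sequence is chosen from a given repertoire, depending on the query and $c$ only, so that it gives the smallest upper bound on $Q$: the least $x$ such that on every input with configuration $c$ the sequence takes at most $x+K\cdot\mathrm{OUT}$ steps (for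 that configuration's join). *Widths.* A fractional cover of $X$ is $w\ge0$ with $\sum_{R\ni a}w_R\ge1$ for all $a\in X$. $\mathrm{AGM}(X)=\inf_w\prod_R|R|^{w_R}$ and $\rho^*(X)=\inf_w\sum_R w_R$ over fractional covers $w$ of $X$. A GHD is a finite tree with bags $\chi(t)\subseteq\mathcal A$ such that each schema is contained in a bag and, for each attribute, the nodes whose bags contain it form a connected subtree. $\mathrm{fhw}=\min_{\mathrm{GHD}}\max_t\rho^*(\chi(t))$; the size-aware version is $\mathrm{fhw}_I=\min_{\mathrm{GHD}}\max_t\log_{\mathrm{IN}}\mathrm{AGM}(\chi(t))$. A query is $\alpha$-acyclic if it has a join tree on its relations (for each attribute, the relations containing it form a connected subtree). **Theorem.** For every join query: 1. There is $K_0$ such that for every $K\ge K_0$ and every repertoire containing all combinations of Split and Light transforms (for example only these, or all transforms), DARTS outputs the join and takes $$\tilde O(\mathrm{IN}^{\mathrm{fhw}}+\mathrm{OUT})\quad\text{and also}\quad\tilde O(\mathrm{IN}+\mathrm{IN}^{\mathrm{fhw}_I}+\mathrm{OUT})$$ steps, with constants independent of the repertoire. 2. If the query is $\alpha$-acyclic,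 then Split can be applied repeatedly, with $G_1$ an ear $R_1$ each time and $S=\mathrm{attr}(R_1)\cap\mathrm{attr}(R_2)$, where $R_2\ne R_1$ is a relation containing every attribute of $R_1$ that occurs in another relation (and with $R_S$, $R'_S$ absorbed into the containing relation $R_2$, $R_1$ by a Light transform on its schema), until one relation is left. For every such sequence, processing each degree configuration by it outputs the join in $\tilde O(\mathrm{IN}+\mathrm{OUT})$ steps. 3. For every degree configuration $c$ with no empty $R(c)$, the cost bound $\mathrm{IN}^{\mathrm{DBP}(\mathcal R(c))}$ of a single Light transform on $\mathcal A$ is at most $\mathrm{AGM}(\mathcal A)$, the AGM bound of the input; and processing each configuration by this single Light transform outputs the join in $\tilde O(\mathrm{IN}+\mathrm{AGM}(\mathcal A))$ steps in total. -/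

import Mathlib

/-! ## Tuples, relations, and the unit-cost evaluation primitive -/

/-- A tuple over the attributes `V` with values in `D`; `none` marks attributes outside its schema. -/
abbrev Tup (V D : Type*) := V → Option D

/-- A relation: its schema (set of attributes) and its finite set of tuples. -/
structure Table (V D : Type*) where
  schema : Finset V
  rows : Finset (Tup V D)

section Relations

variable {V D : Type*} [Fintype V] [DecidableEq V] [DecidableEq D]

/-- `π_A(t)`. -/
def restrict (A : Finset V) (t : Tup V D) : Tup V D := fun a => if a ∈ A then t a else none

/-- Two tuples agree on all attributes that both of them have. -/
def Compat (t r : Tup V D) : Prop := ∀ a, t a = none ∨ r a = none ∨ t a = r a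

instance (t r : Tup V D) : Decidable (Compat t r) := by unfold Compat; infer_instance

/-- The tuple with the attributes of both `t` and `r` (used for compatible tuples). -/
def merge (t r : Tup V D) : Tup V D := fun a => (t a).or (r a)

/-- The tuple without attributes. -/
def emptyTup : Tup V D := fun _ => none

/-- `π_A(R)`. -/
def Table.proj (A : Finset V) (R : Table V D) : Table V D :=
  ⟨R.schema ∩ A, R.rows.image (restrict A)⟩

/-- `deg(v, R, A)`: the number of tuples of `R` whose projection to `A` is `v`. -/
def deg (v : Tup V D) (R : Finset (Tup V D)) (A : Finset V) : ℕ :=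
  (R.filter fun t => restrict A t = v).card

/-- `d_{R,A}`: the maximal degree in `R` of a value of `A`. -/
def maxDeg (R : Table V D) (A : Finset V) : ℕ :=
  R.rows.sup fun t => deg (restrict A t) R.rows A

/-- Total number of tuples of a list of relations. -/
def tableSize (Rs : List (Table V D)) : ℕ := (Rs.map fun R => R.rows.card).sum

/-- Union of a list of schemas. -/
def unionAll (l : List (Finset V)) : Finset V := l.foldr (· ∪ ·) ∅

/-- All attributes of a list of relations. -/
def attrs (Rs : List (Table V D)) : Finset V := unionAll (Rs.map Table.schema)

/-- Nested-loop evaluation of a join in the given order: the current partial tuple `t` is extended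
by every matching row of the next relation. -/
def loopRows : List (Table V D) → Tup V D → Finset (Tup V D)
  | [], t => {t}
  | R :: Rs, t => (R.rows.filter (Compat t)).biUnion fun r => loopRows Rs (merge t r)

/-- Steps of the nested loop: one step per emitted tuple, and one step per index lookup that
returns the list of the matching rows, each of which is then visited in turn. -/
def loopSteps : List (Table V D) → Tup V D → ℕ
  | [], _ => 1
  | R :: Rs, t => 1 + ∑ r ∈ R.rows.filter (Compat t), loopSteps Rs (merge t r)

/-- Steps of a join evaluation: one step per row for building the indexes, then the nested loop. -/
def joinSteps (Rs : List (Table V D)) : ℕ := tableSize Rs + loopSteps Rs emptyTup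

/-! ## Degree-based packing -/

/-- A cover of the attribute set `X` by pairs `(R, A)` with `A ⊆ attr(R) ∩ X`, for the join of the
projections `π_X(R)`; relations are referred to by their position in the list. -/
def IsCover (Rs : List (Table V D)) (X : Finset V) (C : Finset (Fin Rs.length × Finset V)) : Prop :=
  (∀ p ∈ C, p.2 ⊆ (Rs.get p.1).schema ∩ X) ∧ C.biUnion Prod.snd = X

/-- Optimal value of the linear program that belongs to a cover, with bucket range `2` and in
natural logarithms (so the exponential of the value is the bound, whatever the base used). -/
noncomputable def coverValue (Rs : List (Table V D)) (X : Finset V)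
    (C : Finset (Fin Rs.length × Finset V)) : ℝ :=
  sInf {x : ℝ | ∃ v : V → ℝ,
    (∀ p ∈ C, ∀ A' ⊆ p.2,
      Real.log ((maxDeg ((Rs.get p.1).proj p.2) (p.2 \ A') : ℝ) / 2) ≤ ∑ a ∈ A', v a) ∧
    x = ∑ a ∈ X, v a}

/-- The degree-based packing bound `IN ^ DBP` of the join of the projections `π_X(R)`. -/
noncomputable def dbpBound (Rs : List (Table V D)) (X : Finset V) : ℝ :=
  Real.exp (sInf {x : ℝ | ∃ C, IsCover Rs X C ∧ x = coverValue Rs X C})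

open Classical in
/-- A cover whose linear program has the smallest value. -/
noncomputable def bestCover (Rs : List (Table V D)) (X : Finset V) :
    Finset (Fin Rs.length × Finset V) :=
  if h : ∃ C, IsCover Rs X C ∧ ∀ C', IsCover Rs X C' → coverValue Rs X C ≤ coverValue Rs X C'
  then h.choose else ∅

/-! ## The transforms -/

/-- The tables of the Light transform, in the order of evaluation: first the projections `π_A(R)`,
`(R, A)` in the cover; then every `π_X(R)`, as a semijoin filter. -/
noncomputable def lightTables (Rs : List (Table V D)) (X : Finset V)
    (C : Finset (Fin Rs.length × Finset V)) : List (Table V D) :=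
  (C.toList.map fun p => (Rs.get p.1).proj p.2) ++ Rs.map (Table.proj X)

/-- `R_X`, the join of all `π_X(R)`. -/
noncomputable def lightRel (Rs : List (Table V D)) (X : Finset V) : Table V D :=
  ⟨X, loopRows (lightTables Rs X (bestCover Rs X)) emptyTup⟩

/-- The relations after the Light transform. -/
noncomputable def lightReduce (Rs : List (Table V D)) (X : Finset V) : List (Table V D) :=
  lightRel Rs X :: Rs.filter fun R => ¬ R.schema ⊆ X

/-- Steps of the Light transform: computing all projections and all degrees in them, with one scan
per pair `A ⊆ B ⊆ attr(R)`; then the join. -/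
noncomputable def lightSteps (Rs : List (Table V D)) (X : Finset V) : ℕ :=
  (Rs.map fun R => ∑ B ∈ R.schema.powerset, ∑ _A ∈ B.powerset, R.rows.card).sum
    + joinSteps (lightTables Rs X (bestCover Rs X))

/-- The relations that contain the attribute `X`. -/
def heavyRels (Rs : List (Table V D)) (X : V) : List (Table V D) := Rs.filter fun R => X ∈ R.schema

/-- The values of `X` that lie in all relations containing `X` (as tuples over `{X}`). -/
def heavyVals (Rs : List (Table V D)) (X : V) : Finset (Tup V D) :=
  loopRows ((heavyRels Rs X).map (Table.proj {X})) emptyTup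

/-- `π_{V \ X} σ_{X = x} R`. -/
def heavySelect (X : V) (x : Tup V D) (R : Table V D) : Table V D :=
  ⟨R.schema.erase X, (R.rows.filter (Compat x)).image (restrict (R.schema.erase X))⟩

/-- The relations of the problem marginalized on `x`. -/
def heavyReduce (Rs : List (Table V D)) (X : V) (x : Tup V D) : List (Table V D) :=
  Rs.map fun R => if X ∈ R.schema then heavySelect X x R else R

/-- The sublist of the positions selected by `m`. -/
def pick {α : Type*} : (ℕ → Bool) → List α → List α
  | _, [] => []
  | m, a :: l => if m 0 then a :: pick (fun n => m (n + 1)) l else pick (fun n => m (n + 1)) l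

end Relations

/-- A combination of transforms, applied until one relation is left. A Split carries its
articulation set `S`, the positions `m₁`, `m₂` of the relations of `G₁`, `G₂`, and the
continuations for the subproblems: `splitOut` is the case `S ⊆ O`, `splitProj` is the case
`O ⊆ attr(G₂)`. -/
inductive Plan (V : Type*)
  | done : Plan V
  | heavy (X : V) (p : Plan V) : Plan V
  | light (X : Finset V) (p : Plan V) : Plan V
  | splitOut (S : Finset V) (m₁ m₂ : ℕ → Bool) (p₁ p₂ p₃ : Plan V) : Plan V
  | splitProj (S : Finset V) (m₁ m₂ : ℕ → Bool) (p₁ p₂ : Plan V) : Plan V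

namespace Plan

variable {V D : Type*} [Fintype V] [DecidableEq V] [DecidableEq D]

/-- The relation computed by a plan for the problem `π_O(⋈ Rs)`. -/
noncomputable def out : Plan V → List (Table V D) → Finset V → Table V D
  | done, Rs, O => ⟨O, (loopRows Rs emptyTup).image (restrict O)⟩
  | heavy X p, Rs, O =>
      ⟨O, (heavyVals Rs X).biUnion fun x =>
        (out p (heavyReduce Rs X x) (O.erase X)).rows.image (merge (restrict O x))⟩
  | light X p, Rs, O => out p (lightReduce Rs X) O
  | splitOut S m₁ m₂ p₁ p₂ p₃, Rs, O =>
      let G₁ := pick m₁ Rs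
      let G₂ := pick m₂ Rs
      let RS := out p₁ G₁ S
      let O₂ := out p₂ (RS :: G₂) (O ∩ (S ∪ attrs G₂))
      let RS' : Table V D := ⟨S, RS.rows ∩ (O₂.proj S).rows⟩
      let O₁ := out p₃ (RS' :: G₁) (O ∩ attrs G₁)
      ⟨O, loopRows [RS', O₁, O₂] emptyTup⟩
  | splitProj S m₁ m₂ p₁ p₂, Rs, O =>
      out p₂ (out p₁ (pick m₁ Rs) S :: pick m₂ Rs) O

/-- The number of steps a plan takes on the problem `π_O(⋈ Rs)`. -/
noncomputable def steps : Plan V → List (Table V D) → Finset V → ℕ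
  | done, Rs, _ => joinSteps Rs
  | heavy X p, Rs, O =>
      2 * tableSize (heavyRels Rs X) + joinSteps ((heavyRels Rs X).map (Table.proj {X}))
        + ∑ x ∈ heavyVals Rs X,
            (tableSize ((heavyRels Rs X).map (heavySelect X x))
              + steps p (heavyReduce Rs X x) (O.erase X)
              + (out p (heavyReduce Rs X x) (O.erase X)).rows.card)
  | light X p, Rs, O => lightSteps Rs X + steps p (lightReduce Rs X) O
  | splitOut S m₁ m₂ p₁ p₂ p₃, Rs, O =>
      let G₁ := pick m₁ Rs
      let G₂ := pick m₂ Rs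
      let RS := out p₁ G₁ S
      let O₂ := out p₂ (RS :: G₂) (O ∩ (S ∪ attrs G₂))
      let RS' : Table V D := ⟨S, RS.rows ∩ (O₂.proj S).rows⟩
      let O₁ := out p₃ (RS' :: G₁) (O ∩ attrs G₁)
      steps p₁ G₁ S + steps p₂ (RS :: G₂) (O ∩ (S ∪ attrs G₂)) + tableSize [RS, O₂]
        + steps p₃ (RS' :: G₁) (O ∩ attrs G₁) + joinSteps [RS', O₁, O₂]
  | splitProj S m₁ m₂ p₁ p₂, Rs, O =>
      steps p₁ (pick m₁ Rs) S + steps p₂ (out p₁ (pick m₁ Rs) S :: pick m₂ Rs) O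

/-- The conditions on the two parts of a Split: every relation is in a part, attributes common to
both parts lie in `S`, and `S` consists of attributes of the first part. -/
def Separates (S : Finset V) (m₁ m₂ : ℕ → Bool) (l : List (Finset V)) : Prop :=
  (∀ i < l.length, m₁ i = true ∨ m₂ i = true) ∧
  unionAll (pick m₁ l) ∩ unionAll (pick m₂ l) ⊆ S ∧ S ⊆ unionAll (pick m₁ l)

/-- A plan is applicable to relations with schemas `l` and output attributes `O`: the input
conditions of all its transforms hold, and each branch ends with a single relation. -/
def Valid : Plan V → List (Finset V) → Finset V → Prop
  | done, l, O => ∃ s, l = [s] ∧ O ⊆ s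
  | heavy X p, l, O => X ∈ unionAll l ∧ Valid p (l.map fun s => s.erase X) (O.erase X)
  | light X p, l, O => X ⊆ unionAll l ∧ Valid p (X :: l.filter fun s => ¬ s ⊆ X) O
  | splitOut S m₁ m₂ p₁ p₂ p₃, l, O =>
      Separates S m₁ m₂ l ∧ S ⊆ O ∧ Valid p₁ (pick m₁ l) S ∧
      Valid p₂ (S :: pick m₂ l) (O ∩ (S ∪ unionAll (pick m₂ l))) ∧
      Valid p₃ (S :: pick m₁ l) (O ∩ unionAll (pick m₁ l))
  | splitProj S m₁ m₂ p₁ p₂, l, O =>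
      Separates S m₁ m₂ l ∧ O ⊆ unionAll (pick m₂ l) ∧ Valid p₁ (pick m₁ l) S ∧
      Valid p₂ (S :: pick m₂ l) O

/-- The plan uses Split and Light transforms only. -/
def SplitLight : Plan V → Prop
  | done => True
  | heavy _ _ => False
  | light _ p => SplitLight p
  | splitOut _ _ _ p₁ p₂ p₃ => SplitLight p₁ ∧ SplitLight p₂ ∧ SplitLight p₃
  | splitProj _ _ _ p₁ p₂ => SplitLight p₁ ∧ SplitLight p₂

/-- The relation at position `k` is an ear with witness at position `j`: each of its attributes
occurs in no other relation or occurs in the witness. -/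
def IsEar (l : List (Finset V)) (k j : Fin l.length) : Prop :=
  k ≠ j ∧ ∀ a ∈ l.get k, a ∈ l.get j ∨ ∀ i, i ≠ k → a ∉ l.get i

/-- Repeated Split on ears. `G₁` is an ear `R₁` with witness `R₂`, and `S = attr(R₁) ∩ attr(R₂)`;
wherever `R_S` has been added next to a relation that contains its schema, it is absorbed into that
relation by the Light transform on the schema of the latter. -/
inductive EarPlan : Plan V → List (Finset V) → Prop
  | single (s : Finset V) : EarPlan done [s]
  | step (l : List (Finset V)) (k j : Fin l.length) (p : Plan V) (hear : IsEar l k j)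
      (hp : EarPlan p (l.get j ::
        ((l.get k ∩ l.get j) :: l.eraseIdx k).filter fun s => ¬ s ⊆ l.get j)) :
      EarPlan (splitOut (l.get k ∩ l.get j) (fun i => i == k.1) (fun i => i != k.1)
        done (light (l.get j) p) (light (l.get k) done)) l

end Plan

/-! ## Queries, instances, degree uniformization, and DARTS -/

/-- A join query: the schemas of its `m` relations; every attribute occurs in some relation. -/
structure Query (V : Type*) (m : ℕ) where
  schema : Fin m → Finset V
  covered : ∀ a, ∃ i, a ∈ schema i

/-- An input of the query: a nonempty finite relation for each schema. -/
structure Inst {V : Type*} {m : ℕ} (q : Query V m) (D : Type*) where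
  rows : Fin m → Finset (Tup V D)
  wf : ∀ i, ∀ t ∈ rows i, ∀ a, (t a).isSome ↔ a ∈ q.schema i
  nonempty : ∀ i, (rows i).Nonempty

/-- A degree configuration: the index `l` of the bucket `[2^l, 2^(l+1))` for each relation and each
set of its attributes (and `0` for other sets). -/
abbrev Config (V : Type*) (m : ℕ) := Fin m → Finset V → ℕ

section Darts

variable {V : Type*} [Fintype V] [DecidableEq V] {m : ℕ} {q : Query V m}
  {D : Type*} [DecidableEq D]

/-- The list of the schemas of a query. -/
def Query.schemas (q : Query V m) : List (Finset V) := List.ofFn q.schema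

/-- The join: all tuples over `V` whose projection to each schema is in the relation. -/
def joinSet (q : Query V m) (R : Fin m → Finset (Tup V D)) : Set (Tup V D) :=
  {t | (∀ a, (t a).isSome) ∧ ∀ i, restrict (q.schema i) t ∈ R i}

/-- Input size. -/
def Inst.IN (I : Inst q D) : ℕ := ∑ i, (I.rows i).card

/-- Output size. -/
noncomputable def Inst.OUT (I : Inst q D) : ℕ := (joinSet q I.rows).ncard

/-- The set of all degree configurations (bucket range `2`). -/
def Inst.configs (I : Inst q D) : Finset (Config V m) :=
  (Fintype.piFinset fun i => Fintype.piFinset fun A =>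
    if A ⊆ q.schema i then Finset.range (Nat.log 2 (I.rows i).card + 1) else {0}).filter
  fun c => ∀ i, c i (q.schema i) = 0 ∧ c i ∅ = Nat.log 2 (I.rows i).card ∧
    ∀ A' A, A' ⊆ A → A ⊆ q.schema i → c i A ≤ c i A'

/-- `R(c)`: the tuples all of whose degrees are in the buckets prescribed by `c`. -/
def Inst.part (I : Inst q D) (c : Config V m) (i : Fin m) : Finset (Tup V D) :=
  (I.rows i).filter fun t =>
    ∀ A ∈ (q.schema i).powerset, Nat.log 2 (deg (restrict A t) (I.rows i) A) = c i A

/-- The relations `R(c)` as a list. -/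
def Inst.parts (I : Inst q D) (c : Config V m) : List (Table V D) :=
  List.ofFn fun i => ⟨q.schema i, I.part c i⟩

/-- The degree configurations for which no `R(c)` is empty. -/
def Inst.liveConfigs (I : Inst q D) : Finset (Config V m) :=
  I.configs.filter fun c => ∀ i, (I.part c i).Nonempty

/-- The output of the join procedure with degree uniformization, where the configuration `c` is
processed by the plan `choice c`. -/
noncomputable def runOut (choice : Config V m → Plan V) (I : Inst q D) : Finset (Tup V D) :=
  I.liveConfigs.biUnion fun c => ((choice c).out (I.parts c) Finset.univ).rows

/-- Its number of steps: two scans of `R` for each `A ⊆ attr(R)`, to compute the degrees and the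
bucket of each tuple; then, for each configuration, fetching the relations `R(c)` and, unless one
of them is empty, running the plan and writing the result to the output. -/
noncomputable def runSteps (choice : Config V m → Plan V) (I : Inst q D) : ℕ :=
  (∑ i, ∑ _A ∈ (q.schema i).powerset, 2 * (I.rows i).card)
  + (∑ c ∈ I.configs, (1 + ∑ i, (1 + (I.part c i).card)))
  + ∑ c ∈ I.liveConfigs, ((choice c).steps (I.parts c) Finset.univ
      + ((choice c).out (I.parts c) Finset.univ).rows.card)

/-- The bound that a plan gives on `Q(G)` for the problem `G` with the degree configuration `c`:
the smallest `x` such that, on every input with this configuration, the plan takes at most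
`x + K * OUT` steps. -/
noncomputable def qBound (q : Query V m) (D : Type*) [DecidableEq D] (K : ℕ) (c : Config V m)
    (p : Plan V) : ℕ∞ :=
  ⨆ I : {I : Inst q D // c ∈ I.liveConfigs},
    ((p.steps (I.1.parts c) Finset.univ - K * (joinSet q (I.1.part c)).ncard : ℕ) : ℕ∞)

open Classical in
/-- The plan that DARTS chooses for a degree configuration: among the applicable plans of its
repertoire, one with the smallest bound on `Q(G)`. -/
noncomputable def dartsChoice (q : Query V m) (D : Type*) [DecidableEq D] (K : ℕ)
    (rep : Set (Plan V)) (c : Config V m) : Plan V :=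
  if h : ∃ p, (p ∈ rep ∧ p.Valid q.schemas Finset.univ) ∧
      ∀ p', p' ∈ rep ∧ p'.Valid q.schemas Finset.univ → qBound q D K c p ≤ qBound q D K c p'
  then h.choose else Plan.done

/-! ## Covers, decompositions, and widths -/

/-- `w` is a fractional cover of the attribute set `X` by the relations of the query. -/
def Query.FracCover (q : Query V m) (X : Finset V) (w : Fin m → ℝ) : Prop :=
  (∀ i, 0 ≤ w i) ∧ ∀ a ∈ X, 1 ≤ ∑ i with a ∈ q.schema i, w i

/-- The AGM bound over the attribute set `X`. -/
noncomputable def Inst.agm (I : Inst q D) (X : Finset V) : ℝ :=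
  sInf {x : ℝ | ∃ w, q.FracCover X w ∧ x = ∏ i, ((I.rows i).card : ℝ) ^ w i}

/-- The fractional edge cover number of `X`. -/
noncomputable def Query.rhoStar (q : Query V m) (X : Finset V) : ℝ :=
  sInf {x : ℝ | ∃ w, q.FracCover X w ∧ x = ∑ i, w i}

/-- A generalized hypertree decomposition with `n` nodes. -/
structure GHD (q : Query V m) (n : ℕ) where
  tree : SimpleGraph (Fin n)
  isTree : tree.IsTree
  bag : Fin n → Finset V
  covers : ∀ i, ∃ t, q.schema i ⊆ bag t
  running : ∀ a, (tree.induce {t | a ∈ bag t}).Connected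

/-- The fractional hypertree width of the hypergraph of the query. -/
noncomputable def Query.fhw (q : Query V m) : ℝ :=
  sInf {x : ℝ | ∃ (n : ℕ) (T : GHD q n), x = ⨆ t, q.rhoStar (T.bag t)}

/-- The fractional hypertree width with the sizes of the relations taken into account. -/
noncomputable def Inst.fhw (I : Inst q D) : ℝ :=
  sInf {x : ℝ | ∃ (n : ℕ) (T : GHD q n), x = ⨆ t, Real.logb I.IN (I.agm (T.bag t))}

/-- The query is α-acyclic: it has a join tree. -/
def Query.AlphaAcyclic (q : Query V m) : Prop :=
  ∃ T : SimpleGraph (Fin m), T.IsTree ∧ ∀ a, (T.induce {i | a ∈ q.schema i}).Connected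

end Darts

/-! The core is a comparison of two linear programs. Fix a degree configuration `c`. Call a
nonnegative vector `v` on the attributes of `X` a packing if, for each relation `i` and each `A ⊆
attr(R_i) ∩ X`, its sum over `A` is at most `(c i ∅ - c i A) * log 2`. Raising the coordinates one
at a time until each is blocked gives a packing in which every attribute lies in a tight set
(`exists_tight`). The tight pairs form a cover. For `A'` inside a tight `A`, subtracting the packing
inequality for `A \ A'` from the equality for `A` shows that `v` solves the program of this cover;
uniformity of degrees enters here, and the factor 2 of a bucket is exactly the 2 divided out in
`coverValue` (`Inst.packs_of_dominates`). On the other hand `v` packs at most `log |R_i|` into each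
`R_i`, so weak duality with fractional covers bounds its total by the logarithm of the AGM bound
(`Inst.packs_agm`). Hence the degree-based packing bound is at most AGM. A nested loop over a cover
costs a constant times the exponential of its program value (`loopSteps_cover`), because each table
multiplies the number of branches by the degree of its already bound attributes. The predicate
`Packs` carries such a certificate `v` and survives the shrinking of tables.

For acyclic schemas, repeated Split on ears is a form of Yannakakis' algorithm. The subproblem left
after removing an ear has as its join a projection of the full join (`joinRows_split`), so no
intermediate result exceeds a constant times the largest table plus OUT (`Plan.EarPlan.steps_le`).
Absorbing `R_S` into a relation is linear, since a relation packs its own schema with its own size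
(`Inst.packs_schema`).

For the hypertree bounds, the bags of a decomposition are thinned to an acyclic antichain. Light
transforms on all bags replace the query by an acyclic one whose tables are bounded by AGM of the
bags, and ears finish (`Query.GoodBags.exists_plan`). DARTS does not know this plan, but chooses one
with a bound on `Q` at least as good. That bound ranges over all inputs with the same configuration;
their relation sizes agree up to a factor 2, so their AGM bounds agree up to `2 ^ m` (`darts_run`).
There are only finitely many bag families, so one `K₀` and one constant serve all of them. The
number of configurations is polylogarithmic, which is the only source of logarithms (`runSteps_le`).

Correctness is separate: each transform preserves the projected join (`Plan.out_eq`), and each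
output tuple belongs to the configuration given by its own degrees (`Inst.exists_config`). -/

/-! ## Acyclic families of sets -/

/-- A multiset of sets that can be built up from a single one by adding ears. -/
inductive Acyc {V : Type*} : Multiset (Finset V) → Prop
  | single (s : Finset V) : Acyc {s}
  | cons (s : Finset V) (M : Multiset (Finset V)) (t : Finset V) (hM : Acyc M) (ht : t ∈ M)
      (h : ∀ a ∈ s, a ∈ t ∨ ∀ r ∈ M, a ∉ r) : Acyc (s ::ₘ M)

theorem SimpleGraph.mem_support_map_iff {α β : Type*} {G : SimpleGraph α} {H : SimpleGraph β}
    (f : G →g H) {u v : α} (p : G.Walk u v) (y : β) :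
    y ∈ (p.map f).support ↔ ∃ x ∈ p.support, f x = y := by
  rw [SimpleGraph.Walk.support_map, List.mem_map]

namespace Acyc

variable {V : Type*} [DecidableEq V]

/-- The added attributes are private to the enlarged set, so the same order of ears still works: an
enlarged witness serves at least as well, and no attribute private to another ear becomes shared. -/
theorem replace {M : Multiset (Finset V)} (hM : Acyc M) {s x : Finset V} (hs : s ∈ M)
    (hsx : s ⊆ x) (hx : ∀ a ∈ x, a ∈ s ∨ ∀ r ∈ M, a ∉ r) : Acyc (x ::ₘ M.erase s) := by
  induction hM generalizing s x with
  | single y =>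
    obtain rfl : s = y := by simpa using hs
    simpa using Acyc.single x
  | cons y M t hM ht h ih =>
    by_cases hsy : s = y
    · subst hsy
      rw [Multiset.erase_cons_head]
      refine .cons x M t hM ht fun a ha => ?_
      rcases hx a ha with h1 | h1
      · exact h a h1
      · exact .inr fun r hr => h1 r (Multiset.mem_cons_of_mem hr)
    · have hsM : s ∈ M := by
        rcases Multiset.mem_cons.1 hs with h1 | h1
        · exact absurd h1 hsy
        · exact h1
      rw [Multiset.erase_cons_tail _ (Ne.symm hsy), Multiset.cons_swap]
      have hM' := ih hsM hsx fun a ha =>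
        (hx a ha).imp_right fun h1 r hr => h1 r (Multiset.mem_cons_of_mem hr)
      by_cases hts : t = s
      · refine .cons y _ x hM' (Multiset.mem_cons_self _ _) fun a ha => ?_
        rcases h a ha with h1 | h1
        · exact .inl (hsx (hts ▸ h1))
        · refine .inr fun r hr hra => ?_
          rcases Multiset.mem_cons.1 hr with rfl | hr
          · rcases hx a hra with h2 | h2
            · exact h1 s hsM h2
            · exact h2 y (Multiset.mem_cons_self _ _) ha
          · exact h1 r (Multiset.mem_of_mem_erase hr) hra
      · refine .cons y _ t hM'
          (Multiset.mem_cons_of_mem ((Multiset.mem_erase_of_ne hts).2 ht)) fun a ha => ?_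
        rcases h a ha with h1 | h1
        · exact .inl h1
        · refine .inr fun r hr hra => ?_
          rcases Multiset.mem_cons.1 hr with rfl | hr
          · rcases hx a hra with h2 | h2
            · exact h1 s hsM h2
            · exact h2 y (Multiset.mem_cons_self _ _) ha
          · exact h1 r (Multiset.mem_of_mem_erase hr) hra

/-- The delicate case is that the latest ear is the containing set `t`. If its witness is `s`
itself, then `t` takes over the place of `s` by `replace`. Otherwise all of `s`, being shared with
`t`, lies in the witness of `t`, and `s` can be dropped earlier. -/
theorem erase {M : Multiset (Finset V)} (hM : Acyc M) {s t : Finset V} (hs : s ∈ M)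
    (ht : t ∈ M.erase s) (hst : s ⊆ t) : Acyc (M.erase s) := by
  induction hM generalizing s t with
  | single y =>
    obtain rfl : s = y := by simpa using hs
    simp at ht
  | cons y M u hM hu h ih =>
    by_cases hsy : s = y
    · subst hsy
      rwa [Multiset.erase_cons_head]
    have hsM : s ∈ M := by
      rcases Multiset.mem_cons.1 hs with h1 | h1
      · exact absurd h1 hsy
      · exact h1
    rw [Multiset.erase_cons_tail _ (Ne.symm hsy)] at ht ⊢
    rcases Multiset.mem_cons.1 ht with rfl | ht
    · by_cases hus : u = s
      · subst hus
        refine hM.replace hsM hst fun a ha => h a ha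
      · have hsu : s ⊆ u := fun a ha => (h a (hst ha)).resolve_right fun h1 => h1 s hsM ha
        have hu' := (Multiset.mem_erase_of_ne hus).2 hu
        exact .cons t _ u (ih hsM hu' hsu) hu' fun a ha =>
          (h a ha).imp_right fun h1 r hr => h1 r (Multiset.mem_of_mem_erase hr)
    · have hM' := ih hsM ht hst
      by_cases hus : u = s
      · exact .cons y _ t hM' ht fun a ha => (h a ha).imp (fun h1 => hst (hus ▸ h1))
          fun h1 r hr => h1 r (Multiset.mem_of_mem_erase hr)
      · exact .cons y _ u hM' ((Multiset.mem_erase_of_ne hus).2 hu) fun a ha =>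
          (h a ha).imp_right fun h1 r hr => h1 r (Multiset.mem_of_mem_erase hr)

/-- This is the effect of a Light transform on the schema `t`: the absorbed sets are erased one at a
time. -/
theorem filter_not_subset {M : Multiset (Finset V)} {t : Finset V} (hM : Acyc (t ::ₘ M)) :
    Acyc (t ::ₘ M.filter fun s => ¬ s ⊆ t) := by
  induction hn : M.card using Nat.strong_induction_on generalizing M with
  | _ n ih =>
    by_cases h : ∃ s ∈ M, s ⊆ t
    · obtain ⟨s, hs, hst⟩ := h
      have h1 : Acyc (t ::ₘ M.erase s) := by
        by_cases hts : t = s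
        · have h2 := hM.erase (s := s) (t := t) (Multiset.mem_cons_of_mem hs)
            (by rw [hts, Multiset.erase_cons_head]; exact hs) hst
          rw [← hts, Multiset.erase_cons_head] at h2
          rwa [← hts, Multiset.cons_erase (hts ▸ hs)]
        · have h2 := hM.erase (s := s) (t := t) (Multiset.mem_cons_of_mem hs)
            (by rw [Multiset.erase_cons_tail _ hts]; exact Multiset.mem_cons_self _ _) hst
          rwa [Multiset.erase_cons_tail _ hts] at h2
      have h3 := ih _ (by rw [← hn]; exact Multiset.card_erase_lt_of_mem hs) h1 rfl
      rw [← Multiset.cons_erase hs, Multiset.filter_cons_of_neg (p := fun s => ¬ s ⊆ t) _ (not_not.2 hst)]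
      exact h3
    · push Not at h
      rwa [Multiset.filter_eq_self.2 h]

theorem exists_antichain {M : Multiset (Finset V)} (hM : Acyc M) :
    ∃ B : Finset (Finset V), Acyc B.val ∧ B.val ≤ M ∧ (∀ s ∈ M, ∃ t ∈ B, s ⊆ t) ∧
      ∀ s ∈ B, ∀ t ∈ B, s ⊆ t → s = t := by
  induction hn : M.card using Nat.strong_induction_on generalizing M with
  | _ n ih =>
    by_cases h : ∃ s ∈ M, ∃ t ∈ M.erase s, s ⊆ t
    · obtain ⟨s, hs, t, ht, hst⟩ := h
      obtain ⟨B, h1, h2, h3, h4⟩ := ih _ (by rw [← hn]; exact Multiset.card_erase_lt_of_mem hs)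
        (hM.erase hs ht hst) rfl
      refine ⟨B, h1, h2.trans (Multiset.erase_le _ _), fun r hr => ?_, h4⟩
      by_cases hrs : r = s
      · obtain ⟨u, hu, htu⟩ := h3 t ht
        exact ⟨u, hu, hrs ▸ hst.trans htu⟩
      · exact h3 r ((Multiset.mem_erase_of_ne hrs).2 hr)
    · push Not at h
      -- Containment is tested against `M.erase s`, so a second copy of `s` would already have been
      -- erased.
      have hnd : M.Nodup := by
        rw [Multiset.nodup_iff_count_le_one]
        intro s
        by_contra hc
        have hs : s ∈ M := Multiset.count_pos.1 (by omega)
        refine h s hs s (Multiset.count_pos.1 ?_) subset_rfl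
        rw [Multiset.count_erase_self]
        omega
      refine ⟨⟨M, hnd⟩, hM, le_rfl, fun s hs => ⟨s, hs, subset_rfl⟩, fun s hs t ht hst => ?_⟩
      by_contra hne
      exact h s hs t ((Multiset.mem_erase_of_ne (Ne.symm hne)).2 ht) hst

omit [DecidableEq V] in
-- A leaf of the tree is an ear with its neighbour as witness. The running intersection property is
-- phrased through paths because in this form it passes directly to the tree without the leaf.
theorem of_tree_aux {ι : Type*} [Fintype ι] (T : SimpleGraph ι) (hT : T.IsTree)
    (χ : ι → Finset V)
    (h : ∀ a, ∀ i j, ∀ p : T.Walk i j, p.IsPath → a ∈ χ i → a ∈ χ j → ∀ x ∈ p.support, a ∈ χ x) :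
    Acyc (Finset.univ.val.map χ) := by
  classical
  induction hn : Fintype.card ι using Nat.strong_induction_on generalizing ι with
  | _ n ih =>
    have := hT.connected.nonempty
    rcases subsingleton_or_nontrivial ι with hι | hι
    · obtain ⟨x⟩ := this
      have : (Finset.univ : Finset ι) = {x} := by ext y; simp [Subsingleton.elim y x]
      rw [this]
      simpa using Acyc.single (χ x)
    obtain ⟨v, hv⟩ := hT.exists_vert_degree_one_of_nontrivial
    have hT' : (T.induce {v}ᶜ).IsTree :=
      ⟨hT.connected.induce_compl_singleton_of_degree_eq_one hv, hT.isAcyclic.induce _⟩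
    obtain ⟨u, huv, hu⟩ := SimpleGraph.degree_eq_one_iff_existsUnique_adj.1 hv
    have ih' := ih (Fintype.card ({v}ᶜ : Set ι)) (by
        rw [← hn]; exact Fintype.card_subtype_lt (x := v) (by simp)) (T.induce {v}ᶜ) hT'
      (fun x => χ x) (by
        intro a i j p hp hi hj x hx
        refine h a i j (p.map (SimpleGraph.Embedding.induce _).toHom)
          ((SimpleGraph.Walk.isPath_map_iff_of_injective Subtype.val_injective).2 hp) hi hj x ?_
        exact (SimpleGraph.mem_support_map_iff (SimpleGraph.Embedding.induce _).toHom p x).2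
          ⟨x, hx, rfl⟩) rfl
    have hmap : (Finset.univ : Finset ({v}ᶜ : Set ι)).val.map (fun x : ({v}ᶜ : Set ι) => χ x)
        = (Finset.univ.erase v).val.map χ := by
      have : (Finset.univ.erase v) = (Finset.univ : Finset ({v}ᶜ : Set ι)).map
          (Function.Embedding.subtype _) := by
        ext x; simp
      rw [this, Finset.map_val, Multiset.map_map]
      rfl
    have hsplit : (Finset.univ : Finset ι).val.map χ
        = χ v ::ₘ (Finset.univ.erase v).val.map χ := by
      rw [← Multiset.map_cons, Finset.erase_val, Multiset.cons_erase (Finset.mem_univ v)]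
    rw [hmap] at ih'
    rw [hsplit]
    refine .cons _ _ (χ u) ih' (Multiset.mem_map.2 ⟨u, ?_, rfl⟩) fun a ha => ?_
    · rw [Finset.mem_val, Finset.mem_erase]
      exact ⟨huv.ne', Finset.mem_univ _⟩
    · by_contra hcon
      push Not at hcon
      obtain ⟨hau, r, hr, har⟩ := hcon
      obtain ⟨x, hx, rfl⟩ := Multiset.mem_map.1 hr
      rw [Finset.mem_val, Finset.mem_erase] at hx
      obtain ⟨p, hp⟩ := hT.connected.exists_isPath v x
      have hnil : ¬ p.Nil := SimpleGraph.Walk.not_nil_of_ne (Ne.symm hx.1)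
      -- Every path leaving the leaf `v` goes through its only neighbour `u`, so a shared attribute
      -- must be in the bag of `u`.
      have h1 := h a v x p hp ha har p.snd (p.getVert_mem_support 1)
      rw [hu _ (p.adj_snd hnil)] at h1
      exact hau h1

omit [DecidableEq V] in
theorem of_tree {ι : Type*} [Fintype ι] (T : SimpleGraph ι) (hT : T.IsTree)
    (χ : ι → Finset V) (h : ∀ a, (T.induce {i | a ∈ χ i}).Connected) :
    Acyc (Finset.univ.val.map χ) := by
  refine of_tree_aux T hT χ fun a i j p hp hi hj x hx => ?_
  obtain ⟨q, hq⟩ := (h a).exists_isPath ⟨i, hi⟩ ⟨j, hj⟩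
  have hq' : (q.map (SimpleGraph.Embedding.induce _).toHom).IsPath :=
    (SimpleGraph.Walk.isPath_map_iff_of_injective Subtype.val_injective).2 hq
  have := congrArg Subtype.val
    ((hT.isAcyclic.subsingleton_path i j).elim ⟨p, hp⟩ ⟨_, hq'⟩)
  simp only at this
  rw [this] at hx
  obtain ⟨y, -, rfl⟩ :=
    (SimpleGraph.mem_support_map_iff (SimpleGraph.Embedding.induce _).toHom q x).1 hx
  exact y.2

end Acyc

/-! ## Semantics of the nested loop -/

section Semantics

set_option linter.unusedSectionVars false

variable {V D : Type*} [Fintype V] [DecidableEq V] [DecidableEq D]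

/-- Every row of the table is defined exactly on the schema. -/
def Table.WF (R : Table V D) : Prop := ∀ r ∈ R.rows, ∀ a, (r a).isSome ↔ a ∈ R.schema

theorem mem_unionAll {l : List (Finset V)} {a : V} : a ∈ unionAll l ↔ ∃ s ∈ l, a ∈ s := by
  induction l with
  | nil => simp [unionAll]
  | cons s l ih =>
    have : unionAll (s :: l) = s ∪ unionAll l := rfl
    rw [this, Finset.mem_union, ih]; simp

theorem mem_attrs {Rs : List (Table V D)} {a : V} : a ∈ attrs Rs ↔ ∃ R ∈ Rs, a ∈ R.schema := by
  simp [attrs, mem_unionAll]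

theorem subset_attrs {Rs : List (Table V D)} {R : Table V D} (h : R ∈ Rs) :
    R.schema ⊆ attrs Rs := fun _ ha => mem_attrs.2 ⟨R, h, ha⟩

theorem restrict_restrict (A B : Finset V) (t : Tup V D) :
    restrict A (restrict B t) = restrict (A ∩ B) t := by
  ext1 a; by_cases h1 : a ∈ A <;> by_cases h2 : a ∈ B <;> simp [restrict, h1, h2]

theorem restrict_restrict_of_subset {A B : Finset V} (h : A ⊆ B) (t : Tup V D) :
    restrict A (restrict B t) = restrict A t := by
  rw [restrict_restrict, Finset.inter_eq_left.2 h]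

theorem isSome_restrict {A : Finset V} {t : Tup V D} {a : V} :
    (restrict A t a).isSome ↔ a ∈ A ∧ (t a).isSome := by
  by_cases h : a ∈ A <;> simp [restrict, h]

theorem restrict_apply_of_mem {A : Finset V} {t : Tup V D} {a : V} (h : a ∈ A) :
    restrict A t a = t a := if_pos h

theorem restrict_eq_self {A : Finset V} {t : Tup V D} (h : ∀ a, (t a).isSome → a ∈ A) :
    restrict A t = t := by
  ext1 a
  by_cases ha : a ∈ A
  · simp [restrict, ha]
  · have : t a = none := by
      by_contra hc; exact ha (h a (Option.isSome_iff_ne_none.2 hc))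
    simp [restrict, ha, this]

theorem restrict_congr {A : Finset V} {t u : Tup V D} (h : ∀ a ∈ A, t a = u a) :
    restrict A t = restrict A u := by
  ext1 a; by_cases ha : a ∈ A <;> simp [restrict, ha]
  rw [h a ha]

theorem apply_eq_of_restrict_eq {A : Finset V} {t u : Tup V D} (h : restrict A t = restrict A u)
    {a : V} (ha : a ∈ A) : t a = u a := by
  have := congrFun h a
  rwa [restrict_apply_of_mem ha, restrict_apply_of_mem ha] at this

theorem merge_apply_left {t r : Tup V D} {a : V} (h : (t a).isSome) : merge t r a = t a := by
  simp only [merge]; obtain ⟨x, hx⟩ := Option.isSome_iff_exists.1 h; simp [hx]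

theorem merge_apply_right {t r : Tup V D} {a : V} (h : ¬ (t a).isSome) : merge t r a = r a := by
  simp only [merge]; simp at h; simp [h]

theorem isSome_merge {t r : Tup V D} {a : V} :
    (merge t r a).isSome ↔ (t a).isSome ∨ (r a).isSome := by
  simp [merge, Option.isSome_or]

theorem merge_apply_of_compat {t r : Tup V D} (h : Compat t r) {a : V} (ha : (r a).isSome) :
    merge t r a = r a := by
  by_cases ht : (t a).isSome
  · rw [merge_apply_left ht]
    rcases h a with h1 | h1 | h1
    · simp [h1] at ht
    · simp [h1] at ha
    · exact h1
  · exact merge_apply_right ht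

/-- The start tuple is arbitrary because the recursion accumulates the chosen rows in it. -/
theorem mem_loopRows {Rs : List (Table V D)} (hwf : ∀ R ∈ Rs, R.WF) {t u : Tup V D} :
    u ∈ loopRows Rs t ↔ (∀ a, (t a).isSome → u a = t a) ∧
      (∀ a, (u a).isSome ↔ (t a).isSome ∨ a ∈ attrs Rs) ∧
      ∀ R ∈ Rs, restrict R.schema u ∈ R.rows := by
  induction Rs generalizing t with
  | nil =>
    simp only [loopRows, Finset.mem_singleton, mem_attrs]
    constructor
    · rintro rfl; simp
    · rintro ⟨h1, h2, -⟩
      ext1 a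
      by_cases ha : (t a).isSome
      · exact h1 a ha
      · have : ¬ (u a).isSome := fun h => ha (by simpa using (h2 a).1 h)
        simp at ha this
        rw [ha, this]
  | cons R Rs ih =>
    have hR := hwf R List.mem_cons_self
    have hattr : ∀ a, a ∈ attrs (R :: Rs) ↔ a ∈ R.schema ∨ a ∈ attrs Rs := fun a => by
      simp [mem_attrs]
    simp only [loopRows, Finset.mem_biUnion, Finset.mem_filter,
      ih fun R h => hwf R (List.mem_cons_of_mem _ h), List.forall_mem_cons, hattr]
    constructor
    · rintro ⟨r, ⟨hr, hc⟩, h1, h2, h3⟩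
      have hu : ∀ a, a ∈ R.schema → u a = r a := fun a ha => by
        have hs := (hR r hr a).2 ha
        rw [h1 a (isSome_merge.2 (.inr hs)), merge_apply_of_compat hc hs]
      refine ⟨fun a ha => by rw [h1 a (isSome_merge.2 (.inl ha)), merge_apply_left ha],
        fun a => by rw [h2, isSome_merge, hR r hr, or_assoc], ?_, h3⟩
      rw [restrict_congr hu, restrict_eq_self fun a => (hR r hr a).1]
      exact hr
    · rintro ⟨h1, h2, h3, h4⟩
      refine ⟨_, ⟨h3, fun a => ?_⟩, fun a ha => ?_, fun a => ?_, h4⟩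
      · by_cases ha : (t a).isSome
        · by_cases hb : a ∈ R.schema
          · exact .inr (.inr (by rw [restrict_apply_of_mem hb, h1 a ha]))
          · exact .inr (.inl (if_neg hb))
        · exact .inl (by simpa using ha)
      · by_cases ht : (t a).isSome
        · rw [merge_apply_left ht, h1 a ht]
        · rw [merge_apply_right ht]
          have := isSome_restrict.1 ((isSome_merge.1 ha).resolve_left ht)
          rw [restrict_apply_of_mem this.1]
      · rw [isSome_merge, hR _ h3, h2, or_assoc]

/-- The join of the relations. -/
abbrev joinRows (Rs : List (Table V D)) : Finset (Tup V D) := loopRows Rs emptyTup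

theorem mem_joinRows {Rs : List (Table V D)} (hwf : ∀ R ∈ Rs, R.WF) {u : Tup V D} :
    u ∈ joinRows Rs ↔ (∀ a, (u a).isSome ↔ a ∈ attrs Rs) ∧
      ∀ R ∈ Rs, restrict R.schema u ∈ R.rows := by
  rw [joinRows, mem_loopRows hwf]
  simp [emptyTup]

theorem joinRows_congr {Rs Rs' : List (Table V D)} (hwf : ∀ R ∈ Rs, R.WF)
    (hwf' : ∀ R ∈ Rs', R.WF) (ha : attrs Rs = attrs Rs')
    (h : ∀ u : Tup V D, (∀ a, (u a).isSome ↔ a ∈ attrs Rs) →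
      ((∀ R ∈ Rs, restrict R.schema u ∈ R.rows) ↔ ∀ R ∈ Rs', restrict R.schema u ∈ R.rows)) :
    joinRows Rs = joinRows Rs' := by
  ext u
  rw [mem_joinRows hwf, mem_joinRows hwf', ← ha]
  exact and_congr_right fun h1 => h u h1

theorem joinRows_single {R : Table V D} (hR : R.WF) : joinRows [R] = R.rows := by
  ext u
  rw [mem_joinRows (by simpa using hR)]
  simp only [mem_attrs, List.mem_singleton, exists_eq_left, forall_eq]
  constructor
  · rintro ⟨h1, h2⟩
    rwa [restrict_eq_self fun a => (h1 a).1] at h2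
  · intro h
    exact ⟨hR u h, by rwa [restrict_eq_self fun a => (hR u h a).1]⟩

theorem Table.WF.proj {R : Table V D} (hR : R.WF) (A : Finset V) : (R.proj A).WF := by
  intro r hr a
  obtain ⟨t, ht, rfl⟩ := Finset.mem_image.1 hr
  rw [isSome_restrict, hR t ht]
  simp [Table.proj, and_comm]

theorem wf_image {T : Finset (Tup V D)} {A B : Finset V}
    (h : ∀ t ∈ T, ∀ a, (t a).isSome ↔ a ∈ B) (hAB : A ⊆ B) :
    (⟨A, T.image (restrict A)⟩ : Table V D).WF := by
  intro r hr a
  obtain ⟨t, ht, rfl⟩ := Finset.mem_image.1 hr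
  rw [isSome_restrict, h t ht]
  exact ⟨And.left, fun h => ⟨h, hAB h⟩⟩

theorem wf_proj_join {Rs : List (Table V D)} (hwf : ∀ R ∈ Rs, R.WF) {O : Finset V}
    (hO : O ⊆ attrs Rs) : (⟨O, (joinRows Rs).image (restrict O)⟩ : Table V D).WF :=
  wf_image (fun _ ht => ((mem_joinRows hwf).1 ht).1) hO

theorem Table.WF.mono {R R' : Table V D} (hR : R.WF) (hs : R'.schema = R.schema)
    (h : R'.rows ⊆ R.rows) : R'.WF := fun r hr a => by rw [hs]; exact hR r (h hr) a

theorem restrict_mem_joinRows {Rs G : List (Table V D)} (hwf : ∀ R ∈ Rs, R.WF)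
    (hG : ∀ R ∈ G, R ∈ Rs) {t : Tup V D} (ht : t ∈ joinRows Rs) :
    restrict (attrs G) t ∈ joinRows G := by
  rw [mem_joinRows hwf] at ht
  rw [mem_joinRows fun R h => hwf R (hG R h)]
  refine ⟨fun a => ?_, fun R hR => ?_⟩
  · rw [isSome_restrict, ht.1]
    refine ⟨And.left, fun h => ⟨h, ?_⟩⟩
    obtain ⟨R, hR, ha⟩ := mem_attrs.1 h
    exact subset_attrs (hG R hR) ha
  · rw [restrict_restrict_of_subset (subset_attrs hR)]
    exact ht.2 R (hG R hR)

/-! ### Counting the steps of the nested loop -/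

/-- The branches are disjoint: a result determines the row chosen from `R` as its restriction to the
schema of `R`. -/
theorem card_loopRows_cons {R : Table V D} {Rs : List (Table V D)}
    (hwf : ∀ R' ∈ R :: Rs, R'.WF) (t : Tup V D) :
    (loopRows (R :: Rs) t).card
      = ∑ r ∈ R.rows.filter (Compat t), (loopRows Rs (merge t r)).card := by
  have hR := hwf R List.mem_cons_self
  rw [loopRows, Finset.card_biUnion]
  intro r hr r' hr' hne
  refine Finset.disjoint_left.2 fun u hu hu' => ?_
  have key : ∀ s ∈ R.rows.filter (Compat t), u ∈ loopRows Rs (merge t s) →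
      restrict R.schema u = s := by
    intro s hs hu
    rw [Finset.mem_filter] at hs
    rw [mem_loopRows fun R h => hwf R (List.mem_cons_of_mem _ h)] at hu
    rw [restrict_congr (u := s), restrict_eq_self fun a => (hR s hs.1 a).1]
    intro a ha
    have := (hR s hs.1 a).2 ha
    rw [hu.1 a (isSome_merge.2 (.inr this)), merge_apply_of_compat hs.2 this]
  exact hne ((key r hr hu).symm.trans (key r' hr' hu'))

/-- The steps count the nodes of the search tree, and one more table adds one more level, whose
nodes are the tuples of the longer join. Iterating, the cost is the sum of the sizes of all prefix
joins. -/
theorem loopSteps_concat {Rs : List (Table V D)} {R : Table V D}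
    (hwf : ∀ R' ∈ Rs ++ [R], R'.WF) (t : Tup V D) :
    loopSteps (Rs ++ [R]) t = loopSteps Rs t + (loopRows (Rs ++ [R]) t).card := by
  induction Rs generalizing t with
  | nil =>
    rw [List.nil_append, card_loopRows_cons hwf]
    simp [loopSteps, loopRows]
  | cons R' Rs ih =>
    rw [List.cons_append] at hwf ⊢
    rw [card_loopRows_cons hwf]
    simp only [loopSteps]
    rw [Finset.sum_congr rfl fun r _ => ih (fun R h => hwf R (List.mem_cons_of_mem _ h))
      (merge t r), Finset.sum_add_distrib, add_assoc]

theorem loopSteps_single {R : Table V D} (hR : R.WF) :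
    loopSteps [R] emptyTup = 1 + R.rows.card := by
  have := loopSteps_concat (Rs := []) (R := R) (by simpa using hR) emptyTup
  rw [List.nil_append] at this
  rw [this]
  simp only [loopSteps]
  rw [show loopRows [R] emptyTup = R.rows from joinRows_single hR]

theorem card_loopRows_le_loopSteps (Rs : List (Table V D)) (t : Tup V D) :
    (loopRows Rs t).card ≤ loopSteps Rs t := by
  induction Rs generalizing t with
  | nil => simp [loopRows, loopSteps]
  | cons R Rs ih =>
    rw [loopRows, loopSteps]
    exact (Finset.card_biUnion_le.trans (Finset.sum_le_sum fun r _ => ih _)).trans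
      (Nat.le_add_left _ _)

/-! ### Splitting a join -/

/-- The two parts share attributes only inside `S`, so tuples that agree on `S` never conflict. -/
theorem glue {Rs G₁ G₂ : List (Table V D)} {S : Finset V} (hwf : ∀ R ∈ Rs, R.WF)
    (hG : ∀ R, R ∈ Rs ↔ R ∈ G₁ ∨ R ∈ G₂) (hS : attrs G₁ ∩ attrs G₂ ⊆ S) (hS₁ : S ⊆ attrs G₁)
    {t₁ t₂ : Tup V D} (h₁ : t₁ ∈ joinRows G₁) (hd : ∀ a, (t₂ a).isSome ↔ a ∈ S ∪ attrs G₂)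
    (h₂ : ∀ R ∈ G₂, restrict R.schema t₂ ∈ R.rows) (h : restrict S t₁ = restrict S t₂) :
    merge t₁ t₂ ∈ joinRows Rs ∧ (∀ a ∈ attrs G₁, merge t₁ t₂ a = t₁ a) ∧
      ∀ a ∈ S ∪ attrs G₂, merge t₁ t₂ a = t₂ a := by
  rw [mem_joinRows fun R hR => hwf R ((hG R).2 (.inl hR))] at h₁
  have e1 : ∀ a ∈ attrs G₁, merge t₁ t₂ a = t₁ a := fun a ha =>
    merge_apply_left ((h₁.1 a).2 ha)
  have e2 : ∀ a ∈ S ∪ attrs G₂, merge t₁ t₂ a = t₂ a := fun a ha => by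
    by_cases h1 : a ∈ attrs G₁
    · have haS : a ∈ S := by
        rcases Finset.mem_union.1 ha with h2 | h2
        · exact h2
        · exact hS (Finset.mem_inter.2 ⟨h1, h2⟩)
      rw [e1 a h1, apply_eq_of_restrict_eq h haS]
    · exact merge_apply_right fun h2 => h1 ((h₁.1 a).1 h2)
  refine ⟨(mem_joinRows hwf).2 ⟨fun a => ?_, fun R hR => ?_⟩, e1, e2⟩
  · rw [isSome_merge, h₁.1, hd, Finset.mem_union]
    constructor
    · rintro (h3 | h3 | h3)
      · obtain ⟨R, hR, ha⟩ := mem_attrs.1 h3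
        exact subset_attrs ((hG R).2 (.inl hR)) ha
      · obtain ⟨R, hR, ha⟩ := mem_attrs.1 (hS₁ h3)
        exact subset_attrs ((hG R).2 (.inl hR)) ha
      · obtain ⟨R, hR, ha⟩ := mem_attrs.1 h3
        exact subset_attrs ((hG R).2 (.inr hR)) ha
    · intro h3
      obtain ⟨R, hR, ha⟩ := mem_attrs.1 h3
      rcases (hG R).1 hR with h4 | h4
      · exact .inl (subset_attrs h4 ha)
      · exact .inr (.inr (subset_attrs h4 ha))
  · rcases (hG R).1 hR with h4 | h4
    · rw [restrict_congr fun a ha => e1 a (subset_attrs h4 ha)]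
      exact h₁.2 R h4
    · rw [restrict_congr fun a ha => e2 a (Finset.mem_union_right _ (subset_attrs h4 ha))]
      exact h₂ R h4

theorem attrs_cons (R : Table V D) (Rs : List (Table V D)) :
    attrs (R :: Rs) = R.schema ∪ attrs Rs := rfl

theorem attrs_of_split {Rs G₁ G₂ : List (Table V D)}
    (hG : ∀ R, R ∈ Rs ↔ R ∈ G₁ ∨ R ∈ G₂) : attrs Rs = attrs G₁ ∪ attrs G₂ := by
  ext a
  simp only [Finset.mem_union, mem_attrs, hG]
  constructor
  · rintro ⟨R, h | h, ha⟩
    · exact .inl ⟨R, h, ha⟩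
    · exact .inr ⟨R, h, ha⟩
  · rintro (⟨R, h, ha⟩ | ⟨R, h, ha⟩)
    · exact ⟨R, .inl h, ha⟩
    · exact ⟨R, .inr h, ha⟩

/-- Each row of `R_S` extends to a tuple of the join of `G₁`, which can be glued on. Thus the
reduced problem has no dangling tuples, which later bounds its output by OUT. -/
theorem joinRows_split {Rs G₁ G₂ : List (Table V D)} {S : Finset V} (hwf : ∀ R ∈ Rs, R.WF)
    (hG : ∀ R, R ∈ Rs ↔ R ∈ G₁ ∨ R ∈ G₂) (hS : attrs G₁ ∩ attrs G₂ ⊆ S) (hS₁ : S ⊆ attrs G₁) :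
    joinRows (⟨S, (joinRows G₁).image (restrict S)⟩ :: G₂)
      = (joinRows Rs).image (restrict (S ∪ attrs G₂)) := by
  have hwf₁ : ∀ R ∈ G₁, R.WF := fun R h => hwf R ((hG R).2 (.inl h))
  have hwf₂ : ∀ R ∈ G₂, R.WF := fun R h => hwf R ((hG R).2 (.inr h))
  ext u
  rw [mem_joinRows (List.forall_mem_cons.2 ⟨wf_proj_join hwf₁ hS₁, hwf₂⟩), attrs_cons,
    List.forall_mem_cons]
  constructor
  · rintro ⟨h1, h2, h3⟩
    rw [Finset.mem_image]
    obtain ⟨t₁, ht₁, he⟩ := Finset.mem_image.1 h2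
    obtain ⟨g1, -, g3⟩ := glue hwf hG hS hS₁ ht₁ h1 h3 he
    exact ⟨_, g1, by rw [restrict_congr g3, restrict_eq_self fun a => (h1 a).1]⟩
  · intro hu
    obtain ⟨t, ht, rfl⟩ := Finset.mem_image.1 hu
    have ht' := (mem_joinRows hwf).1 ht
    refine ⟨fun a => ?_, ?_, fun R hR => ?_⟩
    · rw [isSome_restrict, ht'.1, attrs_of_split hG]
      refine ⟨And.left, fun h => ⟨h, ?_⟩⟩
      rcases Finset.mem_union.1 h with h | h
      · exact Finset.mem_union_left _ (hS₁ h)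
      · exact Finset.mem_union_right _ h
    · rw [restrict_restrict_of_subset Finset.subset_union_left,
        ← restrict_restrict_of_subset hS₁ t]
      exact Finset.mem_image_of_mem _
        (restrict_mem_joinRows hwf (fun R h => (hG R).2 (.inl h)) ht)
    · rw [restrict_restrict_of_subset
        ((subset_attrs hR).trans Finset.subset_union_right)]
      exact ht'.2 R ((hG R).2 (.inr hR))

/-- Since `S ⊆ O`, the witnesses chosen separately for the rows of `O₁` and `O₂` must agree on `S`,
so they glue to one tuple of the full join. -/
theorem joinRows_recombine {Rs G₁ G₂ : List (Table V D)} {S O : Finset V}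
    (hwf : ∀ R ∈ Rs, R.WF) (hG : ∀ R, R ∈ Rs ↔ R ∈ G₁ ∨ R ∈ G₂)
    (hS : attrs G₁ ∩ attrs G₂ ⊆ S) (hS₁ : S ⊆ attrs G₁) (hSO : S ⊆ O) (hO : O ⊆ attrs Rs)
    {O₂ RS' O₁ : Table V D}
    (h₂ : O₂ = ⟨O ∩ (S ∪ attrs G₂), (joinRows Rs).image (restrict (O ∩ (S ∪ attrs G₂)))⟩)
    (h₀ : RS' = ⟨S, (joinRows G₁).image (restrict S) ∩ (O₂.proj S).rows⟩)
    (h₁ : O₁ = ⟨O ∩ attrs G₁, (joinRows (RS' :: G₁)).image (restrict (O ∩ attrs G₁))⟩) :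
    joinRows [RS', O₁, O₂] = (joinRows Rs).image (restrict O) := by
  have hwf₁ : ∀ R ∈ G₁, R.WF := fun R h => hwf R ((hG R).2 (.inl h))
  have hwf₂ : ∀ R ∈ G₂, R.WF := fun R h => hwf R ((hG R).2 (.inr h))
  have hat := attrs_of_split hG
  have wS : RS'.WF := by
    rw [h₀]
    exact (wf_proj_join hwf₁ hS₁).mono rfl Finset.inter_subset_left
  have wS₁ : ∀ R ∈ RS' :: G₁, R.WF := List.forall_mem_cons.2 ⟨wS, hwf₁⟩
  have w2 : O₂.WF := by
    rw [h₂]; exact wf_proj_join hwf (Finset.inter_subset_left.trans hO)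
  have w1 : O₁.WF := by
    rw [h₁]; refine wf_proj_join wS₁ ?_
    rw [attrs_cons]
    exact Finset.inter_subset_right.trans Finset.subset_union_right
  have hsub2 : S ⊆ O ∩ (S ∪ attrs G₂) := Finset.subset_inter hSO Finset.subset_union_left
  have hsub1 : S ⊆ O ∩ attrs G₁ := Finset.subset_inter hSO hS₁
  have hadd : S ∪ ((O ∩ attrs G₁) ∪ ((O ∩ (S ∪ attrs G₂)) ∪ ∅)) = O := by
    ext a
    have := @hSO a
    have h3 := @hO a
    rw [hat] at h3
    simp only [Finset.mem_union, Finset.mem_inter, Finset.notMem_empty] at *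
    tauto
  ext u
  rw [mem_joinRows (by simp only [List.forall_mem_cons]; exact ⟨wS, w1, w2, by simp⟩)]
  simp only [List.forall_mem_cons, attrs_cons]
  rw [show attrs ([] : List (Table V D)) = ∅ from rfl]
  have e0 : RS'.schema = S := by rw [h₀]
  have e1 : O₁.schema = O ∩ attrs G₁ := by rw [h₁]
  have e2 : O₂.schema = O ∩ (S ∪ attrs G₂) := by rw [h₂]
  rw [e0, e1, e2, hadd, Finset.mem_image]
  constructor
  · rintro ⟨hd, h3, h4, h5, -⟩
    rw [h₁] at h4
    obtain ⟨t₁, ht₁, q1⟩ := Finset.mem_image.1 h4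
    rw [h₂] at h5
    obtain ⟨t₂, ht₂, q2⟩ := Finset.mem_image.1 h5
    have ht₁' : t₁ ∈ joinRows G₁ := by
      rw [mem_joinRows wS₁, attrs_cons, e0, Finset.union_eq_right.2 hS₁,
        List.forall_mem_cons] at ht₁
      rw [mem_joinRows hwf₁]
      exact ⟨ht₁.1, ht₁.2.2⟩
    have ht₂' := (mem_joinRows hwf).1 ht₂
    obtain ⟨g1, g2, g3⟩ := glue (t₂ := restrict (S ∪ attrs G₂) t₂) hwf hG hS hS₁ ht₁'
      (fun a => by
        rw [isSome_restrict, ht₂'.1, hat]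
        refine ⟨And.left, fun h => ⟨h, ?_⟩⟩
        rcases Finset.mem_union.1 h with h | h
        · exact Finset.mem_union_left _ (hS₁ h)
        · exact Finset.mem_union_right _ h)
      (fun R hR => by
        rw [restrict_restrict_of_subset ((subset_attrs hR).trans Finset.subset_union_right)]
        exact ht₂'.2 R ((hG R).2 (.inr hR)))
      (by
        rw [restrict_restrict_of_subset Finset.subset_union_left]
        exact restrict_congr fun a ha => (apply_eq_of_restrict_eq q1 (hsub1 ha)).trans
          (apply_eq_of_restrict_eq q2 (hsub2 ha)).symm)
    refine ⟨_, g1, ?_⟩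
    rw [← restrict_eq_self (A := O) (t := u) fun a => (hd a).1]
    refine restrict_congr fun a ha => ?_
    have h6 := hO ha
    rw [hat] at h6
    rcases Finset.mem_union.1 h6 with h7 | h7
    · rw [g2 a h7, apply_eq_of_restrict_eq q1 (Finset.mem_inter.2 ⟨ha, h7⟩)]
    · have h8 := Finset.mem_union_right S h7
      rw [g3 a h8, restrict_apply_of_mem h8,
        apply_eq_of_restrict_eq q2 (Finset.mem_inter.2 ⟨ha, h8⟩)]
  · rintro ⟨t, ht, rfl⟩
    have ht' := (mem_joinRows hwf).1 ht
    have hg1 := restrict_mem_joinRows hwf (fun R h => (hG R).2 (.inl h)) ht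
    have hRS : restrict S t ∈ RS'.rows := by
      rw [h₀, h₂]
      refine Finset.mem_inter.2 ⟨?_, ?_⟩
      · rw [← restrict_restrict_of_subset hS₁ t]
        exact Finset.mem_image_of_mem _ hg1
      · refine Finset.mem_image.2 ⟨_, Finset.mem_image_of_mem _ ht, ?_⟩
        rw [restrict_restrict_of_subset hsub2]
    refine ⟨fun a => ?_, ?_, ?_, ?_, by simp⟩
    · rw [isSome_restrict, ht'.1]
      exact ⟨And.left, fun h => ⟨h, hO h⟩⟩
    · rw [restrict_restrict_of_subset hSO]
      exact hRS
    · rw [restrict_restrict_of_subset Finset.inter_subset_left, h₁]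
      refine Finset.mem_image.2 ⟨restrict (attrs G₁) t, ?_,
        restrict_restrict_of_subset Finset.inter_subset_right _⟩
      rw [mem_joinRows hwf₁] at hg1
      rw [mem_joinRows wS₁, attrs_cons, e0, Finset.union_eq_right.2 hS₁, List.forall_mem_cons,
        e0, restrict_restrict_of_subset hS₁]
      exact ⟨hg1.1, hRS, hg1.2⟩
    · rw [restrict_restrict_of_subset Finset.inter_subset_left, h₂]
      exact Finset.mem_image_of_mem _ ht

end Semantics

/-! ## Correctness of applicable plans -/

section Correctness

set_option linter.unusedSectionVars false

variable {V D : Type*} [Fintype V] [DecidableEq V] [DecidableEq D]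

/-! ### Sublists by position, and the Light transform. -/

theorem pick_map {α β : Type*} (f : α → β) (m : ℕ → Bool) (l : List α) :
    pick m (l.map f) = (pick m l).map f := by
  induction l generalizing m with
  | nil => rfl
  | cons a l ih =>
    simp only [List.map_cons, pick, ih]
    split <;> rfl

theorem mem_pick {α : Type*} {m : ℕ → Bool} {l : List α} {x : α} :
    x ∈ pick m l ↔ ∃ i, ∃ h : i < l.length, m i = true ∧ l[i] = x := by
  induction l generalizing m with
  | nil => simp [pick]
  | cons a l ih =>
    have key : (∃ i, ∃ h : i < (a :: l).length, m i = true ∧ (a :: l)[i] = x) ↔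
        (m 0 = true ∧ a = x) ∨ x ∈ pick (fun n => m (n + 1)) l := by
      rw [ih]
      constructor
      · rintro ⟨i, hi, h1, h2⟩
        cases i with
        | zero => exact .inl ⟨h1, h2⟩
        | succ i => exact .inr ⟨i, by simpa using hi, h1, by simpa using h2⟩
      · rintro (h | ⟨i, hi, h1, h2⟩)
        · exact ⟨0, by simp, h.1, h.2⟩
        · exact ⟨i + 1, by simpa using hi, h1, by simpa using h2⟩
    rw [key, pick]
    split
    · rename_i h
      simp only [h, true_and, List.mem_cons, eq_comm]
    · rename_i h
      simp only [h, false_and, false_or, Bool.false_eq_true]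

theorem Plan.Separates.mem_iff {S : Finset V} {m₁ m₂ : ℕ → Bool} {Rs : List (Table V D)}
    (h : Plan.Separates S m₁ m₂ (Rs.map Table.schema)) (R : Table V D) :
    R ∈ Rs ↔ R ∈ pick m₁ Rs ∨ R ∈ pick m₂ Rs := by
  simp only [mem_pick]
  constructor
  · intro hR
    obtain ⟨i, hi, rfl⟩ := List.mem_iff_getElem.1 hR
    exact (h.1 i (by simpa using hi)).imp (fun h => ⟨i, hi, h, rfl⟩) fun h => ⟨i, hi, h, rfl⟩
  · rintro (⟨i, hi, -, rfl⟩ | ⟨i, hi, -, rfl⟩) <;> exact List.getElem_mem hi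

theorem attrs_pick (m : ℕ → Bool) (Rs : List (Table V D)) :
    unionAll (pick m (Rs.map Table.schema)) = attrs (pick m Rs) := by
  rw [attrs, pick_map]

theorem subset_of_mem_bestCover {Rs : List (Table V D)} {X : Finset V}
    {p : Fin Rs.length × Finset V} (hp : p ∈ bestCover Rs X) :
    p.2 ⊆ (Rs.get p.1).schema ∩ X := by
  rw [bestCover] at hp
  split at hp
  · rename_i h
    exact h.choose_spec.1.1 p hp
  · simp at hp

theorem mem_lightTables {Rs : List (Table V D)} {X : Finset V} {T : Table V D} :
    T ∈ lightTables Rs X (bestCover Rs X) ↔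
      (∃ p ∈ bestCover Rs X, (Rs.get p.1).proj p.2 = T) ∨ ∃ R ∈ Rs, R.proj X = T := by
  simp [lightTables]

theorem wf_lightTables {Rs : List (Table V D)} (hwf : ∀ R ∈ Rs, R.WF) (X : Finset V)
    {T : Table V D} (hT : T ∈ lightTables Rs X (bestCover Rs X)) : T.WF := by
  rcases mem_lightTables.1 hT with ⟨p, -, rfl⟩ | ⟨R, hR, rfl⟩
  · exact (hwf _ (List.get_mem _ _)).proj _
  · exact (hwf R hR).proj _

theorem attrs_lightTables {Rs : List (Table V D)} {X : Finset V} (hX : X ⊆ attrs Rs) :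
    attrs (lightTables Rs X (bestCover Rs X)) = X := by
  ext a
  rw [mem_attrs]
  constructor
  · rintro ⟨T, hT, ha⟩
    rcases mem_lightTables.1 hT with ⟨p, hp, rfl⟩ | ⟨R, hR, rfl⟩
    · exact (Finset.mem_inter.1 (subset_of_mem_bestCover hp (Finset.mem_inter.1 ha).2)).2
    · exact (Finset.mem_inter.1 ha).2
  · intro ha
    obtain ⟨R, hR, haR⟩ := mem_attrs.1 (hX ha)
    exact ⟨_, mem_lightTables.2 (.inr ⟨R, hR, rfl⟩), Finset.mem_inter.2 ⟨haR, ha⟩⟩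

/-- The filters `π_X(R)` alone determine the result, since they imply membership in every `π_A(R)`
with `A ⊆ X`. The cover affects only the cost. -/
theorem mem_lightRel {Rs : List (Table V D)} (hwf : ∀ R ∈ Rs, R.WF) {X : Finset V}
    (hX : X ⊆ attrs Rs) {u : Tup V D} :
    u ∈ (lightRel Rs X).rows ↔ (∀ a, (u a).isSome ↔ a ∈ X) ∧
      ∀ R ∈ Rs, restrict (R.schema ∩ X) u ∈ R.rows.image (restrict X) := by
  rw [lightRel, mem_joinRows (fun R => wf_lightTables hwf X), attrs_lightTables hX]
  refine and_congr_right fun _ => ⟨fun h R hR => ?_, fun h T hT => ?_⟩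
  · exact h _ (mem_lightTables.2 (.inr ⟨R, hR, rfl⟩))
  · rcases mem_lightTables.1 hT with ⟨p, hp, rfl⟩ | ⟨R, hR, rfl⟩
    · have hR : Rs.get p.1 ∈ Rs := List.get_mem _ _
      have hsub := subset_of_mem_bestCover hp
      obtain ⟨t, ht, he⟩ := Finset.mem_image.1 (h _ hR)
      refine Finset.mem_image.2 ⟨t, ht, ?_⟩
      change _ = restrict ((Rs.get p.1).schema ∩ p.2) u
      rw [Finset.inter_eq_right.2 (hsub.trans Finset.inter_subset_left),
        ← restrict_restrict_of_subset (hsub.trans Finset.inter_subset_right) t, he,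
        restrict_restrict_of_subset hsub]
    · exact h R hR

theorem wf_lightRel {Rs : List (Table V D)} (hwf : ∀ R ∈ Rs, R.WF) {X : Finset V}
    (hX : X ⊆ attrs Rs) : (lightRel Rs X).WF :=
  fun _ hr => ((mem_lightRel hwf hX).1 hr).1

/-- Rows of `R_X` restricted to the schema of a relation inside `X` are rows of that relation. -/
theorem restrict_mem_of_mem_lightRel {Rs : List (Table V D)} (hwf : ∀ R ∈ Rs, R.WF)
    {X : Finset V} (hX : X ⊆ attrs Rs) {R : Table V D} (hR : R ∈ Rs) (hRX : R.schema ⊆ X)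
    {u : Tup V D} (hu : u ∈ (lightRel Rs X).rows) : restrict R.schema u ∈ R.rows := by
  have h := ((mem_lightRel hwf hX).1 hu).2 R hR
  obtain ⟨t, ht, he⟩ := Finset.mem_image.1 h
  rw [Finset.inter_eq_left.2 hRX,
    restrict_eq_self fun a ha => hRX ((hwf R hR t ht a).1 ha)] at he
  rwa [← he]

theorem mem_lightReduce {Rs : List (Table V D)} {X : Finset V} {T : Table V D} :
    T ∈ lightReduce Rs X ↔ T = lightRel Rs X ∨ (T ∈ Rs ∧ ¬ T.schema ⊆ X) := by
  simp [lightReduce]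

theorem wf_lightReduce {Rs : List (Table V D)} (hwf : ∀ R ∈ Rs, R.WF) {X : Finset V}
    (hX : X ⊆ attrs Rs) {T : Table V D} (hT : T ∈ lightReduce Rs X) : T.WF := by
  rcases mem_lightReduce.1 hT with rfl | h
  · exact wf_lightRel hwf hX
  · exact hwf T h.1

theorem attrs_lightReduce {Rs : List (Table V D)} {X : Finset V} (hX : X ⊆ attrs Rs) :
    attrs (lightReduce Rs X) = attrs Rs := by
  ext a
  constructor
  · intro ha
    obtain ⟨T, hT, ha⟩ := mem_attrs.1 ha
    rcases mem_lightReduce.1 hT with rfl | h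
    · exact hX ha
    · exact subset_attrs h.1 ha
  · intro ha
    obtain ⟨R, hR, ha⟩ := mem_attrs.1 ha
    by_cases hRX : R.schema ⊆ X
    · exact mem_attrs.2 ⟨_, mem_lightReduce.2 (.inl rfl), hRX ha⟩
    · exact mem_attrs.2 ⟨R, mem_lightReduce.2 (.inr ⟨hR, hRX⟩), ha⟩

theorem joinRows_lightReduce {Rs : List (Table V D)} (hwf : ∀ R ∈ Rs, R.WF) {X : Finset V}
    (hX : X ⊆ attrs Rs) : joinRows (lightReduce Rs X) = joinRows Rs := by
  refine joinRows_congr (fun R => wf_lightReduce hwf hX) hwf (attrs_lightReduce hX)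
    fun u hu => ?_
  rw [attrs_lightReduce hX] at hu
  constructor
  · intro h R hR
    by_cases hRX : R.schema ⊆ X
    · have := restrict_mem_of_mem_lightRel hwf hX hR hRX (h _ (mem_lightReduce.2 (.inl rfl)))
      rwa [restrict_restrict_of_subset (B := (lightRel Rs X).schema) hRX] at this
    · exact h R (mem_lightReduce.2 (.inr ⟨hR, hRX⟩))
  · intro h T hT
    rcases mem_lightReduce.1 hT with rfl | h1
    · change restrict X u ∈ _
      rw [mem_lightRel hwf hX]
      refine ⟨fun a => ?_, fun R hR => ?_⟩
      · rw [isSome_restrict, hu]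
        exact ⟨And.left, fun h => ⟨h, hX h⟩⟩
      · rw [restrict_restrict_of_subset Finset.inter_subset_right]
        refine Finset.mem_image.2 ⟨_, h R hR, ?_⟩
        rw [restrict_restrict, Finset.inter_comm]
    · exact h T h1.1

theorem map_schema_lightReduce (Rs : List (Table V D)) (X : Finset V) :
    (lightReduce Rs X).map Table.schema
      = X :: (Rs.map Table.schema).filter fun s => ¬ s ⊆ X := by
  rw [lightReduce, List.map_cons, List.filter_map]
  rfl

/-! ### Heavy -/

theorem map_schema_heavyReduce (Rs : List (Table V D)) (X : V) (x : Tup V D) :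
    (heavyReduce Rs X x).map Table.schema = (Rs.map Table.schema).map fun s => s.erase X := by
  simp only [heavyReduce, List.map_map]
  refine List.map_congr_left fun R _ => ?_
  by_cases h : X ∈ R.schema <;> simp [h, heavySelect]

theorem attrs_heavyReduce (Rs : List (Table V D)) (X : V) (x : Tup V D) :
    attrs (heavyReduce Rs X x) = (attrs Rs).erase X := by
  ext a
  rw [attrs, map_schema_heavyReduce, mem_unionAll, Finset.mem_erase, mem_attrs]
  simp only [List.mem_map]
  constructor
  · rintro ⟨s, ⟨t, ⟨R, hR, rfl⟩, rfl⟩, ha⟩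
    rw [Finset.mem_erase] at ha
    exact ⟨ha.1, R, hR, ha.2⟩
  · rintro ⟨h, R, hR, ha⟩
    exact ⟨_, ⟨_, ⟨R, hR, rfl⟩, rfl⟩, Finset.mem_erase.2 ⟨h, ha⟩⟩

theorem wf_heavyReduce {Rs : List (Table V D)} (hwf : ∀ R ∈ Rs, R.WF) (X : V) (x : Tup V D)
    {T : Table V D} (hT : T ∈ heavyReduce Rs X x) : T.WF := by
  obtain ⟨R, hR, rfl⟩ := List.mem_map.1 hT
  split
  · exact wf_image (fun t ht a => hwf R hR t (Finset.filter_subset _ _ ht) a)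
      (Finset.erase_subset _ _)
  · exact hwf R hR

theorem mem_heavyVals {Rs : List (Table V D)} (hwf : ∀ R ∈ Rs, R.WF) {X : V}
    (hX : X ∈ attrs Rs) {x : Tup V D} :
    x ∈ heavyVals Rs X ↔ (∀ a, (x a).isSome ↔ a = X) ∧
      ∀ R ∈ Rs, X ∈ R.schema → x ∈ R.rows.image (restrict {X}) := by
  have hmem : ∀ R, R ∈ heavyRels Rs X ↔ R ∈ Rs ∧ X ∈ R.schema := by simp [heavyRels]
  have hat : attrs ((heavyRels Rs X).map (Table.proj {X})) = {X} := by
    ext a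
    simp only [mem_attrs, List.mem_map, hmem, Finset.mem_singleton]
    constructor
    · rintro ⟨_, ⟨R, -, rfl⟩, ha⟩
      simpa using (Finset.mem_inter.1 ha).2
    · rintro rfl
      obtain ⟨R, hR, ha⟩ := mem_attrs.1 hX
      exact ⟨_, ⟨R, ⟨hR, ha⟩, rfl⟩, Finset.mem_inter.2 ⟨ha, by simp⟩⟩
  rw [heavyVals, mem_joinRows, hat]
  · simp only [Finset.mem_singleton]
    refine and_congr_right fun hx => ?_
    simp only [List.forall_mem_map, hmem, and_imp]
    refine forall₃_congr fun R hR hXR => ?_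
    change restrict (R.schema ∩ {X}) x ∈ R.rows.image (restrict {X}) ↔ _
    rw [restrict_eq_self]
    intro a ha
    rw [(hx a).1 ha]
    exact Finset.mem_inter.2 ⟨hXR, by simp⟩
  · simp only [List.forall_mem_map, hmem]
    exact fun R hR => (hwf R hR.1).proj _

/-- A tuple of the join is the same as its value at `X` together with a tuple of the problem
marginalized on that value. -/
theorem heavy_out {Rs : List (Table V D)} (hwf : ∀ R ∈ Rs, R.WF) {X : V} (hX : X ∈ attrs Rs)
    (O : Finset V) :
    ((heavyVals Rs X).biUnion fun x =>
      ((joinRows (heavyReduce Rs X x)).image (restrict (O.erase X))).image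
        (merge (restrict O x))) = (joinRows Rs).image (restrict O) := by
  ext u
  simp only [Finset.mem_biUnion, Finset.mem_image, exists_exists_and_eq_and]
  constructor
  · rintro ⟨x, hx, s, hs, rfl⟩
    rw [mem_heavyVals hwf hX] at hx
    rw [mem_joinRows fun R => wf_heavyReduce hwf X x, attrs_heavyReduce] at hs
    have hxX : (x X).isSome := (hx.1 X).2 rfl
    have hne : ∀ a, a ≠ X → merge x s a = s a := fun a ha =>
      merge_apply_right fun h => ha ((hx.1 a).1 h)
    refine ⟨merge x s, (mem_joinRows hwf).2 ⟨fun a => ?_, fun R hR => ?_⟩, ?_⟩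
    · by_cases ha : a = X
      · subst ha; simp [isSome_merge, hxX, hX]
      · rw [hne a ha, hs.1, Finset.mem_erase]; simp [ha]
    · by_cases hXR : X ∈ R.schema
      · have h1 := hs.2 (heavySelect X x R) (List.mem_map.2 ⟨R, hR, if_pos hXR⟩)
        obtain ⟨r, hr, he⟩ := Finset.mem_image.1 h1
        rw [Finset.mem_filter] at hr
        have : restrict R.schema (merge x s) = r := by
          rw [← restrict_eq_self (A := R.schema) (t := r) fun a => (hwf R hR r hr.1 a).1]
          refine restrict_congr fun a ha => ?_
          by_cases haX : a = X
          · subst haX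
            rw [merge_apply_left hxX]
            rcases hr.2 a with h | h | h
            · simp [h] at hxX
            · have := (hwf R hR r hr.1 a).2 ha
              simp [h] at this
            · exact h
          · rw [hne a haX]
            exact (apply_eq_of_restrict_eq he (Finset.mem_erase.2 ⟨haX, ha⟩)).symm
        rw [this]; exact hr.1
      · have h1 := hs.2 R (List.mem_map.2 ⟨R, hR, if_neg hXR⟩)
        rwa [restrict_congr fun a ha => hne a fun h => hXR (h ▸ ha)]
    · ext1 a
      by_cases haX : a = X
      · subst haX
        by_cases haO : a ∈ O
        · rw [restrict_apply_of_mem haO, merge_apply_left hxX, merge_apply_left,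
            restrict_apply_of_mem haO]
          exact isSome_restrict.2 ⟨haO, hxX⟩
        · simp [merge, restrict, haO]
      · have hxa : x a = none := by
          have := mt (hx.1 a).1 haX; simpa using this
        by_cases haO : a ∈ O <;> simp [merge, restrict, haO, haX, hxa]
  · rintro ⟨t, ht, rfl⟩
    rw [mem_joinRows hwf] at ht
    have htX : (t X).isSome := (ht.1 X).2 hX
    refine ⟨restrict {X} t, (mem_heavyVals hwf hX).2 ⟨fun a => ?_, fun R hR hXR => ?_⟩,
      restrict (Finset.univ.erase X) t, ?_, ?_⟩
    · rw [isSome_restrict, Finset.mem_singleton]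
      exact ⟨And.left, fun h => ⟨h, h ▸ htX⟩⟩
    · refine Finset.mem_image.2 ⟨_, ht.2 R hR, ?_⟩
      rw [restrict_restrict_of_subset (by simpa using hXR)]
    · rw [mem_joinRows fun R => wf_heavyReduce hwf X _, attrs_heavyReduce]
      refine ⟨fun a => ?_, fun T hT => ?_⟩
      · rw [isSome_restrict, ht.1]; simp
      · obtain ⟨R, hR, rfl⟩ := List.mem_map.1 hT
        split
        · rename_i hXR
          change restrict (R.schema.erase X) _ ∈ Finset.image _ _
          rw [restrict_restrict_of_subset (Finset.erase_subset_erase _ (Finset.subset_univ _))]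
          refine Finset.mem_image.2 ⟨_, Finset.mem_filter.2 ⟨ht.2 R hR, fun a => ?_⟩,
            restrict_restrict_of_subset (Finset.erase_subset _ _) _⟩
          by_cases ha : a = X
          · subst ha
            right; right
            rw [restrict_apply_of_mem (by simp), restrict_apply_of_mem hXR]
          · left; simp [restrict, ha]
        · rename_i hXR
          rw [restrict_restrict_of_subset]
          · exact ht.2 R hR
          · intro a ha
            exact Finset.mem_erase.2 ⟨fun h => hXR (h ▸ ha), Finset.mem_univ _⟩
    · ext1 a
      by_cases haX : a = X
      · subst haX
        by_cases haO : a ∈ O <;> simp [merge, restrict, haO]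
      · by_cases haO : a ∈ O <;> simp [merge, restrict, haO, haX]

/-! ### All plans -/

theorem Plan.out_eq (p : Plan V) {Rs : List (Table V D)} (hwf : ∀ R ∈ Rs, R.WF) {O : Finset V}
    (hO : O ⊆ attrs Rs) (hv : p.Valid (Rs.map Table.schema) O) :
    p.out Rs O = ⟨O, (joinRows Rs).image (restrict O)⟩ := by
  induction p generalizing Rs O with
  | done => rfl
  | heavy X p ih =>
    rw [Plan.out, ← heavy_out hwf hv.1 O]
    congr 1
    refine Finset.biUnion_congr rfl fun x _ => ?_
    rw [ih (fun R => wf_heavyReduce hwf X x)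
      (by rw [attrs_heavyReduce]; exact Finset.erase_subset_erase _ hO)
      (by rw [map_schema_heavyReduce]; exact hv.2)]
  | light X p ih =>
    have hX : X ⊆ attrs Rs := hv.1
    rw [Plan.out, ih (fun R => wf_lightReduce hwf hX) (by rwa [attrs_lightReduce hX])
      (by rw [map_schema_lightReduce]; exact hv.2), joinRows_lightReduce hwf hX]
  | splitOut S m₁ m₂ p₁ p₂ p₃ ih₁ ih₂ ih₃ =>
    obtain ⟨hs, hSO, v1, v2, v3⟩ := hv
    have hG := hs.mem_iff
    obtain ⟨-, hS, hS₁⟩ := hs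
    rw [attrs_pick, attrs_pick] at hS
    rw [attrs_pick] at hS₁ v2 v3
    rw [pick_map] at v1 v2 v3
    have hwf₁ : ∀ R ∈ pick m₁ Rs, R.WF := fun R h => hwf R ((hG R).2 (.inl h))
    have hwf₂ : ∀ R ∈ pick m₂ Rs, R.WF := fun R h => hwf R ((hG R).2 (.inr h))
    have e1 := ih₁ hwf₁ hS₁ v1
    simp only [Plan.out, e1]
    rw [ih₂ (O := O ∩ (S ∪ attrs (pick m₂ Rs)))
      (List.forall_mem_cons.2 ⟨wf_proj_join hwf₁ hS₁, hwf₂⟩) Finset.inter_subset_right v2,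
      joinRows_split hwf hG hS hS₁, Finset.image_image]
    have e2 : restrict (D := D) (O ∩ (S ∪ attrs (pick m₂ Rs))) ∘ restrict (S ∪ attrs (pick m₂ Rs))
        = restrict (O ∩ (S ∪ attrs (pick m₂ Rs))) :=
      funext fun t => restrict_restrict_of_subset Finset.inter_subset_right t
    rw [e2]
    -- Stated for every subset `T` of `R_S`, so that it applies to `R_S'` without naming the
    -- intersection.
    have e3 : ∀ T ⊆ (joinRows (pick m₁ Rs)).image (restrict S),
        p₃.out (⟨S, T⟩ :: pick m₁ Rs) (O ∩ attrs (pick m₁ Rs)) = ⟨O ∩ attrs (pick m₁ Rs),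
          (joinRows (⟨S, T⟩ :: pick m₁ Rs)).image (restrict (O ∩ attrs (pick m₁ Rs)))⟩ :=
      fun T hT => ih₃ (List.forall_mem_cons.2
        ⟨Table.WF.mono (R' := ⟨S, T⟩) (wf_proj_join hwf₁ hS₁) rfl hT, hwf₁⟩)
        (Finset.inter_subset_right.trans Finset.subset_union_right) v3
    rw [e3 _ Finset.inter_subset_left]
    congr 1
    exact joinRows_recombine hwf hG hS hS₁ hSO hO rfl rfl rfl
  | splitProj S m₁ m₂ p₁ p₂ ih₁ ih₂ =>
    obtain ⟨hs, hO₂, v1, v2⟩ := hv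
    have hG := hs.mem_iff
    obtain ⟨-, hS, hS₁⟩ := hs
    rw [attrs_pick, attrs_pick] at hS
    rw [attrs_pick] at hS₁ hO₂
    rw [pick_map] at v1 v2
    have hwf₁ : ∀ R ∈ pick m₁ Rs, R.WF := fun R h => hwf R ((hG R).2 (.inl h))
    have hwf₂ : ∀ R ∈ pick m₂ Rs, R.WF := fun R h => hwf R ((hG R).2 (.inr h))
    rw [Plan.out, ih₁ hwf₁ hS₁ v1,
      ih₂ (List.forall_mem_cons.2 ⟨wf_proj_join hwf₁ hS₁, hwf₂⟩)
        (hO₂.trans Finset.subset_union_right) v2, joinRows_split hwf hG hS hS₁,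
      Finset.image_image]
    congr 2
    exact funext fun t => restrict_restrict_of_subset
      (hO₂.trans Finset.subset_union_right) t

end Correctness

/-! ## Degree-based packing and the cost of a Light transform -/

section Packing

set_option linter.unusedSectionVars false

variable {V D : Type*} [Fintype V] [DecidableEq V] [DecidableEq D]

theorem maxDeg_mono {R R' : Table V D} (h : R'.rows ⊆ R.rows) (A : Finset V) :
    maxDeg R' A ≤ maxDeg R A := by
  refine Finset.sup_le fun t ht => ?_
  exact (Finset.card_le_card (Finset.filter_subset_filter _ h)).trans
    (Finset.le_sup (f := fun t => deg (restrict A t) R.rows A) (h ht))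

/-- All matching rows agree with `t` on the bound attributes, so they lie in a single degree class.
-/
theorem card_filter_compat_le {R : Table V D} (hR : R.WF) {t : Tup V D} {B : Finset V}
    (ht : ∀ a ∈ B, (t a).isSome) :
    (R.rows.filter (Compat t)).card ≤ maxDeg R (R.schema ∩ B) := by
  rcases (R.rows.filter (Compat t)).eq_empty_or_nonempty with h | ⟨r₀, h₀⟩
  · simp [h]
  have key : ∀ r ∈ R.rows.filter (Compat t),
      restrict (R.schema ∩ B) r = restrict (R.schema ∩ B) t := fun r hr => by
    rw [Finset.mem_filter] at hr
    refine restrict_congr fun a ha => ?_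
    rw [Finset.mem_inter] at ha
    rcases hr.2 a with h | h | h
    · have := ht a ha.2; simp [h] at this
    · have := (hR r hr.1 a).2 ha.1; simp [h] at this
    · exact h.symm
  refine le_trans (Finset.card_le_card fun r hr => ?_)
    (Finset.le_sup (f := fun t => deg (restrict (R.schema ∩ B) t) R.rows (R.schema ∩ B))
      (Finset.mem_filter.1 h₀).1)
  exact Finset.mem_filter.2 ⟨(Finset.mem_filter.1 hr).1, (key r hr).trans (key r₀ h₀).symm⟩

/-- Once all attributes are bound, each filter has at most one matching row and never branches. -/
theorem loopSteps_filters {F : List (Table V D)} (hF : ∀ T ∈ F, T.WF) {B : Finset V}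
    (hFB : ∀ T ∈ F, T.schema ⊆ B) {t : Tup V D} (ht : ∀ a ∈ B, (t a).isSome) :
    loopSteps F t ≤ F.length + 1 := by
  induction F generalizing t with
  | nil => simp [loopSteps]
  | cons R F ih =>
    rw [List.forall_mem_cons] at hF hFB
    have h1 : (R.rows.filter (Compat t)).card ≤ 1 := by
      refine (card_filter_compat_le hF.1 ht).trans (Finset.sup_le fun r hr => ?_)
      rw [Finset.inter_eq_left.2 hFB.1, deg, Finset.card_le_one]
      intro a ha b hb
      rw [Finset.mem_filter] at ha hb
      rw [← restrict_eq_self (A := R.schema) (t := a) fun x => (hF.1 a ha.1 x).1,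
        ← restrict_eq_self (A := R.schema) (t := b) fun x => (hF.1 b hb.1 x).1, ha.2, hb.2]
    have h2 : ∑ r ∈ R.rows.filter (Compat t), loopSteps F (merge t r)
        ≤ (R.rows.filter (Compat t)).card * (F.length + 1) := by
      rw [← smul_eq_mul]
      exact Finset.sum_le_card_nsmul _ _ _ fun r _ => ih hF.2 hFB.2 fun a ha =>
        isSome_merge.2 (.inl (ht a ha))
    rw [loopSteps, List.length_cons]
    nlinarith

/-- With `B` already bound, the next table branches at most `2 * exp` of the weight of its new
attributes, by the constraint for `A' = schema \ B`. Every attribute is new only once, so the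
exponents add up to the weight of `X \ B`. Nonnegativity of `u` lets the single steps be absorbed.
-/
theorem loopSteps_cover {X : Finset V} {u : V → ℝ} (hu : ∀ a ∈ X, 0 ≤ u a)
    {F : List (Table V D)} (hF : ∀ T ∈ F, T.WF) (hFX : ∀ T ∈ F, T.schema ⊆ X)
    {Ts : List (Table V D)} (hTs : ∀ T ∈ Ts, T.WF) (hTX : ∀ T ∈ Ts, T.schema ⊆ X)
    (hdeg : ∀ T ∈ Ts, ∀ A' ⊆ T.schema,
      (maxDeg T (T.schema \ A') : ℝ) ≤ 2 * Real.exp (∑ a ∈ A', u a))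
    {B : Finset V} (hB : X ⊆ B ∪ attrs Ts) {t : Tup V D} (ht : ∀ a ∈ B, (t a).isSome) :
    (loopSteps (Ts ++ F) t : ℝ)
      ≤ (Ts.length + F.length + 1) * 2 ^ Ts.length * Real.exp (∑ a ∈ X \ B, u a) := by
  induction Ts generalizing B t with
  | nil =>
    have h1 := loopSteps_filters hF (B := B) (t := t)
      (fun T hT => (hFX T hT).trans (by simpa [attrs, unionAll] using hB)) ht
    have h2 : 1 ≤ Real.exp (∑ a ∈ X \ B, u a) :=
      Real.one_le_exp (Finset.sum_nonneg fun a ha => hu a (Finset.mem_sdiff.1 ha).1)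
    have h3 : (loopSteps F t : ℝ) ≤ F.length + 1 := by exact_mod_cast h1
    simp only [List.nil_append, List.length_nil, pow_zero, Nat.cast_zero, zero_add, mul_one]
    nlinarith [(Nat.cast_nonneg F.length : (0 : ℝ) ≤ F.length)]
  | cons R Ts ih =>
    rw [List.forall_mem_cons] at hTs hTX hdeg
    set E := Real.exp (∑ a ∈ X \ (B ∪ R.schema), u a) with hE
    set N : ℝ := Ts.length + F.length + 1 with hN
    have hN1 : 1 ≤ N := by rw [hN]; exact le_add_of_nonneg_left (by positivity)
    have hrec : ∀ r ∈ R.rows.filter (Compat t),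
        (loopSteps (Ts ++ F) (merge t r) : ℝ) ≤ N * 2 ^ Ts.length * E := fun r hr => by
      refine ih hTs.2 hTX.2 hdeg.2 (B := B ∪ R.schema) ?_ fun a ha => ?_
      · rwa [attrs_cons, ← Finset.union_assoc] at hB
      · rw [isSome_merge]
        exact (Finset.mem_union.1 ha).imp (ht a)
          (hTs.1 r (Finset.mem_filter.1 hr).1 a).2
    have hcard : ((R.rows.filter (Compat t)).card : ℝ)
        ≤ 2 * Real.exp (∑ a ∈ R.schema \ B, u a) := by
      have h1 : ((R.rows.filter (Compat t)).card : ℝ) ≤ maxDeg R (R.schema ∩ B) := by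
        exact_mod_cast card_filter_compat_le hTs.1 ht
      have h2 := hdeg.1 (R.schema \ B) Finset.sdiff_subset
      rw [show R.schema \ (R.schema \ B) = R.schema ∩ B by ext; simp] at h2
      exact h1.trans h2
    have hsum : ∑ a ∈ X \ B, u a
        = ∑ a ∈ R.schema \ B, u a + ∑ a ∈ X \ (B ∪ R.schema), u a := by
      rw [← Finset.sum_union]
      · congr 1
        ext a
        have := @hTX.1 a
        simp only [Finset.mem_sdiff, Finset.mem_union]
        tauto
      · rw [Finset.disjoint_left]
        intro a
        simp only [Finset.mem_sdiff, Finset.mem_union]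
        tauto
    have hone : 1 ≤ Real.exp (∑ a ∈ X \ B, u a) :=
      Real.one_le_exp (Finset.sum_nonneg fun a ha => hu a (Finset.mem_sdiff.1 ha).1)
    have hexp : Real.exp (∑ a ∈ X \ B, u a) = Real.exp (∑ a ∈ R.schema \ B, u a) * E := by
      rw [hsum, Real.exp_add]
    have hE0 : 0 < E := Real.exp_pos _
    have h2 : (1 : ℝ) ≤ 2 ^ (Ts.length + 1) := one_le_pow₀ (by norm_num)
    calc (loopSteps (R :: Ts ++ F) t : ℝ)
        = 1 + ∑ r ∈ R.rows.filter (Compat t), (loopSteps (Ts ++ F) (merge t r) : ℝ) := by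
          rw [List.cons_append, loopSteps]; push_cast; rfl
      _ ≤ 1 + (R.rows.filter (Compat t)).card * (N * 2 ^ Ts.length * E) := by
          gcongr
          rw [← nsmul_eq_mul]
          exact Finset.sum_le_card_nsmul _ _ _ hrec
      _ ≤ 1 + 2 * Real.exp (∑ a ∈ R.schema \ B, u a) * (N * 2 ^ Ts.length * E) := by
          gcongr
      _ = 1 + N * 2 ^ (Ts.length + 1) * Real.exp (∑ a ∈ X \ B, u a) := by
          rw [hexp]; ring
      _ ≤ 2 ^ (Ts.length + 1) * Real.exp (∑ a ∈ X \ B, u a)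
          + N * 2 ^ (Ts.length + 1) * Real.exp (∑ a ∈ X \ B, u a) := by
          gcongr
          nlinarith
      _ = _ := by rw [List.length_cons, hN]; push_cast; ring

/-- Division by the bucket range allows negative coordinates in the linear program, but none below
`-log 2`. This makes the program bounded and explains the shift by `log 2` in the cost estimate. For
`k = 0` the logarithm is `0` by convention. -/
theorem neg_log_two_le_log_half (k : ℕ) : -Real.log 2 ≤ Real.log ((k : ℝ) / 2) := by
  rcases Nat.eq_zero_or_pos k with rfl | hk
  · simp [Real.log_nonneg]
  · have : (0 : ℝ) < k := by exact_mod_cast hk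
    rw [Real.log_div this.ne' two_ne_zero]
    have : 0 ≤ Real.log (k : ℝ) := Real.log_nonneg (by exact_mod_cast hk)
    linarith

/-- The constraints of the linear program of a cover. -/
def Feasible (Rs : List (Table V D)) (C : Finset (Fin Rs.length × Finset V)) (v : V → ℝ) : Prop :=
  ∀ p ∈ C, ∀ A' ⊆ p.2,
    Real.log ((maxDeg ((Rs.get p.1).proj p.2) (p.2 \ A') : ℝ) / 2) ≤ ∑ a ∈ A', v a

theorem Feasible.neg_log_two_le {Rs : List (Table V D)} {X : Finset V}
    {C : Finset (Fin Rs.length × Finset V)} (hC : IsCover Rs X C) {v : V → ℝ}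
    (hv : Feasible Rs C v) {a : V} (ha : a ∈ X) : -Real.log 2 ≤ v a := by
  rw [← hC.2, Finset.mem_biUnion] at ha
  obtain ⟨p, hp, hap⟩ := ha
  have := hv p hp {a} (by simpa using hap)
  rw [Finset.sum_singleton] at this
  exact (neg_log_two_le_log_half _).trans this

theorem coverValue_le {Rs : List (Table V D)} {X : Finset V}
    {C : Finset (Fin Rs.length × Finset V)} (hC : IsCover Rs X C) {v : V → ℝ}
    (hv : Feasible Rs C v) : coverValue Rs X C ≤ ∑ a ∈ X, v a := by
  refine csInf_le ⟨∑ a ∈ X, -Real.log 2, ?_⟩ ⟨v, hv, rfl⟩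
  rintro _ ⟨w, hw, rfl⟩
  exact Finset.sum_le_sum fun a ha => Feasible.neg_log_two_le hC hw ha

theorem maxDeg_proj_self_le (R : Table V D) (A : Finset V) : maxDeg (R.proj A) A ≤ 1 := by
  refine Finset.sup_le fun t ht => Finset.card_le_one.2 fun a ha b hb => ?_
  rw [Finset.mem_filter] at ha hb
  have key : ∀ r ∈ (R.proj A).rows, restrict A r = r := fun r hr => by
    obtain ⟨s, -, rfl⟩ := Finset.mem_image.1 hr
    exact restrict_restrict_of_subset subset_rfl s
  rw [← key a ha.1, ← key b hb.1, ha.2, hb.2]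

/-- A large constant vector works. Feasibility excludes the default value of `sInf` on the empty
set. -/
theorem exists_feasible (Rs : List (Table V D)) (C : Finset (Fin Rs.length × Finset V)) :
    ∃ v, Feasible Rs C v := by
  set f : Fin Rs.length × Finset V × Finset V → ℝ := fun q =>
    |Real.log ((maxDeg ((Rs.get q.1).proj q.2.1) (q.2.1 \ q.2.2) : ℝ) / 2)|
  refine ⟨fun _ => ∑ q, f q, fun p _ A' hA' => ?_⟩
  have h0 : 0 ≤ ∑ q, f q := Finset.sum_nonneg fun _ _ => abs_nonneg _
  rcases A'.eq_empty_or_nonempty with rfl | hne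
  -- The constraint for `A' = ∅` cannot be met by enlarging `v`; it holds because a projection to
  -- `A` has degree at most 1 over `A`.
  · rw [Finset.sum_empty, Finset.sdiff_empty]
    refine Real.log_nonpos (by positivity) ?_
    have : (maxDeg ((Rs.get p.1).proj p.2) p.2 : ℝ) ≤ 1 := by
      exact_mod_cast maxDeg_proj_self_le _ _
    linarith
  · have h1 : f (p.1, p.2, A') ≤ ∑ q, f q :=
      Finset.single_le_sum (fun _ _ => abs_nonneg _) (Finset.mem_univ _)
    have h2 : (1 : ℝ) ≤ A'.card := by exact_mod_cast hne.card_pos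
    rw [Finset.sum_const, nsmul_eq_mul]
    have := le_abs_self (Real.log ((maxDeg ((Rs.get p.1).proj p.2) (p.2 \ A') : ℝ) / 2))
    change _ ≤ f (p.1, p.2, A') at this
    nlinarith

theorem exists_cover {Rs : List (Table V D)} {X : Finset V} (hX : X ⊆ attrs Rs) :
    ∃ C, IsCover Rs X C := by
  refine ⟨Finset.univ.filter fun p => p.2 ⊆ (Rs.get p.1).schema ∩ X, fun p hp =>
    (Finset.mem_filter.1 hp).2, ?_⟩
  ext a
  rw [Finset.mem_biUnion]
  constructor
  · rintro ⟨p, hp, ha⟩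
    exact (Finset.mem_inter.1 ((Finset.mem_filter.1 hp).2 ha)).2
  · intro ha
    obtain ⟨R, hR, haR⟩ := mem_attrs.1 (hX ha)
    obtain ⟨i, rfl⟩ := List.mem_iff_get.1 hR
    refine ⟨(i, {a}), Finset.mem_filter.2 ⟨Finset.mem_univ _, ?_⟩, by simp⟩
    simpa using ⟨haR, ha⟩

theorem bestCover_spec {Rs : List (Table V D)} {X : Finset V} (hX : X ⊆ attrs Rs) :
    IsCover Rs X (bestCover Rs X) ∧
      ∀ C, IsCover Rs X C → coverValue Rs X (bestCover Rs X) ≤ coverValue Rs X C := by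
  classical
  have h : ∃ C, IsCover Rs X C ∧ ∀ C', IsCover Rs X C' → coverValue Rs X C ≤ coverValue Rs X C' := by
    obtain ⟨C₀, h₀⟩ := exists_cover hX
    obtain ⟨C, hC, hmin⟩ := Finset.exists_min_image (Finset.univ.filter fun C => IsCover Rs X C)
      (coverValue Rs X) ⟨C₀, by simpa using h₀⟩
    exact ⟨C, by simpa using hC, fun C' h' => hmin C' (by simpa using h')⟩
  rw [bestCover, dif_pos h]
  exact h.choose_spec

theorem dbpBound_le {Rs : List (Table V D)} {X : Finset V}
    {C : Finset (Fin Rs.length × Finset V)} (hC : IsCover Rs X C) :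
    dbpBound Rs X ≤ Real.exp (coverValue Rs X C) := by
  refine Real.exp_le_exp.2 (csInf_le (Set.Finite.bddBelow ?_) ⟨C, hC, rfl⟩)
  refine (Set.finite_range (coverValue Rs X)).subset ?_
  rintro _ ⟨C, -, rfl⟩
  exact ⟨C, rfl⟩

/-! ### Packing certificates. -/

/-- The tables `Rs` contain projections that cover `X`, together with a nonnegative solution of
their linear program of value at most `log N`. -/
def Packs (Rs : List (Table V D)) (X : Finset V) (N : ℝ) : Prop :=
  ∃ v : V → ℝ, (∀ a, 0 ≤ v a) ∧ ∑ a ∈ X, v a ≤ Real.log N ∧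
    ∀ a ∈ X, ∃ T ∈ Rs, ∃ A ⊆ T.schema ∩ X, a ∈ A ∧
      ∀ A' ⊆ A, Real.log ((maxDeg (T.proj A) (A \ A') : ℝ) / 2) ≤ ∑ b ∈ A', v b

theorem Packs.mono {Rs Rs' : List (Table V D)} {X : Finset V} {N N' : ℝ} (h : Packs Rs X N)
    (hN : 0 < N) (hNN : N ≤ N')
    (hRs : ∀ T ∈ Rs, ∃ T' ∈ Rs', T'.schema = T.schema ∧ T'.rows ⊆ T.rows) : Packs Rs' X N' := by
  obtain ⟨v, h0, h1, h2⟩ := h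
  refine ⟨v, h0, h1.trans (Real.log_le_log hN hNN), fun a ha => ?_⟩
  obtain ⟨T, hT, A, hA, haA, hv⟩ := h2 a ha
  obtain ⟨T', hT', hs, hr⟩ := hRs T hT
  refine ⟨T', hT', A, hs ▸ hA, haA, fun A' hA' => ?_⟩
  have hle : maxDeg (T'.proj A) (A \ A') ≤ maxDeg (T.proj A) (A \ A') :=
    maxDeg_mono (Finset.image_subset_image hr) _
  -- An emptied table has degree 0 and `log 0 = 0`, which monotonicity of the logarithm does not
  -- cover; here `v ≥ 0` is used.
  rcases Nat.eq_zero_or_pos (maxDeg (T'.proj A) (A \ A')) with h3 | h3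
  · rw [h3]; simpa using Finset.sum_nonneg fun b _ => h0 b
  · refine le_trans (Real.log_le_log (by positivity) ?_) (hv A' hA')
    gcongr

theorem Packs.subset_attrs {Rs : List (Table V D)} {X : Finset V} {N : ℝ} (h : Packs Rs X N) :
    X ⊆ attrs Rs := fun a ha => by
  obtain ⟨v, -, -, h2⟩ := h
  obtain ⟨T, hT, A, hA, haA, -⟩ := h2 a ha
  exact mem_attrs.2 ⟨T, hT, (Finset.mem_inter.1 (hA haA)).1⟩

theorem Packs.exists_cover {Rs : List (Table V D)} {X : Finset V} {N : ℝ} (h : Packs Rs X N) :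
    ∃ C, IsCover Rs X C ∧ coverValue Rs X C ≤ Real.log N := by
  classical
  obtain ⟨v, h0, h1, h2⟩ := h
  -- All pairs whose constraints `v` satisfies; the certificate guarantees that they cover `X`.
  set C : Finset (Fin Rs.length × Finset V) := Finset.univ.filter fun p =>
    p.2 ⊆ (Rs.get p.1).schema ∩ X ∧ ∀ A' ⊆ p.2,
      Real.log ((maxDeg ((Rs.get p.1).proj p.2) (p.2 \ A') : ℝ) / 2) ≤ ∑ a ∈ A', v a with hCdef
  have hC : IsCover Rs X C := by
    refine ⟨fun p hp => (Finset.mem_filter.1 hp).2.1, ?_⟩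
    ext a
    rw [Finset.mem_biUnion]
    constructor
    · rintro ⟨p, hp, ha⟩
      exact (Finset.mem_inter.1 ((Finset.mem_filter.1 hp).2.1 ha)).2
    · intro ha
      obtain ⟨T, hT, A, hA, haA, hv⟩ := h2 a ha
      obtain ⟨i, rfl⟩ := List.mem_iff_get.1 hT
      exact ⟨(i, A), Finset.mem_filter.2 ⟨Finset.mem_univ _, hA, hv⟩, haA⟩
  exact ⟨C, hC, (coverValue_le hC fun p hp => (Finset.mem_filter.1 hp).2.2).trans h1⟩

theorem Packs.dbpBound_le {Rs : List (Table V D)} {X : Finset V} {N : ℝ} (h : Packs Rs X N)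
    (hN : 0 < N) : dbpBound Rs X ≤ N := by
  obtain ⟨C, hC, hv⟩ := h.exists_cover
  rw [← Real.exp_log hN]
  exact (_root_.dbpBound_le hC).trans (Real.exp_le_exp.2 hv)

/-- The constant in the bound for the nested loop of a Light transform on `n` relations. -/
def loopConst (V : Type*) [Fintype V] (n : ℕ) : ℕ :=
  (n * 2 ^ Fintype.card V + n + 1) * 2 ^ (n * 2 ^ Fintype.card V) * 2 ^ Fintype.card V

theorem card_cover_le {n : ℕ} (C : Finset (Fin n × Finset V)) :
    C.card ≤ n * 2 ^ Fintype.card V := by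
  refine (Finset.card_le_univ C).trans_eq ?_
  simp

theorem loopSteps_lightTables_le_of_feasible {Rs : List (Table V D)} (hwf : ∀ R ∈ Rs, R.WF)
    {X : Finset V} {C : Finset (Fin Rs.length × Finset V)} (hC : IsCover Rs X C) {v : V → ℝ}
    (hv : Feasible Rs C v) :
    (loopSteps (lightTables Rs X C) emptyTup : ℝ)
      ≤ loopConst V Rs.length * Real.exp (∑ a ∈ X, v a) := by
  have hlog : 0 ≤ Real.log 2 := Real.log_nonneg one_le_two
  have hsch : ∀ p ∈ C, ((Rs.get p.1).proj p.2).schema = p.2 := fun p hp =>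
    Finset.inter_eq_right.2 ((hC.1 p hp).trans Finset.inter_subset_left)
  -- The shift makes the weights nonnegative and costs a factor 2 per attribute, the last factor of
  -- `loopConst`.
  have main := loopSteps_cover (X := X) (u := fun a => v a + Real.log 2) (B := ∅)
    (t := (emptyTup : Tup V D))
    (fun a ha => by have := Feasible.neg_log_two_le hC hv ha; linarith)
    (F := Rs.map (Table.proj X))
    (by simpa using fun R hR => (hwf R hR).proj X)
    (by
      intro T hT
      obtain ⟨R, -, rfl⟩ := List.mem_map.1 hT
      exact Finset.inter_subset_right)
    (Ts := C.toList.map fun p => (Rs.get p.1).proj p.2)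
    (by
      intro T hT
      obtain ⟨p, -, rfl⟩ := List.mem_map.1 hT
      exact (hwf _ (List.get_mem _ _)).proj _)
    (by
      intro T hT
      obtain ⟨p, hp, rfl⟩ := List.mem_map.1 hT
      rw [Finset.mem_toList] at hp
      rw [hsch p hp]
      exact (hC.1 p hp).trans Finset.inter_subset_right)
    (by
      intro T hT A' hA'
      obtain ⟨p, hp, rfl⟩ := List.mem_map.1 hT
      rw [Finset.mem_toList] at hp
      rw [hsch p hp] at hA' ⊢
      have h1 := hv p hp A' hA'
      have h2 : ∑ a ∈ A', v a ≤ ∑ a ∈ A', (v a + Real.log 2) :=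
        Finset.sum_le_sum fun a _ => by linarith
      rcases Nat.eq_zero_or_pos (maxDeg ((Rs.get p.1).proj p.2) (p.2 \ A')) with h3 | h3
      · rw [h3]; simp [Real.exp_nonneg]
      · have h4 : (0 : ℝ) < maxDeg ((Rs.get p.1).proj p.2) (p.2 \ A') := by exact_mod_cast h3
        have := (Real.log_le_iff_le_exp (by positivity)).1 (h1.trans h2)
        linarith)
    (by
      intro a ha
      rw [← hC.2, Finset.mem_biUnion] at ha
      obtain ⟨p, hp, hap⟩ := ha
      refine Finset.mem_union_right _ (mem_attrs.2 ⟨_, List.mem_map.2 ⟨p, ?_, rfl⟩, ?_⟩)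
      · rwa [Finset.mem_toList]
      · rwa [hsch p hp])
    (by simp)
  refine main.trans ?_
  simp only [List.length_map, Finset.length_toList, Finset.sdiff_empty]
  have hcard := card_cover_le C
  rw [Finset.sum_add_distrib, Finset.sum_const, nsmul_eq_mul, Real.exp_add, mul_comm (X.card : ℝ),
    Real.exp_mul, Real.exp_log two_pos, Real.rpow_natCast, loopConst]
  push_cast
  have h1 : ((C.card : ℕ) : ℝ) ≤ Rs.length * 2 ^ Fintype.card V := by exact_mod_cast hcard
  have h2 : (2 : ℝ) ^ C.card ≤ 2 ^ (Rs.length * 2 ^ Fintype.card V) :=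
    pow_le_pow_right₀ one_le_two hcard
  have h3 : (2 : ℝ) ^ X.card ≤ 2 ^ Fintype.card V :=
    pow_le_pow_right₀ one_le_two (Finset.card_le_univ X)
  refine le_of_le_of_eq (b := ((Rs.length : ℝ) * 2 ^ Fintype.card V + Rs.length + 1)
    * 2 ^ (Rs.length * 2 ^ Fintype.card V)
    * (Real.exp (∑ a ∈ X, v a) * 2 ^ Fintype.card V)) ?_ (by ring)
  gcongr

/-- The bound holds for each feasible `v`, hence for the infimum, whether or not it is attained. -/
theorem loopSteps_lightTables_le {Rs : List (Table V D)} (hwf : ∀ R ∈ Rs, R.WF)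
    {X : Finset V} {C : Finset (Fin Rs.length × Finset V)} (hC : IsCover Rs X C) :
    (loopSteps (lightTables Rs X C) emptyTup : ℝ)
      ≤ loopConst V Rs.length * Real.exp (coverValue Rs X C) := by
  have hc : (0 : ℝ) < loopConst V Rs.length := by
    rw [loopConst]; positivity
  have hpos : (0 : ℝ) < loopSteps (lightTables Rs X C) emptyTup := by
    have : 0 < loopSteps (lightTables Rs X C) (emptyTup : Tup V D) := by
      cases lightTables Rs X C <;> simp [loopSteps]
    exact_mod_cast this
  rw [← div_le_iff₀' hc, ← Real.log_le_iff_le_exp (by positivity)]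
  refine le_csInf ?_ ?_
  · obtain ⟨v, hv⟩ := exists_feasible Rs C
    exact ⟨_, v, hv, rfl⟩
  · rintro _ ⟨v, hv, rfl⟩
    rw [Real.log_le_iff_le_exp (by positivity), div_le_iff₀' hc]
    exact loopSteps_lightTables_le_of_feasible hwf hC hv

theorem Packs.loopSteps_le {Rs : List (Table V D)} (hwf : ∀ R ∈ Rs, R.WF) {X : Finset V}
    {N : ℝ} (h : Packs Rs X N) (hN : 0 < N) :
    (loopSteps (lightTables Rs X (bestCover Rs X)) emptyTup : ℝ)
      ≤ loopConst V Rs.length * N := by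
  obtain ⟨C, hC, hv⟩ := h.exists_cover
  obtain ⟨h1, h2⟩ := bestCover_spec h.subset_attrs
  refine (loopSteps_lightTables_le hwf h1).trans ?_
  gcongr
  rw [← Real.le_log_iff_exp_le hN]
  exact (h2 C hC).trans hv

theorem Packs.card_lightRel_le {Rs : List (Table V D)} (hwf : ∀ R ∈ Rs, R.WF) {X : Finset V}
    {N : ℝ} (h : Packs Rs X N) (hN : 0 < N) :
    ((lightRel Rs X).rows.card : ℝ) ≤ loopConst V Rs.length * N :=
  le_trans (by exact_mod_cast card_loopRows_le_loopSteps _ _) (h.loopSteps_le hwf hN)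

/-- The constant in the bound for the cost of a Light transform on `n` relations. -/
def lightConst (V : Type*) [Fintype V] (n : ℕ) : ℕ :=
  2 ^ Fintype.card V * 2 ^ Fintype.card V * n + (n * 2 ^ Fintype.card V + n) + loopConst V n

theorem tableSize_le {Rs : List (Table V D)} {N : ℕ} (h : ∀ R ∈ Rs, R.rows.card ≤ N) :
    tableSize Rs ≤ Rs.length * N := by
  have := List.sum_le_card_nsmul (Rs.map fun R => R.rows.card) N (by simpa using h)
  simpa [tableSize] using this

theorem lightSteps_le {Rs : List (Table V D)} {X : Finset V} {N : ℕ}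
    (h : ∀ R ∈ Rs, R.rows.card ≤ N) :
    lightSteps Rs X ≤ 2 ^ Fintype.card V * 2 ^ Fintype.card V * Rs.length * N
      + (Rs.length * 2 ^ Fintype.card V + Rs.length) * N
      + loopSteps (lightTables Rs X (bestCover Rs X)) emptyTup := by
  rw [lightSteps, joinSteps, ← add_assoc]
  gcongr
  · have hpow : ∀ A : Finset V, A.powerset.card ≤ 2 ^ Fintype.card V := fun A => by
      rw [Finset.card_powerset]
      exact Nat.pow_le_pow_right two_pos (Finset.card_le_univ A)
    have := List.sum_le_card_nsmul
      (Rs.map fun R => ∑ B ∈ R.schema.powerset, ∑ _A ∈ B.powerset, R.rows.card)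
      (2 ^ Fintype.card V * (2 ^ Fintype.card V * N)) (by
        intro x hx
        obtain ⟨R, hR, rfl⟩ := List.mem_map.1 hx
        refine (Finset.sum_le_card_nsmul _ _ (2 ^ Fintype.card V * N) fun B _ => ?_).trans ?_
        · rw [Finset.sum_const, smul_eq_mul]
          exact Nat.mul_le_mul (hpow B) (h R hR)
        · rw [smul_eq_mul]
          exact Nat.mul_le_mul_right _ (hpow _))
    rw [List.length_map, smul_eq_mul] at this
    refine this.trans_eq (by ring)
  · refine (tableSize_le (N := N) ?_).trans (Nat.mul_le_mul_right _ ?_)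
    · intro T hT
      rcases mem_lightTables.1 hT with ⟨p, -, rfl⟩ | ⟨R, hR, rfl⟩
      · exact Finset.card_image_le.trans (h _ (List.get_mem _ _))
      · exact Finset.card_image_le.trans (h R hR)
    · simp only [lightTables, List.length_append, List.length_map, Finset.length_toList]
      exact Nat.add_le_add_right (card_cover_le _) _

theorem Packs.lightSteps_le {Rs : List (Table V D)} (hwf : ∀ R ∈ Rs, R.WF) {X : Finset V}
    {N : ℝ} (h : Packs Rs X N) (hN : 0 < N) (hR : ∀ R ∈ Rs, (R.rows.card : ℝ) ≤ N) :
    (lightSteps Rs X : ℝ) ≤ lightConst V Rs.length * N := by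
  have h1 : (lightSteps Rs X : ℝ) ≤ _ := Nat.cast_le.2 (_root_.lightSteps_le (X := X)
    (N := ⌊N⌋₊) fun R hR' => Nat.le_floor (hR R hR'))
  push_cast at h1
  have h2 := h.loopSteps_le hwf hN
  have h3 : (⌊N⌋₊ : ℝ) ≤ N := Nat.floor_le hN.le
  refine h1.trans ((add_le_add (add_le_add (mul_le_mul_of_nonneg_left h3 (by positivity))
    (mul_le_mul_of_nonneg_left h3 (by positivity))) h2).trans_eq ?_)
  rw [lightConst]
  push_cast
  ring

end Packing

/-! ## Packing bounds for uniform degrees -/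

section Uniform

set_option linter.unusedSectionVars false

/-- Greedy: raise the coordinate `b` by the least slack of a constraint containing `b`. Tight sets
found earlier do not contain `b`, otherwise `b` would not need raising, so they remain tight. -/
theorem exists_tight {V ι : Type*} [DecidableEq V] [DecidableEq ι] (J : Finset ι)
    (s : ι → Finset V) (h : ι → Finset V → ℝ) (h0 : ∀ i ∈ J, ∀ A ⊆ s i, 0 ≤ h i A)
    (X : Finset V) (hX : ∀ a ∈ X, ∃ i ∈ J, a ∈ s i) :
    ∃ v : V → ℝ, (∀ a, 0 ≤ v a) ∧ (∀ i ∈ J, ∀ A ⊆ s i, ∑ a ∈ A, v a ≤ h i A) ∧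
      ∀ a ∈ X, ∃ i ∈ J, ∃ A ⊆ s i, a ∈ A ∧ ∑ b ∈ A, v b = h i A := by
  induction X using Finset.induction_on with
  | empty => exact ⟨0, by simp, by simpa using h0, by simp⟩
  | insert b X hb ih =>
    obtain ⟨v, v0, v1, v2⟩ := ih fun a ha => hX a (Finset.mem_insert_of_mem ha)
    by_cases ht : ∃ i ∈ J, ∃ A ⊆ s i, b ∈ A ∧ ∑ a ∈ A, v a = h i A
    · exact ⟨v, v0, v1, Finset.forall_mem_insert _ _ _ |>.2 ⟨ht, v2⟩⟩
    · obtain ⟨i₀, hi₀, hbi⟩ := hX b (Finset.mem_insert_self _ _)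
      obtain ⟨p, hp, hmin⟩ := Finset.exists_min_image
        ((J.sigma fun i => (s i).powerset).filter fun p => b ∈ p.2)
        (fun p => h p.1 p.2 - ∑ a ∈ p.2, v a)
        ⟨⟨i₀, {b}⟩, by simpa using ⟨hi₀, hbi⟩⟩
      simp only [Finset.mem_filter, Finset.mem_sigma, Finset.mem_powerset] at hp hmin
      set δ := h p.1 p.2 - ∑ a ∈ p.2, v a with hδ
      have hδ0 : 0 ≤ δ := sub_nonneg.2 (v1 _ hp.1.1 _ hp.1.2)
      have hsum : ∀ A : Finset V, b ∈ A →
          ∑ a ∈ A, Function.update v b (v b + δ) a = ∑ a ∈ A, v a + δ := fun A hA => by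
        rw [Finset.sum_update_of_mem hA, ← Finset.add_sum_erase A v hA,
          Finset.sdiff_singleton_eq_erase]
        ring
      have hsum' : ∀ A : Finset V, b ∉ A →
          ∑ a ∈ A, Function.update v b (v b + δ) a = ∑ a ∈ A, v a := fun A hA =>
        Finset.sum_update_of_notMem hA _ _
      refine ⟨Function.update v b (v b + δ), fun a => ?_, fun i hi A hA => ?_, fun a ha => ?_⟩
      · by_cases hab : a = b
        · subst hab; simpa using add_nonneg (v0 a) hδ0
        · rw [Function.update_of_ne hab]; exact v0 a
      · by_cases hbA : b ∈ A
        · rw [hsum A hbA]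
          have := hmin ⟨i, A⟩ ⟨⟨hi, hA⟩, hbA⟩
          simp only at this
          linarith
        · rw [hsum' A hbA]; exact v1 i hi A hA
      · rcases Finset.mem_insert.1 ha with rfl | ha
        · exact ⟨p.1, hp.1.1, p.2, hp.1.2, hp.2, by rw [hsum _ hp.2, hδ]; ring⟩
        · obtain ⟨i, hi, A, hA, haA, he⟩ := v2 a ha
          refine ⟨i, hi, A, hA, haA, ?_⟩
          rw [hsum' A fun hbA => ht ⟨i, hi, A, hA, hbA, he⟩, he]

variable {V : Type*} [Fintype V] [DecidableEq V] {m : ℕ} {q : Query V m}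
  {D : Type*} [DecidableEq D]

theorem Inst.mem_configs {I : Inst q D} {c : Config V m} (hc : c ∈ I.configs) (i : Fin m) :
    c i (q.schema i) = 0 ∧ c i ∅ = Nat.log 2 (I.rows i).card ∧
      ∀ A' A, A' ⊆ A → A ⊆ q.schema i → c i A ≤ c i A' :=
  (Finset.mem_filter.1 hc).2 i

/-- Double counting in the original relation, where the buckets are defined: each value of `A` that
occurs has at least `2 ^ c i A` rows above it, and those over a common value of `B` are disjoint
sets among fewer than `2 ^ (c i B + 1)` rows. -/
theorem Inst.maxDeg_proj_mul_le {I : Inst q D} {c : Config V m} {i : Fin m} {A B : Finset V}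
    (hA : A ⊆ q.schema i) (hB : B ⊆ A) {T : Table V D}
    (hT : ∀ t ∈ T.rows, ∃ r ∈ I.part c i, restrict A r = restrict A t) :
    maxDeg (T.proj A) B * 2 ^ c i A ≤ 2 ^ (c i B + 1) := by
  rw [← Nat.le_div_iff_mul_le (by positivity)]
  refine Finset.sup_le fun u₀ hu₀ => ?_
  rw [Nat.le_div_iff_mul_le (by positivity)]
  have hrow : ∀ u ∈ (T.proj A).rows, ∃ r ∈ I.part c i, restrict A r = u := fun u hu => by
    obtain ⟨t, ht, rfl⟩ := Finset.mem_image.1 hu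
    exact hT t ht
  have hne : ∀ (r : Tup V D) (E : Finset V), r ∈ I.rows i →
      deg (restrict E r) (I.rows i) E ≠ 0 := fun r E hr =>
    Finset.card_ne_zero_of_mem (Finset.mem_filter.2 ⟨hr, rfl⟩)
  set β := restrict B u₀ with hβ
  set U := (T.proj A).rows.filter fun u => restrict B u = β with hU
  have hcard := Finset.mul_card_image_le_card_of_maps_to (f := restrict A)
    (s := (I.rows i).filter fun r => restrict A r ∈ U) (t := U)
    (fun r hr => (Finset.mem_filter.1 hr).2) (2 ^ c i A) (fun u hu => by
      obtain ⟨r, hr, hru⟩ := hrow u (Finset.mem_filter.1 hu).1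
      rw [Inst.part, Finset.mem_filter] at hr
      rw [← hr.2 A (Finset.mem_powerset.2 hA), hru]
      refine (Nat.pow_log_le_self 2 (hru ▸ hne r A hr.1)).trans
        (Finset.card_le_card fun x hx => ?_)
      rw [Finset.mem_filter] at hx
      exact Finset.mem_filter.2 ⟨Finset.mem_filter.2 ⟨hx.1, hx.2 ▸ hu⟩, hx.2⟩)
  change U.card * _ ≤ _
  rw [mul_comm]
  refine hcard.trans ?_
  obtain ⟨r₀, hr₀, hru₀⟩ := hrow u₀ hu₀
  rw [Inst.part, Finset.mem_filter] at hr₀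
  have hβ' : β = restrict B r₀ := by
    rw [hβ, ← hru₀, restrict_restrict_of_subset hB]
  have h1 : deg β (I.rows i) B < 2 ^ (c i B + 1) := by
    rw [← hr₀.2 B (Finset.mem_powerset.2 (hB.trans hA)), hβ']
    exact Nat.lt_pow_succ_log_self one_lt_two _
  refine (Finset.card_le_card fun r hr => ?_).trans h1.le
  rw [Finset.mem_filter] at hr
  refine Finset.mem_filter.2 ⟨hr.1, ?_⟩
  have := (Finset.mem_filter.1 hr.2).2
  rwa [restrict_restrict_of_subset hB] at this

/-- The rows of `T`, restricted to the part of the schema of the relation `i` inside `X`, come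
from rows of `R(c)`. -/
def Inst.Dominates (I : Inst q D) (c : Config V m) (X : Finset V) (i : Fin m)
    (T : Table V D) : Prop :=
  q.schema i ∩ X ⊆ T.schema ∧ ∀ t ∈ T.rows,
    restrict (q.schema i ∩ X) t ∈ (I.part c i).image (restrict (q.schema i ∩ X))

/-- For a tight pair `(i, A)` and `A' ⊆ A`, the weight of `A'` is that of `A` minus that of `A \
A'`, hence at least `(c i (A \ A') - c i A) * log 2`. By `maxDeg_proj_mul_le` this dominates the
logarithm of half the degree. `hN` bounds the total of every packing, so it bounds the tight one. -/
theorem Inst.packs_of_dominates {I : Inst q D} {c : Config V m} (hc : c ∈ I.configs)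
    (J : Finset (Fin m)) {X : Finset V} (hX : ∀ a ∈ X, ∃ i ∈ J, a ∈ q.schema i)
    {Rs : List (Table V D)} (hdom : ∀ i ∈ J, ∃ T ∈ Rs, I.Dominates c X i T) {N : ℝ}
    (hN : ∀ v : V → ℝ, (∀ a, 0 ≤ v a) → (∀ i ∈ J, ∀ A ⊆ q.schema i ∩ X,
      ∑ a ∈ A, v a ≤ ((c i ∅ : ℝ) - c i A) * Real.log 2) → ∑ a ∈ X, v a ≤ Real.log N) :
    Packs Rs X N := by
  have hlog : 0 ≤ Real.log 2 := Real.log_nonneg one_le_two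
  obtain ⟨v, v0, v1, v2⟩ := exists_tight J (fun i => q.schema i ∩ X)
    (fun i A => ((c i ∅ : ℝ) - c i A) * Real.log 2) (fun i _ A hA => by
      refine mul_nonneg (sub_nonneg.2 ?_) hlog
      exact_mod_cast (I.mem_configs hc i).2.2 ∅ A (Finset.empty_subset _)
        (hA.trans Finset.inter_subset_left)) X (fun a ha => by
      obtain ⟨i, hi, hai⟩ := hX a ha
      exact ⟨i, hi, Finset.mem_inter.2 ⟨hai, ha⟩⟩)
  refine ⟨v, v0, hN v v0 v1, fun a ha => ?_⟩
  obtain ⟨i, hi, A, hA, haA, he⟩ := v2 a ha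
  obtain ⟨T, hT, hTs, hTr⟩ := hdom i hi
  refine ⟨T, hT, A, Finset.subset_inter (hA.trans hTs) (hA.trans Finset.inter_subset_right),
    haA, fun A' hA' => ?_⟩
  have hdeg := I.maxDeg_proj_mul_le (c := c) (hA.trans Finset.inter_subset_left)
    (Finset.sdiff_subset (s := A) (t := A')) (T := T) (fun t ht => by
      obtain ⟨r, hr, hrt⟩ := Finset.mem_image.1 (hTr t ht)
      exact ⟨r, hr, restrict_congr fun a ha => apply_eq_of_restrict_eq hrt (hA ha)⟩)
  rcases Nat.eq_zero_or_pos (maxDeg (T.proj A) (A \ A')) with h3 | h3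
  · rw [h3]; simpa using Finset.sum_nonneg fun b _ => v0 b
  have h4 := v1 i hi (A \ A') (Finset.sdiff_subset.trans hA)
  have h5 : ∑ b ∈ A \ A', v b + ∑ b ∈ A', v b = ∑ b ∈ A, v b := Finset.sum_sdiff hA'
  have h6 : (0 : ℝ) < maxDeg (T.proj A) (A \ A') := by exact_mod_cast h3
  have h7 : (maxDeg (T.proj A) (A \ A') : ℝ) * 2 ^ c i A ≤ 2 ^ (c i (A \ A') + 1) := by
    exact_mod_cast hdeg
  have h8 := Real.log_le_log (by positivity) h7
  rw [Real.log_mul h6.ne' (by positivity), Real.log_pow, Real.log_pow] at h8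
  rw [Real.log_div h6.ne' two_ne_zero]
  push_cast at h8
  nlinarith

theorem Query.fracCover_one (q : Query V m) (X : Finset V) : q.FracCover X fun _ => 1 := by
  refine ⟨fun _ => zero_le_one, fun a _ => ?_⟩
  obtain ⟨i, hi⟩ := q.covered a
  rw [Finset.sum_const, nsmul_eq_mul, mul_one]
  exact_mod_cast Finset.card_pos.2 ⟨i, by simpa using hi⟩

theorem Inst.one_le_card (I : Inst q D) (i : Fin m) : (1 : ℝ) ≤ (I.rows i).card := by
  exact_mod_cast (I.nonempty i).card_pos

theorem Inst.one_le_agm (I : Inst q D) (X : Finset V) : 1 ≤ I.agm X := by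
  refine le_csInf ⟨_, _, q.fracCover_one X, rfl⟩ ?_
  rintro _ ⟨w, hw, rfl⟩
  rw [← Finset.prod_const_one (s := (Finset.univ : Finset (Fin m)))]
  exact Finset.prod_le_prod (fun _ _ => zero_le_one) fun i _ =>
    Real.one_le_rpow (I.one_le_card i) (hw.1 i)

theorem Inst.agm_le (I : Inst q D) {X : Finset V} {w : Fin m → ℝ} (hw : q.FracCover X w) :
    I.agm X ≤ ∏ i, ((I.rows i).card : ℝ) ^ w i := by
  refine csInf_le ⟨0, ?_⟩ ⟨w, hw, rfl⟩
  rintro _ ⟨w, hw, rfl⟩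
  positivity

theorem Inst.config_empty_mul_log_le {I : Inst q D} {c : Config V m} (hc : c ∈ I.configs)
    (i : Fin m) : (c i ∅ : ℝ) * Real.log 2 ≤ Real.log (I.rows i).card := by
  rw [(I.mem_configs hc i).2.1, ← Real.log_pow]
  refine Real.log_le_log (by positivity) ?_
  exact_mod_cast Nat.pow_log_le_self 2 (I.nonempty i).card_pos.ne'

/-- Weak duality: weigh the packing constraints for `A = attr(R_i) ∩ X` with a fractional cover. -/
theorem Inst.packs_agm {I : Inst q D} {c : Config V m} (hc : c ∈ I.configs) {X : Finset V}
    {Rs : List (Table V D)} (hdom : ∀ i, ∃ T ∈ Rs, I.Dominates c X i T) :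
    Packs Rs X (I.agm X) := by
  have hlog : 0 ≤ Real.log 2 := Real.log_nonneg one_le_two
  refine I.packs_of_dominates hc Finset.univ (fun a _ => by simpa using q.covered a)
    (fun i _ => hdom i) fun v v0 v1 => ?_
  rw [Real.le_log_iff_exp_le (by linarith [I.one_le_agm X])]
  refine le_csInf ⟨_, _, q.fracCover_one X, rfl⟩ ?_
  rintro _ ⟨w, hw, rfl⟩
  rw [← Real.le_log_iff_exp_le (Finset.prod_pos fun i _ =>
    Real.rpow_pos_of_pos (by linarith [I.one_le_card i]) _), Real.log_prod fun i _ =>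
    (Real.rpow_pos_of_pos (by linarith [I.one_le_card i]) _).ne']
  calc ∑ a ∈ X, v a ≤ ∑ a ∈ X, v a * ∑ i with a ∈ q.schema i, w i :=
        Finset.sum_le_sum fun a ha => le_mul_of_one_le_right (v0 a) (hw.2 a ha)
    _ = ∑ i, w i * ∑ a ∈ q.schema i ∩ X, v a := by
        simp only [Finset.mul_sum, Finset.sum_filter]
        rw [Finset.sum_comm]
        refine Finset.sum_congr rfl fun i _ => ?_
        rw [Finset.inter_comm, ← Finset.filter_mem_eq_inter, Finset.sum_filter]
        exact Finset.sum_congr rfl fun a _ => by split <;> simp [mul_comm]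
    _ ≤ ∑ i, Real.log (((I.rows i).card : ℝ) ^ w i) := by
        refine Finset.sum_le_sum fun i _ => ?_
        rw [Real.log_rpow (by linarith [I.one_le_card i])]
        refine mul_le_mul_of_nonneg_left ?_ (hw.1 i)
        refine (v1 i (Finset.mem_univ _) _ subset_rfl).trans
          (le_trans ?_ (I.config_empty_mul_log_le hc i))
        gcongr
        simp

/-- The packing uses only the relation `j`. This is what makes absorption by a Light transform
linear in the relation sizes. -/
theorem Inst.packs_schema {I : Inst q D} {c : Config V m} (hc : c ∈ I.configs) {j : Fin m}
    {Rs : List (Table V D)} (hdom : ∃ T ∈ Rs, I.Dominates c (q.schema j) j T) :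
    Packs Rs (q.schema j) (I.rows j).card := by
  have hlog : 0 ≤ Real.log 2 := Real.log_nonneg one_le_two
  refine I.packs_of_dominates hc {j} (fun a ha => ⟨j, by simp, ha⟩) (by simpa using hdom)
    fun v v0 v1 => ?_
  refine (v1 j (by simp) (q.schema j) (by simp)).trans
    (le_trans ?_ (I.config_empty_mul_log_le hc j))
  gcongr
  simp

theorem Inst.wf_parts (I : Inst q D) (c : Config V m) : ∀ R ∈ I.parts c, R.WF := by
  intro R hR
  obtain ⟨i, rfl⟩ := (List.mem_ofFn' _ _).1 hR
  exact fun r hr => I.wf i r (Finset.filter_subset _ _ hr)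

theorem Inst.dominates_part (I : Inst q D) (c : Config V m) (X : Finset V) (i : Fin m) :
    I.Dominates c X i ⟨q.schema i, I.part c i⟩ :=
  ⟨Finset.inter_subset_left, fun _ ht => Finset.mem_image_of_mem _ ht⟩

theorem Inst.mem_parts (I : Inst q D) (c : Config V m) {R : Table V D} :
    R ∈ I.parts c ↔ ∃ i, R = ⟨q.schema i, I.part c i⟩ := by
  rw [Inst.parts, List.mem_ofFn', Set.mem_range]
  simp only [eq_comm]

theorem Inst.map_schema_parts (I : Inst q D) (c : Config V m) :
    (I.parts c).map Table.schema = q.schemas := by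
  rw [Inst.parts, List.map_ofFn]; rfl

theorem Query.unionAll_schemas (q : Query V m) : unionAll q.schemas = Finset.univ := by
  ext a
  obtain ⟨i, hi⟩ := q.covered a
  simp only [mem_unionAll, Finset.mem_univ, iff_true]
  exact ⟨_, (List.mem_ofFn' _ _).2 ⟨i, rfl⟩, hi⟩

theorem Inst.attrs_parts (I : Inst q D) (c : Config V m) :
    attrs (I.parts c) = Finset.univ := by
  rw [attrs, I.map_schema_parts, q.unionAll_schemas]

end Uniform

/-! ## Repeated Split on ears -/

section Ears

set_option linter.unusedSectionVars false

variable {V : Type*} [Fintype V] [DecidableEq V]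

theorem pick_false {α : Type*} (l : List α) : pick (fun _ => false) l = [] := by
  induction l with
  | nil => rfl
  | cons a l ih => simpa [pick] using ih

theorem pick_true {α : Type*} (l : List α) : pick (fun _ => true) l = l := by
  induction l with
  | nil => rfl
  | cons a l ih => simpa [pick] using ih

theorem pick_beq {α : Type*} (l : List α) (k : ℕ) (hk : k < l.length) :
    pick (fun i => i == k) l = [l[k]] := by
  induction l generalizing k with
  | nil => simp at hk
  | cons a l ih =>
    cases k with
    | zero => simpa [pick] using pick_false l
    | succ k => simpa [pick] using ih k (by simpa using hk)

theorem pick_bne {α : Type*} (l : List α) (k : ℕ) :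
    pick (fun i => i != k) l = l.eraseIdx k := by
  induction l generalizing k with
  | nil => rfl
  | cons a l ih =>
    cases k with
    | zero => simpa [pick] using pick_true l
    | succ k => simpa [pick] using ih k

theorem coe_eraseIdx {α : Type*} [DecidableEq α] (l : List α) (k : Fin l.length) :
    l.get k ::ₘ ((l.eraseIdx k : List α) : Multiset α) = l := by
  rw [Multiset.cons_coe, Multiset.coe_eq_coe]
  exact List.getElem_cons_eraseIdx_perm k.2

/-- The set added last is split off. What remains after absorption is acyclic by
`filter_not_subset`, and shorter. -/
theorem Acyc.exists_earPlan {l : List (Finset V)} (hl : Acyc (l : Multiset (Finset V))) :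
    ∃ p : Plan V, p.EarPlan l := by
  induction hn : l.length using Nat.strong_induction_on generalizing l with
  | _ n ih =>
    generalize hM' : (l : Multiset (Finset V)) = M' at hl
    cases hl with
    | single s =>
      rw [Multiset.coe_eq_singleton] at hM'
      exact ⟨.done, hM' ▸ .single s⟩
    | cons s M t hM ht h =>
      have hs : s ∈ l := by
        rw [← Multiset.mem_coe, hM']; exact Multiset.mem_cons_self _ _
      obtain ⟨k, rfl⟩ := List.mem_iff_get.1 hs
      have her : ((l.eraseIdx k : List (Finset V)) : Multiset (Finset V)) = M := by
        have := coe_eraseIdx l k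
        rw [hM'] at this
        exact (Multiset.cons_inj_right _).1 this
      have ht' : t ∈ l.eraseIdx k := by rwa [← Multiset.mem_coe, her]
      obtain ⟨j, hj, hjk, rfl⟩ := List.mem_eraseIdx_iff_getElem.1 ht'
      set j' : Fin l.length := ⟨j, hj⟩
      have hjt : l[j] = l.get j' := rfl
      rw [hjt] at ht h
      have hear : Plan.IsEar l k j' := by
        refine ⟨fun hkj => hjk (congrArg Fin.val hkj).symm, fun a ha => (h a ha).imp_right
          fun h1 i hik => h1 _ ?_⟩
        rw [← her, Multiset.mem_coe]
        exact List.mem_eraseIdx_iff_getElem.2 ⟨i, i.2, fun hh => hik (Fin.ext hh), rfl⟩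
      set l' := l.get j' :: ((l.get k ∩ l.get j') :: l.eraseIdx k).filter
        (fun s => ¬ s ⊆ l.get j') with hl'
      -- Both `S` and the old copy of the witness lie inside the witness, so the filter removes
      -- them.
      have hco : (l' : Multiset (Finset V))
          = l.get j' ::ₘ (M.erase (l.get j')).filter fun s => ¬ s ⊆ l.get j' := by
        rw [hl', ← Multiset.cons_coe, ← Multiset.filter_coe, ← Multiset.cons_coe, her,
          Multiset.filter_cons_of_neg (p := fun s => ¬ s ⊆ l.get j') _
            (not_not.2 Finset.inter_subset_right)]
        congr 1
        conv_lhs => rw [← Multiset.cons_erase ht]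
        exact Multiset.filter_cons_of_neg (p := fun s => ¬ s ⊆ l.get j') _
          (not_not.2 subset_rfl)
      have hac : Acyc (l' : Multiset (Finset V)) := by
        rw [hco]
        exact Acyc.filter_not_subset (by rwa [Multiset.cons_erase ht])
      have hlen : l'.length < n := by
        rw [← Multiset.coe_card, hco, Multiset.card_cons]
        have h1 := Multiset.card_le_card
          (Multiset.filter_le (fun s => ¬ s ⊆ l.get j') (M.erase (l.get j')))
        have h2 := Multiset.card_erase_lt_of_mem ht
        have h3 : M.card + 1 = n := by
          rw [← hn, ← Multiset.coe_card, hM', Multiset.card_cons]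
        omega
      obtain ⟨p, hp⟩ := ih _ hlen hac rfl
      exact ⟨_, .step l k j' p hear hp⟩

theorem Plan.IsEar.separates {l : List (Finset V)} {k j : Fin l.length}
    (h : Plan.IsEar l k j) :
    Plan.Separates (l.get k ∩ l.get j) (fun i => i == k.1) (fun i => i != k.1) l := by
  refine ⟨fun i _ => ?_, ?_, ?_⟩
  · by_cases hi : i = k <;> simp [hi]
  · rw [pick_beq l k k.2, pick_bne]
    intro a ha
    rw [Finset.mem_inter, mem_unionAll, mem_unionAll] at ha
    obtain ⟨⟨s, hs, has⟩, r, hr, har⟩ := ha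
    rw [List.mem_singleton] at hs
    subst hs
    obtain ⟨i, hi, hik, rfl⟩ := List.mem_eraseIdx_iff_getElem.1 hr
    refine Finset.mem_inter.2 ⟨has, (h.2 a has).resolve_right fun h1 =>
      h1 ⟨i, hi⟩ (fun hh => hik (congrArg Fin.val hh)) har⟩
  · rw [pick_beq l k k.2]
    intro a ha
    exact mem_unionAll.2 ⟨_, List.mem_singleton_self _, (Finset.mem_inter.1 ha).1⟩

theorem Plan.IsEar.mem_eraseIdx {l : List (Finset V)} {k j : Fin l.length}
    (h : Plan.IsEar l k j) : l.get j ∈ l.eraseIdx k :=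
  List.mem_eraseIdx_iff_getElem.2 ⟨j, j.2, fun hh => h.1 (Fin.ext hh.symm), rfl⟩

theorem unionAll_light {l : List (Finset V)} {X : Finset V} (hX : X ⊆ unionAll l) :
    unionAll (X :: l.filter fun s => ¬ s ⊆ X) = unionAll l := by
  ext a
  simp only [mem_unionAll, List.mem_cons, List.mem_filter, decide_eq_true_eq]
  constructor
  · rintro ⟨s, rfl | hs, ha⟩
    · exact mem_unionAll.1 (hX ha)
    · exact ⟨s, hs.1, ha⟩
  · rintro ⟨s, hs, ha⟩
    by_cases hsX : s ⊆ X
    · exact ⟨X, .inl rfl, hsX ha⟩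
    · exact ⟨s, .inr ⟨hs, hsX⟩, ha⟩

theorem Plan.EarPlan.valid {p : Plan V} {l : List (Finset V)} (hp : p.EarPlan l) :
    p.Valid l (unionAll l) := by
  induction hp with
  | single s => exact ⟨s, rfl, by simp [unionAll]⟩
  | step l k j p hear hp ih =>
    have hs := hear.separates
    refine ⟨hs, fun a ha => mem_unionAll.2 ⟨_, List.get_mem _ k, (Finset.mem_inter.1 ha).1⟩, ?_⟩
    rw [pick_beq l k k.2, pick_bne]
    have hsub : unionAll ((l.get k ∩ l.get j) :: l.eraseIdx k) ⊆ unionAll l := by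
      intro a ha
      obtain ⟨s, hs, ha⟩ := mem_unionAll.1 ha
      rcases List.mem_cons.1 hs with rfl | hs
      · exact mem_unionAll.2 ⟨_, List.get_mem _ k, (Finset.mem_inter.1 ha).1⟩
      · exact mem_unionAll.2 ⟨s, List.mem_of_mem_eraseIdx hs, ha⟩
    have hj : l.get j ⊆ unionAll ((l.get k ∩ l.get j) :: l.eraseIdx k) := fun a ha =>
      mem_unionAll.2 ⟨_, List.mem_cons_of_mem _ hear.mem_eraseIdx, ha⟩
    refine ⟨⟨_, rfl, Finset.inter_subset_left⟩, ⟨hj, ?_⟩, ?_, ⟨l.get k, ?_, ?_⟩⟩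
    · rw [unionAll_light hj] at ih
      convert ih using 1
      exact Finset.inter_eq_right.2 hsub
    · intro a ha
      exact mem_unionAll.2 ⟨_, List.mem_cons_of_mem _ (List.mem_singleton_self _), ha⟩
    · simp
    · simp [unionAll]

theorem Plan.steps_splitOut {D : Type*} [DecidableEq D] {S : Finset V} {m₁ m₂ : ℕ → Bool}
    {p₁ p₂ p₃ : Plan V} {Rs G₁ G₂ : List (Table V D)} {O : Finset V}
    (h₁ : pick m₁ Rs = G₁) (h₂ : pick m₂ Rs = G₂) {RS O₂ RS' O₁ : Table V D}
    (hRS : RS = p₁.out G₁ S) (hO₂ : O₂ = p₂.out (RS :: G₂) (O ∩ (S ∪ attrs G₂)))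
    (hRS' : RS' = ⟨S, RS.rows ∩ (O₂.proj S).rows⟩)
    (hO₁ : O₁ = p₃.out (RS' :: G₁) (O ∩ attrs G₁)) :
    (splitOut S m₁ m₂ p₁ p₂ p₃).steps Rs O
      = p₁.steps G₁ S + p₂.steps (RS :: G₂) (O ∩ (S ∪ attrs G₂)) + tableSize [RS, O₂]
        + p₃.steps (RS' :: G₁) (O ∩ attrs G₁) + joinSteps [RS', O₁, O₂] := by
  subst h₁ h₂ hRS hO₂ hRS' hO₁
  rfl

theorem Plan.out_splitOut {D : Type*} [DecidableEq D] {S : Finset V} {m₁ m₂ : ℕ → Bool}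
    {p₁ p₂ p₃ : Plan V} {Rs G₁ G₂ : List (Table V D)} {O : Finset V}
    (h₁ : pick m₁ Rs = G₁) (h₂ : pick m₂ Rs = G₂) {RS O₂ RS' O₁ : Table V D}
    (hRS : RS = p₁.out G₁ S) (hO₂ : O₂ = p₂.out (RS :: G₂) (O ∩ (S ∪ attrs G₂)))
    (hRS' : RS' = ⟨S, RS.rows ∩ (O₂.proj S).rows⟩)
    (hO₁ : O₁ = p₃.out (RS' :: G₁) (O ∩ attrs G₁)) :
    (splitOut S m₁ m₂ p₁ p₂ p₃).out Rs O = ⟨O, joinRows [RS', O₁, O₂]⟩ := by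
  subst h₁ h₂ hRS hO₂ hRS' hO₁
  rfl

theorem lightRel_subset {D : Type*} [DecidableEq D] {Rs : List (Table V D)}
    (hwf : ∀ R ∈ Rs, R.WF) {R : Table V D} (hR : R ∈ Rs) :
    (lightRel Rs R.schema).rows ⊆ R.rows := by
  intro u hu
  have h1 := restrict_mem_of_mem_lightRel hwf (subset_attrs hR) hR subset_rfl hu
  rwa [restrict_eq_self (A := R.schema) fun a => (wf_lightRel hwf (subset_attrs hR) u hu a).1] at h1

theorem joinSteps_single {D : Type*} [DecidableEq D] {R : Table V D} (hR : R.WF) :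
    joinSteps [R] = R.rows.card + (1 + R.rows.card) := by
  rw [joinSteps, loopSteps_single hR]
  simp [tableSize]

/-- The cost is the sum of the prefix joins. Since the first schema lies in the second, the join of
the first two tables is no larger than the second. -/
theorem joinSteps_triple_le {D : Type*} [DecidableEq D] {R₀ R₁ R₂ : Table V D} (h₀ : R₀.WF)
    (h₁ : R₁.WF) (h₂ : R₂.WF) (hs : R₀.schema ⊆ R₁.schema) :
    joinSteps [R₀, R₁, R₂] ≤ 1 + 2 * R₀.rows.card + 2 * R₁.rows.card + R₂.rows.card
      + (joinRows [R₀, R₁, R₂]).card := by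
  have e1 := loopSteps_concat (Rs := [R₀, R₁]) (R := R₂)
    (by simpa using ⟨h₀, h₁, h₂⟩) emptyTup
  have e2 := loopSteps_concat (Rs := [R₀]) (R := R₁) (by simpa using ⟨h₀, h₁⟩) emptyTup
  have e3 : (joinRows [R₀, R₁]).card ≤ R₁.rows.card := by
    refine Finset.card_le_card fun u hu => ?_
    rw [mem_joinRows (by simpa using ⟨h₀, h₁⟩)] at hu
    have h3 := hu.2 R₁ (by simp)
    rwa [restrict_eq_self] at h3
    intro a ha
    have := (hu.1 a).1 ha
    rw [attrs_cons, attrs_cons] at this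
    simp only [Finset.mem_union] at this
    rcases this with h | h | h
    · exact hs h
    · exact h
    · simp [attrs, unionAll] at h
  simp only [List.cons_append, List.nil_append] at e1 e2
  rw [joinSteps, e1, e2, loopSteps_single h₀]
  simp only [tableSize, List.map_cons, List.map_nil, List.sum_cons, List.sum_nil]
  unfold joinRows at e3 ⊢
  omega

universe u

/-- Induction over the ears, keeping all tables of size at most `N` and each of them packing its own
schema within `N`. Light on the witness only shrinks the witness, so both invariants persist. -/
theorem Plan.EarPlan.steps_le {p : Plan V} {l : List (Finset V)} (hp : p.EarPlan l) :
    ∃ C K : ℕ, ∀ (D : Type u) [DecidableEq D] (Rs : List (Table V D)) (N : ℝ),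
      Rs.map Table.schema = l → (∀ R ∈ Rs, R.WF) → 1 ≤ N →
      (∀ R ∈ Rs, (R.rows.card : ℝ) ≤ N) → (∀ R ∈ Rs, Packs [R] R.schema N) →
      (p.steps Rs (unionAll l) : ℝ) ≤ C * N + K * (joinRows Rs).card := by
  induction hp with
  | single s =>
    refine ⟨3, 0, fun D _ Rs N hl hwf hN hcard _ => ?_⟩
    obtain ⟨R, rfl, hR⟩ := List.map_eq_singleton_iff.1 hl
    rw [Plan.steps, joinSteps_single (hwf R (by simp))]
    have := hcard R (by simp)
    push_cast
    linarith
  | step l k j p hear hp ih =>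
    obtain ⟨C₀, K₀, ih⟩ := ih
    -- 12 = 3 + 1 + 3 + 5: computing `R_S`, scanning it, the end of the third branch, and the final
    -- join. OUT enters three more times: scanning `O₂`, then `O₂` and the result in the final join.
    refine ⟨C₀ + lightConst V l.length + lightConst V 2 + 12, K₀ + 3,
      fun D _ Rs N hl hwf hN hcard hpack => ?_⟩
    have hN0 : 0 < N := by linarith
    have hvalid := (Plan.EarPlan.step l k j p hear hp).valid
    have hsep := hear.separates
    subst hl
    have hlen : (Rs.map Table.schema).length = Rs.length := by simp
    obtain ⟨Rk, hRk⟩ : ∃ R, R = Rs[k.1]'(by simpa using k.2) := ⟨_, rfl⟩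
    obtain ⟨Rj, hRj⟩ : ∃ R, R = Rs[j.1]'(by simpa using j.2) := ⟨_, rfl⟩
    have ek : (Rs.map Table.schema).get k = Rk.schema := by simp [hRk]
    have ej : (Rs.map Table.schema).get j = Rj.schema := by simp [hRj]
    have hRkm : Rk ∈ Rs := hRk ▸ List.getElem_mem _
    have hRjm : Rj ∈ Rs.eraseIdx k := List.mem_eraseIdx_iff_getElem.2
      ⟨j, by simpa using j.2, fun hh => hear.1 (Fin.ext hh.symm), hRj.symm⟩
    have p1 : pick (fun i => i == k.1) Rs = [Rk] := by
      rw [pick_beq Rs k (by simpa using k.2), hRk]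
    have p2 : pick (fun i => i != k.1) Rs = Rs.eraseIdx k := pick_bne Rs k
    have hunion : unionAll (Rs.map Table.schema) = attrs Rs := rfl
    rw [hunion] at hvalid ⊢
    have hG := hsep.mem_iff
    obtain ⟨-, hS, hS₁⟩ := hsep
    rw [attrs_pick, attrs_pick] at hS
    rw [attrs_pick] at hS₁
    rw [p1, p2] at hS
    simp only [p1, p2] at hG
    rw [p1] at hS₁
    rw [List.eraseIdx_map] at ih
    simp only [ek, ej] at hvalid ih hS hS₁ ⊢
    set G₂ := Rs.eraseIdx k with hG₂
    set S := Rk.schema ∩ Rj.schema with hSdef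
    have hatk : attrs [Rk] = Rk.schema := by simp [attrs, unionAll]
    have hwf₁ : ∀ R ∈ [Rk], R.WF := fun R h => hwf R ((hG R).2 (.inl h))
    have hwf₂ : ∀ R ∈ G₂, R.WF := fun R h => hwf R ((hG R).2 (.inr h))
    have hat := attrs_of_split hG
    have hSO : S ⊆ attrs Rs := by rw [hat]; exact hS₁.trans Finset.subset_union_left
    have hOi : attrs Rs ∩ (S ∪ attrs G₂) = S ∪ attrs G₂ :=
      Finset.inter_eq_right.2 (Finset.union_subset hSO (by
        rw [hat]; exact Finset.subset_union_right))
    obtain ⟨RS, hRS⟩ : ∃ R, R = Plan.done.out [Rk] S := ⟨_, rfl⟩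
    obtain ⟨O₂, hO₂⟩ : ∃ R, R = (Plan.light Rj.schema p).out (RS :: G₂)
      (attrs Rs ∩ (S ∪ attrs G₂)) := ⟨_, rfl⟩
    obtain ⟨RS', hRS'⟩ : ∃ R : Table V D, R = ⟨S, RS.rows ∩ (O₂.proj S).rows⟩ := ⟨_, rfl⟩
    obtain ⟨O₁, hO₁⟩ : ∃ R, R = (Plan.light Rk.schema .done).out (RS' :: [Rk])
      (attrs Rs ∩ attrs [Rk]) := ⟨_, rfl⟩
    rw [Plan.steps_splitOut p1 p2 hRS hO₂ hRS' hO₁]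
    have hout := Plan.out_splitOut (O := attrs Rs) p1 p2 hRS hO₂ hRS' hO₁
    rw [Plan.out_eq _ hwf subset_rfl hvalid] at hout
    have hRS0 : RS = ⟨S, (joinRows [Rk]).image (restrict S)⟩ := hRS
    have wRS : RS.WF := by rw [hRS0]; exact wf_proj_join hwf₁ hS₁
    have wRSG : ∀ R ∈ RS :: G₂, R.WF := List.forall_mem_cons.2 ⟨wRS, hwf₂⟩
    have hRSs : RS.schema = S := by rw [hRS0]
    have hjoin := joinRows_split hwf hG hS hS₁
    rw [← hRS0] at hjoin
    have hk1 : (Rk.rows.card : ℝ) ≤ N := hcard Rk hRkm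
    have hRSN : (RS.rows.card : ℝ) ≤ N := by
      refine le_trans ?_ hk1
      rw [hRS0, joinRows_single (hwf Rk hRkm)]
      exact_mod_cast Finset.card_image_le
    have wRS' : RS'.WF := wRS.mono (by rw [hRS', hRSs]) (by
      rw [hRS']; exact Finset.inter_subset_left)
    have hRS'N : (RS'.rows.card : ℝ) ≤ N := by
      refine le_trans ?_ hRSN
      rw [hRS']
      exact_mod_cast Finset.card_le_card Finset.inter_subset_left
    have hRS's : RS'.schema = S := by rw [hRS']
    have hXj : Rj.schema ⊆ attrs (RS :: G₂) := subset_attrs (List.mem_cons_of_mem _ hRjm)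
    have hpackj : Packs [Rj] Rj.schema N := hpack Rj ((hG Rj).2 (.inr hRjm))
    have hjN : (Rj.rows.card : ℝ) ≤ N := hcard Rj ((hG Rj).2 (.inr hRjm))
    have hsubj := lightRel_subset wRSG (List.mem_cons_of_mem RS hRjm)
    -- The subproblem joins to a projection of the full join, so the output term does not grow along
    -- the recursion.
    have hOUT2 : (joinRows (RS :: G₂)).card ≤ (joinRows Rs).card := by
      rw [hjoin]; exact Finset.card_image_le
    have hlenG : (RS :: G₂).length = (Rs.map Table.schema).length := by
      have : k.1 < Rs.length := by simpa using k.2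
      rw [List.length_cons, hG₂, List.length_eraseIdx_of_lt this, hlen]
      omega
    have ih' := ih D (lightReduce (RS :: G₂) Rj.schema) N
      (by rw [map_schema_lightReduce, List.map_cons, hRSs])
      (fun R => wf_lightReduce wRSG hXj) hN
      (fun R hR => by
        rcases mem_lightReduce.1 hR with rfl | h
        · exact le_trans (by exact_mod_cast Finset.card_le_card hsubj) hjN
        · rcases List.mem_cons.1 h.1 with rfl | h2
          · exact hRSN
          · exact hcard R ((hG R).2 (.inr h2)))
      (fun R hR => by
        rcases mem_lightReduce.1 hR with rfl | h
        · exact hpackj.mono hN0 le_rfl (by simpa using ⟨rfl, hsubj⟩)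
        · rcases List.mem_cons.1 h.1 with rfl | h2
          -- `R_S` is absorbed by the witness, so no packing certificate is needed for it.
          · exact absurd (hRSs ▸ Finset.inter_subset_right) h.2
          · exact hpack R ((hG R).2 (.inr h2)))
    rw [joinRows_lightReduce wRSG hXj] at ih'
    have ihO : unionAll (Rj.schema ::
        (S :: G₂.map Table.schema).filter fun s => ¬ s ⊆ Rj.schema) = S ∪ attrs G₂ := by
      have h1 := attrs_lightReduce (Rs := RS :: G₂) hXj
      rw [attrs, map_schema_lightReduce, List.map_cons, hRSs, attrs_cons, hRSs] at h1
      exact h1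
    rw [ihO] at ih'
    have s1 : ((Plan.done : Plan V).steps [Rk] S : ℝ) ≤ 3 * N := by
      rw [Plan.steps, joinSteps_single (hwf Rk hRkm)]
      push_cast
      linarith
    have s2 : ((Plan.light Rj.schema p).steps (RS :: G₂) (attrs Rs ∩ (S ∪ attrs G₂)) : ℝ)
        ≤ (lightConst V (Rs.map Table.schema).length + C₀) * N + K₀ * (joinRows Rs).card := by
      have hp1 : Packs (RS :: G₂) Rj.schema N := hpackj.mono hN0 le_rfl fun T hT => by
        rw [List.mem_singleton] at hT
        exact ⟨Rj, List.mem_cons_of_mem _ hRjm, by rw [hT], by rw [hT]⟩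
      have h1 := hp1.lightSteps_le wRSG hN0 (List.forall_mem_cons.2
        ⟨hRSN, fun R h => hcard R ((hG R).2 (.inr h))⟩)
      rw [hlenG] at h1
      rw [hOi, Plan.steps]
      push_cast
      have h2 : (K₀ : ℝ) * (joinRows (RS :: G₂)).card ≤ K₀ * (joinRows Rs).card := by
        gcongr
      linarith
    have hv2 : (Plan.light Rj.schema p).Valid ((RS :: G₂).map Table.schema)
        (attrs Rs ∩ (S ∪ attrs G₂)) := by
      have := hvalid.2.2.2.1
      rw [attrs_pick, pick_map, p2] at this
      rwa [List.map_cons, hRSs]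
    have hOs : attrs Rs ∩ (S ∪ attrs G₂) ⊆ attrs (RS :: G₂) := by
      rw [attrs_cons, hRSs]
      exact Finset.inter_subset_right
    have hO₂' := Plan.out_eq _ wRSG hOs hv2
    have hO₂card : (O₂.rows.card : ℝ) ≤ (joinRows Rs).card := by
      rw [hO₂, hO₂']
      exact_mod_cast Finset.card_image_le.trans hOUT2
    have wO₂ : O₂.WF := by
      rw [hO₂, hO₂']
      exact wf_proj_join wRSG hOs
    have wRSk : ∀ R ∈ [RS', Rk], R.WF := by simpa using ⟨wRS', hwf Rk hRkm⟩
    have hSk : S ⊆ Rk.schema := Finset.inter_subset_left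
    have hXk : Rk.schema ⊆ attrs [RS', Rk] := subset_attrs (by simp)
    have hsubk : (lightRel [RS', Rk] Rk.schema).rows ⊆ Rk.rows :=
      lightRel_subset wRSk (by simp)
    have hlN : ((lightRel [RS', Rk] Rk.schema).rows.card : ℝ) ≤ N :=
      le_trans (by exact_mod_cast Finset.card_le_card hsubk) hk1
    have hred : lightReduce [RS', Rk] Rk.schema = [lightRel [RS', Rk] Rk.schema] := by
      simp [lightReduce, hRS's, hSk]
    have s3 : ((Plan.light Rk.schema .done).steps [RS', Rk] (attrs Rs ∩ attrs [Rk]) : ℝ)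
        ≤ (lightConst V 2 + 3) * N := by
      have hp1 : Packs [RS', Rk] Rk.schema N := (hpack Rk hRkm).mono hN0 le_rfl fun T hT => by
        rw [List.mem_singleton] at hT
        exact ⟨Rk, by simp, by rw [hT], by rw [hT]⟩
      have h1 := hp1.lightSteps_le wRSk hN0 (by simpa using ⟨hRS'N, hk1⟩)
      rw [Plan.steps, Plan.steps, hred, joinSteps_single (wf_lightRel wRSk hXk)]
      push_cast
      have : ([RS', Rk] : List (Table V D)).length = 2 := rfl
      rw [this] at h1
      linarith
    have hO₁' : O₁ = ⟨attrs Rs ∩ attrs [Rk],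
        (joinRows [lightRel [RS', Rk] Rk.schema]).image (restrict (attrs Rs ∩ attrs [Rk]))⟩ := by
      rw [hO₁, Plan.out, Plan.out, hred]
    have wl : ∀ R ∈ [lightRel [RS', Rk] Rk.schema], R.WF := by
      simpa using wf_lightRel wRSk hXk
    have wO₁ : O₁.WF := by
      rw [hO₁']
      refine wf_proj_join wl (Finset.inter_subset_right.trans ?_)
      rw [hatk]
      exact subset_attrs (R := lightRel [RS', Rk] Rk.schema) (by simp)
    have hO₁card : (O₁.rows.card : ℝ) ≤ N := by
      refine le_trans ?_ hlN
      rw [hO₁', joinRows_single (wf_lightRel wRSk hXk)]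
      exact_mod_cast Finset.card_image_le
    have s4 : (joinSteps [RS', O₁, O₂] : ℝ) ≤ 5 * N + 2 * (joinRows Rs).card := by
      have h1 := joinSteps_triple_le wRS' wO₁ wO₂ (by
        rw [hRS's, hO₁']; exact Finset.subset_inter hSO hS₁)
      have h2 : (joinRows [RS', O₁, O₂]).card ≤ (joinRows Rs).card := by
        have := congrArg Table.rows hout
        simp only at this
        rw [← this]
        exact Finset.card_image_le
      have h3 : (joinSteps [RS', O₁, O₂] : ℝ) ≤ 1 + 2 * RS'.rows.card + 2 * O₁.rows.card
          + O₂.rows.card + (joinRows Rs).card := by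
        exact_mod_cast h1.trans (Nat.add_le_add_left h2 _)
      linarith
    have s5 : (tableSize [RS, O₂] : ℝ) ≤ N + (joinRows Rs).card := by
      simp only [tableSize, List.map_cons, List.map_nil, List.sum_cons, List.sum_nil]
      push_cast
      linarith
    push_cast
    linarith

end Ears

/-! ## Runs over all degree configurations -/

section Runs

set_option linter.unusedSectionVars false

variable {V : Type*} [Fintype V] [DecidableEq V] {m : ℕ} {q : Query V m}
  {D : Type*} [DecidableEq D]

theorem coe_joinRows_ofFn {R : Fin m → Finset (Tup V D)}
    (hR : ∀ i, ∀ t ∈ R i, ∀ a, (t a).isSome ↔ a ∈ q.schema i) :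
    (joinRows (List.ofFn fun i => (⟨q.schema i, R i⟩ : Table V D)) : Set (Tup V D))
      = joinSet q R := by
  have hmem : ∀ T : Table V D, T ∈ List.ofFn (fun i => (⟨q.schema i, R i⟩ : Table V D)) ↔
      ∃ i, ⟨q.schema i, R i⟩ = T := fun T => List.mem_ofFn' _ _
  ext u
  rw [Finset.mem_coe, mem_joinRows]
  · have : attrs (List.ofFn fun i => (⟨q.schema i, R i⟩ : Table V D)) = Finset.univ := by
      rw [attrs, List.map_ofFn]
      exact q.unionAll_schemas
    simp only [this, Finset.mem_univ, iff_true, hmem, forall_exists_index,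
      forall_apply_eq_imp_iff]
    rfl
  · intro T hT
    obtain ⟨i, rfl⟩ := (hmem T).1 hT
    exact hR i

theorem Inst.coe_joinRows_parts (I : Inst q D) (c : Config V m) :
    (joinRows (I.parts c) : Set (Tup V D)) = joinSet q (I.part c) :=
  coe_joinRows_ofFn fun i t ht => I.wf i t (Finset.filter_subset _ _ ht)

theorem Inst.card_joinRows_parts (I : Inst q D) (c : Config V m) :
    (joinRows (I.parts c)).card = (joinSet q (I.part c)).ncard := by
  rw [← I.coe_joinRows_parts, Set.ncard_coe_finset]

theorem Inst.joinSet_part_subset (I : Inst q D) (c : Config V m) :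
    joinSet q (I.part c) ⊆ joinSet q I.rows :=
  fun _ ht => ⟨ht.1, fun i => Finset.filter_subset _ _ (ht.2 i)⟩

theorem Inst.ncard_joinSet_part_le (I : Inst q D) (c : Config V m) :
    (joinSet q (I.part c)).ncard ≤ I.OUT := by
  refine Set.ncard_le_ncard (I.joinSet_part_subset c) ?_
  rw [← coe_joinRows_ofFn (q := q) I.wf]
  exact Finset.finite_toSet _

theorem Plan.out_parts {p : Plan V} (hp : p.Valid q.schemas Finset.univ) (I : Inst q D)
    (c : Config V m) : (p.out (I.parts c) Finset.univ).rows = joinRows (I.parts c) := by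
  rw [Plan.out_eq p (I.wf_parts c) (by rw [I.attrs_parts])
    (by rw [I.map_schema_parts]; exact hp)]
  conv_rhs => rw [← Finset.image_id (s := joinRows (I.parts c))]
  exact Finset.image_congr fun t _ => restrict_eq_self fun a _ => Finset.mem_univ a

/-- The configuration is read off from the degrees of the projections of `t` itself. -/
theorem Inst.exists_config (I : Inst q D) {t : Tup V D} (ht : t ∈ joinSet q I.rows) :
    ∃ c ∈ I.liveConfigs, t ∈ joinSet q (I.part c) := by
  set c : Config V m := fun i A => if A ⊆ q.schema i then
    Nat.log 2 (deg (restrict A t) (I.rows i) A) else 0 with hc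
  have hcA : ∀ i A, A ⊆ q.schema i → c i A = Nat.log 2 (deg (restrict A t) (I.rows i) A) :=
    fun i A hA => if_pos hA
  have hpart : ∀ i, restrict (q.schema i) t ∈ I.part c i := fun i =>
    Finset.mem_filter.2 ⟨ht.2 i, fun A hA => by
      rw [Finset.mem_powerset] at hA
      rw [hcA i A hA, restrict_restrict_of_subset hA]⟩
  refine ⟨c, Finset.mem_filter.2 ⟨Finset.mem_filter.2 ⟨?_, fun i => ⟨?_, ?_, ?_⟩⟩,
    fun i => ⟨_, hpart i⟩⟩, ht.1, hpart⟩
  · refine Fintype.mem_piFinset.2 fun i => Fintype.mem_piFinset.2 fun A => ?_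
    by_cases hA : A ⊆ q.schema i
    · rw [if_pos hA, hcA i A hA, Finset.mem_range, Nat.lt_succ_iff]
      exact Nat.log_mono_right (Finset.card_filter_le _ _)
    · rw [if_neg hA, Finset.mem_singleton]
      exact if_neg hA
  · rw [hcA i _ subset_rfl]
    have : deg (restrict (q.schema i) t) (I.rows i) (q.schema i) ≤ 1 := by
      refine Finset.card_le_one.2 fun a ha b hb => ?_
      rw [Finset.mem_filter] at ha hb
      rw [← restrict_eq_self (A := q.schema i) (t := a) fun x => (I.wf i a ha.1 x).1,
        ← restrict_eq_self (A := q.schema i) (t := b) fun x => (I.wf i b hb.1 x).1, ha.2, hb.2]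
    exact Nat.log_of_lt (by omega)
  · rw [hcA i _ (Finset.empty_subset _), deg, Finset.filter_true_of_mem]
    intro r _
    ext1 a
    simp [restrict]
  · intro A' A hA' hA
    rw [hcA i A hA, hcA i A' (hA'.trans hA)]
    refine Nat.log_mono_right (Finset.card_le_card fun r hr => ?_)
    rw [Finset.mem_filter] at hr ⊢
    refine ⟨hr.1, ?_⟩
    rw [← restrict_restrict_of_subset hA' r, hr.2, restrict_restrict_of_subset hA']

theorem coe_runOut {choice : Config V m → Plan V}
    (hch : ∀ c, (choice c).Valid q.schemas Finset.univ) (I : Inst q D) :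
    (runOut choice I : Set (Tup V D)) = joinSet q I.rows := by
  ext t
  rw [runOut, Finset.coe_biUnion]
  simp only [Plan.out_parts (hch _), Set.mem_iUnion, I.coe_joinRows_parts, Finset.mem_coe,
    exists_prop]
  exact ⟨fun ⟨c, _, h⟩ => I.joinSet_part_subset c h, fun h => I.exists_config h⟩

theorem Inst.card_le_IN (I : Inst q D) (i : Fin m) : (I.rows i).card ≤ I.IN :=
  Finset.single_le_sum (f := fun i => (I.rows i).card) (fun _ _ => Nat.zero_le _)
    (Finset.mem_univ i)

/-- A configuration has `m * 2 ^ |V|` entries, each with at most `log₂ IN + 1` values. -/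
theorem Inst.card_configs_le (I : Inst q D) :
    I.configs.card ≤ (Nat.log 2 I.IN + 1) ^ (m * 2 ^ Fintype.card V) := by
  refine (Finset.card_filter_le _ _).trans ?_
  rw [Fintype.card_piFinset]
  have h : ∀ i ∈ (Finset.univ : Finset (Fin m)),
      (Fintype.piFinset fun A => if A ⊆ q.schema i then
        Finset.range (Nat.log 2 (I.rows i).card + 1) else {0}).card
      ≤ (Nat.log 2 I.IN + 1) ^ (2 ^ Fintype.card V) := fun i _ => by
    rw [Fintype.card_piFinset]
    refine (Finset.prod_le_pow_card _ _ (Nat.log 2 I.IN + 1) fun A _ => ?_).trans_eq (by simp)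
    split
    · rw [Finset.card_range]
      exact Nat.succ_le_succ (Nat.log_mono_right (I.card_le_IN i))
    · simp
  refine (Finset.prod_le_pow_card _ _ _ h).trans_eq ?_
  rw [Finset.card_univ, Fintype.card_fin, ← pow_mul, mul_comm]

theorem half_le_log (n : ℕ) : (1 : ℝ) / 2 ≤ Real.log (n + 2) := by
  have h1 := Real.log_two_gt_d9
  have h2 : Real.log 2 ≤ Real.log ((n : ℝ) + 2) := Real.log_le_log (by norm_num) (by simp)
  linarith

theorem natLog_add_one_le (n : ℕ) : (Nat.log 2 n : ℝ) + 1 ≤ 4 * Real.log (n + 2) := by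
  have h1 := Real.log_two_gt_d9
  have h2 : Real.log 2 ≤ Real.log ((n : ℝ) + 2) := Real.log_le_log (by norm_num) (by simp)
  have h3 : (Nat.log 2 n : ℝ) * Real.log 2 ≤ Real.log (n + 2) := by
    rcases Nat.eq_zero_or_pos n with rfl | hn
    · simp [Real.log_nonneg]
    · rw [← Real.log_pow]
      refine Real.log_le_log (by positivity) ?_
      have : ((2 ^ Nat.log 2 n : ℕ) : ℝ) ≤ n := by
        exact_mod_cast Nat.pow_log_le_self 2 hn.ne'
      push_cast at this
      linarith
  have h4 : (0 : ℝ) ≤ Nat.log 2 n := Nat.cast_nonneg _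
  nlinarith

/-- The constant for the total cost over all configurations. -/
def runConst (V : Type*) [Fintype V] (m : ℕ) : ℕ :=
  4 ^ (m * 2 ^ Fintype.card V) * (2 * 2 ^ Fintype.card V + m + 2)

theorem runSteps_le (choice : Config V m → Plan V) (I : Inst q D) {B : ℝ} (hB0 : 0 ≤ B)
    (hB : ∀ c ∈ I.liveConfigs, ((choice c).steps (I.parts c) Finset.univ : ℝ)
      + ((choice c).out (I.parts c) Finset.univ).rows.card ≤ B) :
    (runSteps choice I : ℝ) ≤ runConst V m * Real.log (I.IN + 2) ^ (m * 2 ^ Fintype.card V)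
      * (1 + I.IN + B) := by
  set k := m * 2 ^ Fintype.card V
  set L := Real.log ((I.IN : ℝ) + 2)
  have hL : 1 / 2 ≤ L := half_le_log _
  have hconf : (I.configs.card : ℝ) ≤ (4 * L) ^ k := by
    have h1 : (I.configs.card : ℝ) ≤ ((Nat.log 2 I.IN : ℝ) + 1) ^ k := by
      exact_mod_cast I.card_configs_le
    exact h1.trans (pow_le_pow_left₀ (by positivity) (natLog_add_one_le _) _)
  have h1k : 1 ≤ (4 * L) ^ k := one_le_pow₀ (by linarith)
  have hIN0 : (0 : ℝ) ≤ I.IN := Nat.cast_nonneg _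
  have t1 : ((∑ i, ∑ _A ∈ (q.schema i).powerset, 2 * (I.rows i).card : ℕ) : ℝ)
      ≤ 2 * 2 ^ Fintype.card V * I.IN := by
    have : ∑ i, ∑ _A ∈ (q.schema i).powerset, 2 * (I.rows i).card
        ≤ ∑ i, 2 * 2 ^ Fintype.card V * (I.rows i).card := by
      refine Finset.sum_le_sum fun i _ => ?_
      rw [Finset.sum_const, smul_eq_mul, Finset.card_powerset]
      have := Nat.pow_le_pow_right two_pos (Finset.card_le_univ (q.schema i))
      nlinarith [Nat.zero_le (I.rows i).card, Nat.mul_le_mul_right (2 * (I.rows i).card) this]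
    rw [← Finset.mul_sum] at this
    exact_mod_cast this
  have t2 : ((∑ c ∈ I.configs, (1 + ∑ i, (1 + (I.part c i).card)) : ℕ) : ℝ)
      ≤ (4 * L) ^ k * (1 + m + I.IN) := by
    have : ∑ c ∈ I.configs, (1 + ∑ i, (1 + (I.part c i).card))
        ≤ I.configs.card * (1 + m + I.IN) := by
      rw [← smul_eq_mul]
      refine Finset.sum_le_card_nsmul _ _ _ fun c _ => ?_
      rw [Finset.sum_add_distrib, add_assoc]
      gcongr
      · simp
      · exact Finset.sum_le_sum fun i _ => Finset.card_filter_le _ _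
    have : ((∑ c ∈ I.configs, (1 + ∑ i, (1 + (I.part c i).card)) : ℕ) : ℝ)
        ≤ I.configs.card * (1 + m + I.IN) := by exact_mod_cast this
    exact this.trans (by gcongr)
  have t3 : ((∑ c ∈ I.liveConfigs, ((choice c).steps (I.parts c) Finset.univ
      + ((choice c).out (I.parts c) Finset.univ).rows.card) : ℕ) : ℝ) ≤ (4 * L) ^ k * B := by
    push_cast
    refine (Finset.sum_le_card_nsmul _ _ B hB).trans ?_
    rw [nsmul_eq_mul]
    gcongr
    exact le_trans (by exact_mod_cast Finset.card_filter_le _ _) hconf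
  have hm : (0 : ℝ) ≤ m := Nat.cast_nonneg _
  have hP : (1 : ℝ) ≤ 2 ^ Fintype.card V := one_le_pow₀ one_le_two
  calc (runSteps choice I : ℝ)
      ≤ 2 * 2 ^ Fintype.card V * I.IN + (4 * L) ^ k * (1 + m + I.IN) + (4 * L) ^ k * B := by
        rw [runSteps]; push_cast [-Nat.cast_sum] ; gcongr
    _ ≤ (4 * L) ^ k * (2 * 2 ^ Fintype.card V * I.IN) + (4 * L) ^ k * (1 + m + I.IN)
        + (4 * L) ^ k * B := by
        have := le_mul_of_one_le_left (b := 2 * 2 ^ Fintype.card V * (I.IN : ℝ))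
          (by positivity) h1k
        linarith
    _ = (4 * L) ^ k * (2 * 2 ^ Fintype.card V * I.IN + (1 + m + I.IN) + B) := by ring
    _ ≤ (4 * L) ^ k * ((2 * 2 ^ Fintype.card V + m + 2) * (1 + I.IN + B)) := by
        gcongr
        nlinarith [mul_nonneg hm hIN0, mul_nonneg hm hB0,
          mul_nonneg (zero_le_one.trans hP) hB0]
    _ = _ := by
        rw [runConst, mul_pow]; push_cast; ring

theorem Inst.one_le_IN (I : Inst q D) (i : Fin m) : (1 : ℝ) ≤ I.IN :=
  (I.one_le_card i).trans (by exact_mod_cast I.card_le_IN i)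

theorem Query.coe_schemas (q : Query V m) :
    (q.schemas : Multiset (Finset V)) = Finset.univ.val.map q.schema := by
  rw [Query.schemas, Fin.univ_val_map]

theorem Inst.packs_part {I : Inst q D} {c : Config V m} (hc : c ∈ I.configs) (i : Fin m) :
    Packs [(⟨q.schema i, I.part c i⟩ : Table V D)] (q.schema i) (I.rows i).card :=
  I.packs_schema hc ⟨_, List.mem_singleton_self _, I.dominates_part c _ i⟩

theorem mul_mul_le_of_le {R P x c N : ℝ} (hR : 0 ≤ R) (hP : 0 ≤ P) (h : x ≤ c * N) :
    R * P * x ≤ R * c * P * N :=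
  (mul_le_mul_of_nonneg_left h (mul_nonneg hR hP)).trans_eq (by ring)

universe u

theorem earPlan_run {q : Query V m} (hm : 0 < m) {p : Plan V} (hp : p.EarPlan q.schemas) :
    ∃ (C : ℝ) (k : ℕ), ∀ (D : Type u) [DecidableEq D] (I : Inst q D),
      (runOut (fun _ => p) I : Set (Tup V D)) = joinSet q I.rows ∧
      (runSteps (fun _ => p) I : ℝ) ≤ C * Real.log (I.IN + 2) ^ k * (I.IN + I.OUT) := by
  have hv : p.Valid q.schemas Finset.univ := by
    rw [← q.unionAll_schemas]; exact hp.valid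
  obtain ⟨C, K, hCK⟩ := Plan.EarPlan.steps_le.{u, _} hp
  refine ⟨runConst V m * (C + K + 3), m * 2 ^ Fintype.card V, fun D _ I =>
    ⟨coe_runOut (fun _ => hv) I, ?_⟩⟩
  have hIN : (1 : ℝ) ≤ I.IN := I.one_le_IN ⟨0, hm⟩
  have hO0 : (0 : ℝ) ≤ I.OUT := Nat.cast_nonneg _
  have hC0 : (0 : ℝ) ≤ C := Nat.cast_nonneg _
  have hK0 : (0 : ℝ) ≤ K := Nat.cast_nonneg _
  refine (runSteps_le (fun _ => p) I (B := C * I.IN + K * I.OUT + I.OUT) (by positivity)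
    fun c hc => ?_).trans ?_
  · have hc' := (Finset.mem_filter.1 hc).1
    have h1 := hCK D (I.parts c) I.IN (I.map_schema_parts c) (I.wf_parts c) hIN
      (fun R hR => by
        obtain ⟨i, rfl⟩ := (I.mem_parts c).1 hR
        exact_mod_cast (Finset.card_filter_le _ _).trans (I.card_le_IN i))
      (fun R hR => by
        obtain ⟨i, rfl⟩ := (I.mem_parts c).1 hR
        exact (I.packs_part hc' i).mono (by linarith [I.one_le_card i])
          (by exact_mod_cast I.card_le_IN i) fun T hT => ⟨T, hT, rfl, subset_rfl⟩)
    rw [q.unionAll_schemas] at h1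
    have h2 : ((joinRows (I.parts c)).card : ℝ) ≤ I.OUT := by
      rw [I.card_joinRows_parts]; exact_mod_cast I.ncard_joinSet_part_le c
    rw [Plan.out_parts hv]
    have h3 : (K : ℝ) * (joinRows (I.parts c)).card ≤ K * I.OUT := by gcongr
    linarith
  · have hL : (0 : ℝ) ≤ Real.log (I.IN + 2) := by linarith [half_le_log I.IN]
    exact mul_mul_le_of_le (Nat.cast_nonneg _) (by positivity) (by nlinarith)

theorem light_run (q : Query V m) :
    ∃ (C : ℝ) (k : ℕ), ∀ (D : Type u) [DecidableEq D] (I : Inst q D),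
      (∀ c ∈ I.liveConfigs, dbpBound (I.parts c) Finset.univ ≤ I.agm Finset.univ) ∧
      (runOut (fun _ => .light Finset.univ .done) I : Set (Tup V D)) = joinSet q I.rows ∧
      (runSteps (fun _ => .light Finset.univ .done) I : ℝ) ≤
        C * Real.log (I.IN + 2) ^ k * (I.IN + I.agm Finset.univ) := by
  have hv : (Plan.light Finset.univ .done : Plan V).Valid q.schemas Finset.univ := by
    refine ⟨by rw [q.unionAll_schemas], Finset.univ, ?_, subset_rfl⟩
    simp
  refine ⟨runConst V m * (lightConst V m + 3 * loopConst V m + 3), m * 2 ^ Fintype.card V,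
    fun D _ I => ⟨fun c hc => ?_, coe_runOut (fun _ => hv) I, ?_⟩⟩
  · have hc' := (Finset.mem_filter.1 hc).1
    exact (I.packs_agm hc' fun i => ⟨_, (I.mem_parts c).2 ⟨i, rfl⟩,
      I.dominates_part c _ i⟩).dbpBound_le (by linarith [I.one_le_agm Finset.univ])
  have hagm := I.one_le_agm Finset.univ
  have hIN0 : (0 : ℝ) ≤ I.IN := Nat.cast_nonneg _
  -- Scanning costs IN, which the AGM bound need not dominate.
  set N : ℝ := I.IN + I.agm Finset.univ with hN
  have hN1 : 1 ≤ N := by linarith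
  have hl0 : (0 : ℝ) ≤ lightConst V m := Nat.cast_nonneg _
  have ho0 : (0 : ℝ) ≤ loopConst V m := Nat.cast_nonneg _
  refine (runSteps_le _ I (B := (lightConst V m + 3 * loopConst V m + 1) * N) (by positivity)
    fun c hc => ?_).trans ?_
  · have hc' := (Finset.mem_filter.1 hc).1
    have hpack : Packs (I.parts c) Finset.univ N :=
      (I.packs_agm hc' fun i => ⟨_, (I.mem_parts c).2 ⟨i, rfl⟩,
        I.dominates_part c _ i⟩).mono (by linarith) (by linarith)
        fun T hT => ⟨T, hT, rfl, subset_rfl⟩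
    have hlen : (I.parts c).length = m := by simp [Inst.parts]
    have h1 := hpack.lightSteps_le (I.wf_parts c) (by linarith) fun R hR => by
      obtain ⟨i, rfl⟩ := (I.mem_parts c).1 hR
      have : ((I.part c i).card : ℝ) ≤ I.IN := by
        exact_mod_cast (Finset.card_filter_le _ _).trans (I.card_le_IN i)
      simp only
      linarith
    have h2 := hpack.card_lightRel_le (I.wf_parts c) (by linarith)
    rw [hlen] at h1 h2
    have hX : Finset.univ ⊆ attrs (I.parts c) := by rw [I.attrs_parts]
    have hred : lightReduce (I.parts c) Finset.univ = [lightRel (I.parts c) Finset.univ] := by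
      simp [lightReduce]
    have hwl := wf_lightRel (I.wf_parts c) hX
    rw [Plan.out_parts hv, ← joinRows_lightReduce (I.wf_parts c) hX, Plan.steps, Plan.steps,
      hred, joinSteps_single hwl, joinRows_single hwl]
    push_cast
    linarith
  · have hL : (0 : ℝ) ≤ Real.log (I.IN + 2) := by linarith [half_le_log I.IN]
    exact mul_mul_le_of_le (Nat.cast_nonneg _) (by positivity) (by nlinarith)

end Runs

/-! ## Light transforms on all bags, followed by Split on ears -/

section Bags

set_option linter.unusedSectionVars false

variable {V : Type*} [Fintype V] [DecidableEq V]

/-- Light transforms on the given sets, followed by the plan `p`. -/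
def Plan.lights (bs : List (Finset V)) (p : Plan V) : Plan V := bs.foldr .light p

/-- The schemas that remain after Light transforms on the given sets. -/
def lightsSchemas : List (Finset V) → List (Finset V) → List (Finset V)
  | [], l => l
  | b :: bs, l => lightsSchemas bs (b :: l.filter fun s => ¬ s ⊆ b)

theorem unionAll_lightsSchemas {bs l : List (Finset V)} (h : ∀ b ∈ bs, b ⊆ unionAll l) :
    unionAll (lightsSchemas bs l) = unionAll l := by
  induction bs generalizing l with
  | nil => rfl
  | cons b bs ih =>
    rw [List.forall_mem_cons] at h
    rw [lightsSchemas, ih, unionAll_light h.1]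
    rw [unionAll_light h.1]
    exact h.2

/-- The hypothesis prevents a later Light transform from swallowing the table of an earlier bag. -/
theorem lightsSchemas_eq {bs : List (Finset V)} (l : List (Finset V))
    (h : bs.Pairwise fun b b' => ¬ b ⊆ b') :
    lightsSchemas bs l = bs.reverse ++ l.filter fun s => ∀ b ∈ bs, ¬ s ⊆ b := by
  induction bs generalizing l with
  | nil => simp [lightsSchemas]
  | cons b bs ih =>
    rw [List.pairwise_cons] at h
    rw [lightsSchemas, ih _ h.2, List.filter_cons_of_pos (by simpa using h.1),
      List.filter_filter, List.reverse_cons, List.append_assoc, List.singleton_append]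
    congr 2
    refine List.filter_congr fun s _ => ?_
    simp [Bool.and_comm]

theorem Plan.lights_valid {bs l : List (Finset V)} {p : Plan V} {O : Finset V}
    (h : ∀ b ∈ bs, b ⊆ unionAll l) (hp : p.Valid (lightsSchemas bs l) O) :
    (Plan.lights bs p).Valid l O := by
  induction bs generalizing l with
  | nil => exact hp
  | cons b bs ih =>
    rw [List.forall_mem_cons] at h
    refine ⟨h.1, ih ?_ hp⟩
    rw [unionAll_light h.1]
    exact h.2

theorem Plan.splitLight_lights {bs : List (Finset V)} {p : Plan V} (hp : p.SplitLight) :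
    (Plan.lights bs p).SplitLight := by
  induction bs with
  | nil => exact hp
  | cons b bs ih => exact ih

theorem Plan.EarPlan.splitLight {p : Plan V} {l : List (Finset V)} (hp : p.EarPlan l) :
    p.SplitLight := by
  induction hp with
  | single s => trivial
  | step l k j p hear hp ih => exact ⟨trivial, ih, trivial⟩

variable {m : ℕ} {q : Query V m}

/-- Each relation of the query has a table that contains its schema and restricts to rows of
`R(c)`. -/
def Inst.Refines {D : Type*} [DecidableEq D] (I : Inst q D) (c : Config V m)
    (Rs : List (Table V D)) : Prop :=
  ∀ i, ∃ T ∈ Rs, q.schema i ⊆ T.schema ∧ ∀ t ∈ T.rows, restrict (q.schema i) t ∈ I.part c i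

theorem Inst.Refines.dominates {D : Type*} [DecidableEq D] {I : Inst q D} {c : Config V m}
    {Rs : List (Table V D)} (h : I.Refines c Rs) (X : Finset V) (i : Fin m) :
    ∃ T ∈ Rs, I.Dominates c X i T := by
  obtain ⟨T, hT, hs, hr⟩ := h i
  refine ⟨T, hT, Finset.inter_subset_left.trans hs, fun t ht => ?_⟩
  exact Finset.mem_image.2 ⟨_, hr t ht, restrict_restrict_of_subset Finset.inter_subset_left t⟩

theorem Inst.Refines.lightReduce {D : Type*} [DecidableEq D] {I : Inst q D} {c : Config V m}
    {Rs : List (Table V D)} (h : I.Refines c Rs) (hwf : ∀ R ∈ Rs, R.WF) {X : Finset V}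
    (hX : X ⊆ attrs Rs) : I.Refines c (lightReduce Rs X) := fun i => by
  obtain ⟨T, hT, hs, hr⟩ := h i
  by_cases hTX : T.schema ⊆ X
  · refine ⟨_, mem_lightReduce.2 (.inl rfl), hs.trans hTX, fun u hu => ?_⟩
    rw [← restrict_restrict_of_subset hs]
    exact hr _ (restrict_mem_of_mem_lightRel hwf hX hT hTX hu)
  · exact ⟨T, mem_lightReduce.2 (.inr ⟨hT, hTX⟩), hs, hr⟩

/-- The filters by every `π_X(T)` force the degree structure of all relations on `R_X`. Hence this
one table packs its bag within AGM, as the ear phase requires. -/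
theorem Inst.Refines.dominates_lightRel {D : Type*} [DecidableEq D] {I : Inst q D}
    {c : Config V m} {Rs : List (Table V D)} (h : I.Refines c Rs) (hwf : ∀ R ∈ Rs, R.WF)
    {X : Finset V} (hX : X ⊆ attrs Rs) (i : Fin m) : I.Dominates c X i (lightRel Rs X) := by
  obtain ⟨T, hT, hs, hr⟩ := h i
  refine ⟨Finset.inter_subset_right, fun u hu => ?_⟩
  obtain ⟨r, hrT, he⟩ := Finset.mem_image.1 (((mem_lightRel hwf hX).1 hu).2 T hT)
  refine Finset.mem_image.2 ⟨_, hr r hrT, ?_⟩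
  rw [restrict_restrict_of_subset Finset.inter_subset_left,
    ← restrict_restrict_of_subset Finset.inter_subset_right r, he,
    restrict_restrict_of_subset (Finset.inter_subset_inter_right hs)]

universe u

/-- Invariant: a table either packs its own schema within `N`, or lies in a bag still to come and
will be swallowed. When no bags are left, only the first alternative remains and the ear bound
applies. -/
theorem Plan.lights_steps_le {bs l : List (Finset V)} {p : Plan V}
    (hp : p.EarPlan (lightsSchemas bs l)) (hbs : ∀ b ∈ bs, b ⊆ unionAll l) {κ : ℕ}
    (hκ : 1 ≤ κ) :
    ∃ C K : ℕ, ∀ (D : Type u) [DecidableEq D] (I : Inst q D) (c : Config V m)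
      (Rs : List (Table V D)) (N : ℝ), c ∈ I.configs → Rs.map Table.schema = l →
      (∀ R ∈ Rs, R.WF) → 1 ≤ N → (∀ b ∈ bs, I.agm b ≤ N) →
      (∀ R ∈ Rs, (R.rows.card : ℝ) ≤ κ * N) → I.Refines c Rs →
      (∀ R ∈ Rs, Packs [R] R.schema N ∨ ∃ b ∈ bs, R.schema ⊆ b) →
      ((Plan.lights bs p).steps Rs (unionAll l) : ℝ) ≤ C * N + K * (joinRows Rs).card := by
  induction bs generalizing l κ with
  | nil =>
    obtain ⟨C, K, h⟩ := hp.steps_le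
    refine ⟨C * κ, K, fun D _ I c Rs N hc hl hwf hN _ hcard _ hpack => ?_⟩
    have hκ' : (1 : ℝ) ≤ κ := by exact_mod_cast hκ
    have hNN : N ≤ κ * N := le_mul_of_one_le_left (by linarith) hκ'
    have := h D Rs (κ * N) hl hwf (by linarith) hcard fun R hR =>
      ((hpack R hR).resolve_right (by simp)).mono (by linarith) hNN
        fun T hT => ⟨T, hT, rfl, subset_rfl⟩
    push_cast
    rw [mul_assoc]
    exact this
  | cons b bs ih =>
    rw [List.forall_mem_cons] at hbs
    obtain ⟨C, K, h⟩ := ih hp (by rw [unionAll_light hbs.1]; exact hbs.2)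
      -- Only the row counts acquire a constant with each Light transform; the certificates keep the
      -- same `N`.
      (κ := κ + loopConst V l.length) (by omega)
    refine ⟨lightConst V l.length * κ + C, K,
      fun D _ I c Rs N hc hl hwf hN hagm hcard href hpack => ?_⟩
    rw [List.forall_mem_cons] at hagm
    have hlen : Rs.length = l.length := by rw [← hl, List.length_map]
    have hκ' : (1 : ℝ) ≤ κ := by exact_mod_cast hκ
    have hNN : N ≤ κ * N := le_mul_of_one_le_left (by linarith) hκ'
    have hX : b ⊆ attrs Rs := by rw [attrs, hl]; exact hbs.1
    have hpos : 0 < I.agm b := by linarith [I.one_le_agm b]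
    have hpb : Packs Rs b N := (I.packs_agm hc (href.dominates b)).mono hpos hagm.1
      fun T hT => ⟨T, hT, rfl, subset_rfl⟩
    have hpb' : Packs Rs b (κ * N) := hpb.mono (by linarith) hNN
      fun T hT => ⟨T, hT, rfl, subset_rfl⟩
    have h1 := hpb'.lightSteps_le hwf (by linarith) hcard
    have h2 := hpb.card_lightRel_le hwf (by linarith)
    rw [hlen] at h1 h2
    have h3 := h D I c (lightReduce Rs b) N hc (by rw [map_schema_lightReduce, hl])
      (fun R => wf_lightReduce hwf hX) hN hagm.2
      (fun R hR => by
        push_cast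
        rcases mem_lightReduce.1 hR with rfl | hR
        · nlinarith
        · have := hcard R hR.1
          have : (0 : ℝ) ≤ loopConst V l.length * N := by positivity
          linarith)
      (href.lightReduce hwf hX)
      (fun R hR => by
        rcases mem_lightReduce.1 hR with rfl | hR
        · exact .inl ((I.packs_agm hc fun i => ⟨_, List.mem_singleton_self _,
            href.dominates_lightRel hwf hX i⟩).mono hpos hagm.1
              fun T hT => ⟨T, hT, rfl, subset_rfl⟩)
        · refine (hpack R hR.1).imp_right ?_
          rintro ⟨b', hb', hs⟩
          rcases List.mem_cons.1 hb' with rfl | hb'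
          · exact absurd hs hR.2
          · exact ⟨b', hb', hs⟩)
    rw [joinRows_lightReduce hwf hX, unionAll_light hbs.1] at h3
    change ((lightSteps Rs b + (Plan.lights bs p).steps (lightReduce Rs b) (unionAll l) : ℕ) : ℝ)
      ≤ _
    push_cast
    linarith

/-- The bags of an acyclic decomposition of the query, none of which contains another. -/
def Query.GoodBags (q : Query V m) (B : Finset (Finset V)) : Prop :=
  Acyc B.val ∧ (∀ i, ∃ b ∈ B, q.schema i ⊆ b) ∧ ∀ s ∈ B, ∀ t ∈ B, s ⊆ t → s = t

theorem Query.goodBags_univ (q : Query V m) : q.GoodBags {Finset.univ} :=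
  ⟨.single _, fun i => ⟨Finset.univ, by simp, Finset.subset_univ _⟩, by simp⟩

theorem GHD.exists_goodBags {n : ℕ} (T : GHD q n) :
    ∃ B, q.GoodBags B ∧ ∀ b ∈ B, ∃ t, T.bag t = b := by
  obtain ⟨B, h1, h2, h3, h4⟩ := (Acyc.of_tree T.tree T.isTree T.bag T.running).exists_antichain
  refine ⟨B, ⟨h1, fun i => ?_, h4⟩, fun b hb => ?_⟩
  · obtain ⟨t, ht⟩ := T.covers i
    obtain ⟨b, hb, htb⟩ := h3 (T.bag t) (Multiset.mem_map_of_mem _ (Finset.mem_univ t))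
    exact ⟨b, hb, ht.trans htb⟩
  · obtain ⟨t, -, ht⟩ := Multiset.mem_map.1 (Multiset.mem_of_le h2 hb)
    exact ⟨t, ht⟩

theorem Query.GoodBags.exists_plan {B : Finset (Finset V)} (hB : q.GoodBags B) :
    ∃ (p : Plan V) (C K : ℕ), p.SplitLight ∧ p.Valid q.schemas Finset.univ ∧
      ∀ (D : Type u) [DecidableEq D] (I : Inst q D) (c : Config V m) (N : ℝ),
        c ∈ I.configs → 1 ≤ N → (I.IN : ℝ) ≤ N → (∀ b ∈ B, I.agm b ≤ N) →
        (p.steps (I.parts c) Finset.univ : ℝ) ≤ C * N + K * (joinSet q (I.part c)).ncard := by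
  obtain ⟨hac, hcov, hanti⟩ := hB
  have hpw : B.toList.Pairwise fun b b' => ¬ b ⊆ b' := by
    refine List.Pairwise.imp_of_mem (fun {a b} ha hb hne hab => hne ?_) B.nodup_toList
    exact hanti a (Finset.mem_toList.1 ha) b (Finset.mem_toList.1 hb) hab
  have hsch : lightsSchemas B.toList q.schemas = B.toList.reverse := by
    rw [lightsSchemas_eq _ hpw, List.filter_eq_nil_iff.2, List.append_nil]
    intro s hs
    obtain ⟨i, rfl⟩ := (List.mem_ofFn' _ _).1 hs
    obtain ⟨b, hb, hsb⟩ := hcov i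
    simpa using ⟨b, hb, hsb⟩
  have hac' : Acyc ((lightsSchemas B.toList q.schemas : List (Finset V)) :
      Multiset (Finset V)) := by
    rw [hsch, Multiset.coe_reverse, Finset.coe_toList]
    exact hac
  obtain ⟨p, hp⟩ := hac'.exists_earPlan
  have hsub : ∀ b ∈ B.toList, b ⊆ unionAll q.schemas := fun b _ => by
    rw [q.unionAll_schemas]; exact Finset.subset_univ b
  obtain ⟨C, K, h⟩ := Plan.lights_steps_le.{u} (q := q) hp hsub le_rfl
  refine ⟨Plan.lights B.toList p, C, K, Plan.splitLight_lights hp.splitLight,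
    Plan.lights_valid hsub ?_, fun D _ I c N hc hN hIN hagm => ?_⟩
  · have := hp.valid
    rwa [unionAll_lightsSchemas hsub, q.unionAll_schemas] at this
  · have := h D I c (I.parts c) N hc (I.map_schema_parts c) (I.wf_parts c) hN
      (fun b hb => hagm b (Finset.mem_toList.1 hb))
      (fun R hR => by
        obtain ⟨i, rfl⟩ := (I.mem_parts c).1 hR
        rw [Nat.cast_one, one_mul]
        refine le_trans ?_ hIN
        exact_mod_cast (Finset.card_filter_le _ _).trans (I.card_le_IN i))
      (fun i => ⟨_, (I.mem_parts c).2 ⟨i, rfl⟩, subset_rfl, fun t ht => by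
        rwa [restrict_eq_self fun a =>
          (I.wf i t (Finset.filter_subset _ _ ht) a).1]⟩)
      (fun R hR => by
        obtain ⟨i, rfl⟩ := (I.mem_parts c).1 hR
        obtain ⟨b, hb, hsb⟩ := hcov i
        exact .inr ⟨b, Finset.mem_toList.2 hb, hsb⟩)
    rwa [q.unionAll_schemas, I.card_joinRows_parts] at this

/-! ### The plan chosen by DARTS -/

theorem dartsChoice_spec {rep : Set (Plan V)} (hrep : {p | p.SplitLight} ⊆ rep) (q : Query V m)
    (D : Type u) [DecidableEq D] (K : ℕ) (c : Config V m) :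
    (dartsChoice q D K rep c).Valid q.schemas Finset.univ ∧
      ∀ p : Plan V, p.SplitLight → p.Valid q.schemas Finset.univ →
        qBound q D K c (dartsChoice q D K rep c) ≤ qBound q D K c p := by
  have h : ∃ p, (p ∈ rep ∧ p.Valid q.schemas Finset.univ) ∧
      ∀ p', p' ∈ rep ∧ p'.Valid q.schemas Finset.univ → qBound q D K c p ≤ qBound q D K c p' := by
    -- The one-bag plan shows that there is an applicable plan; a minimum exists because `ℕ∞` is
    -- well ordered.
    obtain ⟨p₀, -, -, h1, h2, -⟩ := q.goodBags_univ.exists_plan.{u}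
    obtain ⟨_, ⟨p, hp, rfl⟩, hmin⟩ := wellFounded_lt.has_min
      ((qBound q D K c) '' {p | p ∈ rep ∧ p.Valid q.schemas Finset.univ})
      ⟨_, p₀, ⟨hrep h1, h2⟩, rfl⟩
    exact ⟨p, hp, fun p' hp' => not_lt.1 (hmin _ ⟨p', hp', rfl⟩)⟩
  rw [dartsChoice, dif_pos h]
  exact ⟨h.choose_spec.1.2, fun p h1 h2 => h.choose_spec.2 p ⟨hrep h1, h2⟩⟩

/-- The entry `c i ∅` fixes the bucket of the relation size. -/
theorem Inst.card_le_two_mul {D : Type*} [DecidableEq D] {I I' : Inst q D} {c : Config V m}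
    (h : c ∈ I.configs) (h' : c ∈ I'.configs) (i : Fin m) :
    (I'.rows i).card ≤ 2 * (I.rows i).card := by
  have h1 := (I.mem_configs h i).2.1
  have h2 := (I'.mem_configs h' i).2.1
  have h3 := Nat.lt_pow_succ_log_self one_lt_two (I'.rows i).card
  have h4 := Nat.pow_log_le_self 2 (I.nonempty i).card_pos.ne'
  rw [← h2, h1, pow_succ] at h3
  omega

theorem Inst.agm_le_two_pow_mul {D : Type*} [DecidableEq D] {I I' : Inst q D}
    {c : Config V m} (h : c ∈ I.configs) (h' : c ∈ I'.configs) (X : Finset V) :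
    I'.agm X ≤ 2 ^ m * I.agm X := by
  have h2 : (0 : ℝ) < 2 ^ m := by positivity
  rw [← div_le_iff₀' h2]
  refine le_csInf ⟨_, _, q.fracCover_one X, rfl⟩ ?_
  rintro _ ⟨w, hw, rfl⟩
  rw [div_le_iff₀' h2]
  -- Weights truncated at 1 still cover, and keep the loss from each relation below a factor 2,
  -- whatever `w` is.
  have hw' : q.FracCover X fun i => min (w i) 1 := by
    refine ⟨fun i => le_min (hw.1 i) zero_le_one, fun a ha => ?_⟩
    by_cases hall : ∃ i, a ∈ q.schema i ∧ 1 ≤ w i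
    · obtain ⟨i, hi, hwi⟩ := hall
      have := Finset.single_le_sum (f := fun i => min (w i) 1)
        (s := Finset.univ.filter fun i => a ∈ q.schema i)
        (fun i _ => le_min (hw.1 i) zero_le_one) (by simpa using hi)
      simpa [min_eq_right hwi] using this
    · push Not at hall
      refine (hw.2 a ha).trans_eq (Finset.sum_congr rfl fun i hi => ?_)
      exact (min_eq_left (hall i (Finset.mem_filter.1 hi).2).le).symm
  calc I'.agm X ≤ ∏ i, ((I'.rows i).card : ℝ) ^ min (w i) 1 := I'.agm_le hw'
    _ ≤ ∏ i, (2 * ((I.rows i).card : ℝ) ^ w i) := by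
        refine Finset.prod_le_prod (fun i _ => by positivity) fun i _ => ?_
        have h3 : ((I'.rows i).card : ℝ) ≤ 2 * (I.rows i).card := by
          exact_mod_cast Inst.card_le_two_mul h h' i
        have h4 : (0 : ℝ) ≤ min (w i) 1 := le_min (hw.1 i) zero_le_one
        calc ((I'.rows i).card : ℝ) ^ min (w i) 1
            ≤ (2 * (I.rows i).card : ℝ) ^ min (w i) 1 :=
              Real.rpow_le_rpow (by positivity) h3 h4
          _ = 2 ^ min (w i) 1 * ((I.rows i).card : ℝ) ^ min (w i) 1 :=
              Real.mul_rpow (by positivity) (by positivity)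
          _ ≤ 2 ^ (1 : ℝ) * ((I.rows i).card : ℝ) ^ w i := by
              gcongr
              · exact one_le_two
              · exact min_le_right _ _
              · exact I.one_le_card i
              · exact min_le_left _ _
          _ = _ := by rw [Real.rpow_one]
    _ = _ := by rw [Finset.prod_mul_distrib]; simp

/-- The constants are summed over the finitely many families `B`, so they depend neither on the best
family for the data nor on the repertoire. The chosen plan need not resemble the plan of `B`; only
the values of `qBound` are compared. -/
theorem darts_run (q : Query V m) :
    ∃ K₀ : ℕ, ∀ K ≥ K₀, ∃ (C : ℝ) (k : ℕ), 0 ≤ C ∧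
      ∀ rep : Set (Plan V), {p | p.SplitLight} ⊆ rep →
      ∀ (D : Type u) [DecidableEq D] (I : Inst q D),
        (runOut (dartsChoice q D K rep) I : Set (Tup V D)) = joinSet q I.rows ∧
        ∀ (B : Finset (Finset V)) (N : ℝ), q.GoodBags B → 1 ≤ N → (I.IN : ℝ) ≤ N →
          (∀ b ∈ B, I.agm b ≤ N) →
          (runSteps (dartsChoice q D K rep) I : ℝ) ≤
            C * Real.log (I.IN + 2) ^ k * (N + I.OUT) := by
  classical
  have hex : ∀ B : Finset (Finset V), ∃ (p : Plan V) (C K : ℕ), q.GoodBags B →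
      p.SplitLight ∧ p.Valid q.schemas Finset.univ ∧
      ∀ (D : Type u) [DecidableEq D] (I : Inst q D) (c : Config V m) (N : ℝ),
        c ∈ I.configs → 1 ≤ N → (I.IN : ℝ) ≤ N → (∀ b ∈ B, I.agm b ≤ N) →
        (p.steps (I.parts c) Finset.univ : ℝ) ≤ C * N + K * (joinSet q (I.part c)).ncard :=
    fun B => by
      by_cases hB : q.GoodBags B
      · obtain ⟨p, C, K, h⟩ := hB.exists_plan.{u}
        exact ⟨p, C, K, fun _ => h⟩
      · exact ⟨.done, 0, 0, fun h => absurd h hB⟩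
  choose P C Kf hP using hex
  refine ⟨∑ B, Kf B, fun K hK => ⟨runConst V m * ((∑ B, C B : ℕ) * (2 * 2 ^ m) + K + 3),
    m * 2 ^ Fintype.card V, by positivity, fun rep hrep D _ I =>
    ⟨coe_runOut (fun c => (dartsChoice_spec hrep q D K c).1) I, fun B N hB hN hIN hagm => ?_⟩⟩⟩
  obtain ⟨hsl, hval, hst⟩ := hP B hB
  have hKB : Kf B ≤ K := (Finset.single_le_sum (fun _ _ => Nat.zero_le _)
    (Finset.mem_univ B)).trans hK
  have hCB : (C B : ℝ) ≤ (∑ B, C B : ℕ) := by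
    exact_mod_cast Finset.single_le_sum (f := C) (fun _ _ => Nat.zero_le _) (Finset.mem_univ B)
  have hO0 : (0 : ℝ) ≤ I.OUT := Nat.cast_nonneg _
  have hK0 : (0 : ℝ) ≤ K := Nat.cast_nonneg _
  have h2m : (1 : ℝ) ≤ 2 ^ m := one_le_pow₀ one_le_two
  set C₁ : ℝ := ((∑ B, C B : ℕ) : ℝ) with hC₁
  have hC0 : 0 ≤ C₁ := Nat.cast_nonneg _
  -- Large enough for every input with the same configuration: input sizes vary by a factor 2, AGM
  -- bounds by `2 ^ m`.
  set N' : ℝ := 2 * 2 ^ m * N with hN'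
  have hNN : 2 * N ≤ N' := by rw [hN']; nlinarith
  have hq : ∀ c ∈ I.liveConfigs, qBound q D K c (P B) ≤ (⌊C₁ * N'⌋₊ : ℕ) := fun c hc => by
    have hc' := (Finset.mem_filter.1 hc).1
    refine iSup_le fun ⟨I', hI'⟩ => ?_
    have hI'c := (Finset.mem_filter.1 hI').1
    have h1 := hst D I' c N' hI'c (by linarith) (by
      have : I'.IN ≤ 2 * I.IN := by
        rw [Inst.IN, Inst.IN, Finset.mul_sum]
        exact Finset.sum_le_sum fun i _ => Inst.card_le_two_mul hc' hI'c i
      have : (I'.IN : ℝ) ≤ 2 * I.IN := by exact_mod_cast this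
      linarith) fun b hb => by
        have h3 := Inst.agm_le_two_pow_mul hc' hI'c b
        have h4 := hagm b hb
        have h5 := mul_le_mul_of_nonneg_left h4 (zero_le_one.trans h2m)
        rw [hN']
        nlinarith
    rw [Nat.cast_le]
    refine Nat.le_floor ?_
    -- The subtraction in `qBound` is truncated.
    rcases le_total ((P B).steps (I'.parts c) Finset.univ) (K * (joinSet q (I'.part c)).ncard)
      with h6 | h6
    · rw [Nat.sub_eq_zero_of_le h6, Nat.cast_zero]; positivity
    · rw [Nat.cast_sub h6]
      push_cast
      have h7 : (Kf B : ℝ) * (joinSet q (I'.part c)).ncard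
          ≤ K * (joinSet q (I'.part c)).ncard := by gcongr
      have h8 : (C B : ℝ) * N' ≤ C₁ * N' := by
        gcongr
      linarith
  refine (runSteps_le _ I (B := C₁ * N' + K * I.OUT + I.OUT) (by positivity)
    fun c hc => ?_).trans ?_
  · obtain ⟨hv, hmin⟩ := dartsChoice_spec hrep q D K c
    have h1 := (hmin (P B) hsl hval).trans (hq c hc)
    -- The given input is itself one of those over which the supremum is taken.
    have h2 := (le_iSup (fun I : {I : Inst q D // c ∈ I.liveConfigs} =>
      (((dartsChoice q D K rep c).steps (I.1.parts c) Finset.univ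
        - K * (joinSet q (I.1.part c)).ncard : ℕ) : ℕ∞)) ⟨I, hc⟩).trans h1
    rw [Nat.cast_le] at h2
    have h3 : (dartsChoice q D K rep c).steps (I.parts c) Finset.univ
        ≤ ⌊C₁ * N'⌋₊ + K * I.OUT := by
      have h4 := Nat.mul_le_mul_left K (I.ncard_joinSet_part_le c)
      simp only at h2
      omega
    have h5 : ((dartsChoice q D K rep c).steps (I.parts c) Finset.univ : ℝ)
        ≤ ⌊C₁ * N'⌋₊ + K * I.OUT := by exact_mod_cast h3
    have h6 : (⌊C₁ * N'⌋₊ : ℝ) ≤ C₁ * N' := Nat.floor_le (by positivity)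
    have h7 : ((joinRows (I.parts c)).card : ℝ) ≤ I.OUT := by
      rw [I.card_joinRows_parts]; exact_mod_cast I.ncard_joinSet_part_le c
    rw [Plan.out_parts hv]
    linarith
  · have hL : (0 : ℝ) ≤ Real.log (I.IN + 2) := by linarith [half_le_log I.IN]
    refine mul_mul_le_of_le (Nat.cast_nonneg _) (by positivity) ?_
    have e1 : 0 ≤ C₁ * (2 * 2 ^ m) * I.OUT := by positivity
    have e2 : 0 ≤ K * N := by positivity
    rw [hN']
    nlinarith

end Bags

/-! ## Widths -/

section Widths

set_option linter.unusedSectionVars false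

variable {V : Type*} [Fintype V] [DecidableEq V] {m : ℕ} {q : Query V m}
  {D : Type*} [DecidableEq D]

/-- The decomposition with a single bag. -/
def GHD.single (q : Query V m) : GHD q 1 where
  tree := ⊥
  isTree := .of_subsingleton
  bag _ := Finset.univ
  covers _ := ⟨0, Finset.subset_univ _⟩
  running a := by
    have : Nonempty {t : Fin 1 | a ∈ (Finset.univ : Finset V)} := ⟨⟨0, Finset.mem_univ a⟩⟩
    exact ⟨fun x y => by rw [Subsingleton.elim x y]⟩

theorem GHD.nonempty {n : ℕ} (T : GHD q n) : Nonempty (Fin n) := T.isTree.connected.nonempty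

/-- The width depends only on the set of bags, so it takes finitely many values and the infimum is
attained. -/
theorem exists_ghd_eq_sInf (q : Query V m) (f : Finset V → ℝ) :
    ∃ (n : ℕ) (T : GHD q n),
      sInf {x : ℝ | ∃ (n : ℕ) (T : GHD q n), x = ⨆ t, f (T.bag t)} = ⨆ t, f (T.bag t) := by
  refine Set.Nonempty.csInf_mem (s := {x : ℝ | ∃ (n : ℕ) (T : GHD q n), x = ⨆ t, f (T.bag t)})
    ⟨_, 1, GHD.single q, rfl⟩ ?_
  refine (Set.finite_range fun s : Set (Finset V) => sSup (f '' s)).subset ?_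
  rintro _ ⟨n, T, rfl⟩
  refine ⟨Set.range T.bag, ?_⟩
  simp only [← Set.range_comp]
  rfl

theorem GHD.le_iSup {n : ℕ} (T : GHD q n) (f : Finset V → ℝ) (t : Fin n) :
    f (T.bag t) ≤ ⨆ t, f (T.bag t) :=
  le_ciSup (f := fun t => f (T.bag t)) (Set.finite_range _).bddAbove t

theorem exists_goodBags_le_sInf (q : Query V m) (f : Finset V → ℝ) :
    ∃ B, q.GoodBags B ∧
      ∀ b ∈ B, f b ≤ sInf {x : ℝ | ∃ (n : ℕ) (T : GHD q n), x = ⨆ t, f (T.bag t)} := by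
  obtain ⟨n, T, hT⟩ := exists_ghd_eq_sInf q f
  obtain ⟨B, hB, hbag⟩ := T.exists_goodBags
  refine ⟨B, hB, fun b hb => ?_⟩
  obtain ⟨t, rfl⟩ := hbag b hb
  exact hT ▸ T.le_iSup f t

theorem Query.rhoStar_nonneg (q : Query V m) (X : Finset V) : 0 ≤ q.rhoStar X := by
  refine le_csInf ⟨_, _, q.fracCover_one X, rfl⟩ ?_
  rintro _ ⟨w, hw, rfl⟩
  exact Finset.sum_nonneg fun i _ => hw.1 i

theorem Query.one_le_rhoStar (q : Query V m) {X : Finset V} {a : V} (ha : a ∈ X) :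
    1 ≤ q.rhoStar X := by
  refine le_csInf ⟨_, _, q.fracCover_one X, rfl⟩ ?_
  rintro _ ⟨w, hw, rfl⟩
  exact (hw.2 a ha).trans
    (Finset.sum_le_sum_of_subset_of_nonneg (Finset.filter_subset _ _) fun i _ _ => hw.1 i)

theorem Query.fhw_nonneg (q : Query V m) : 0 ≤ q.fhw := by
  obtain ⟨n, T, hT⟩ := exists_ghd_eq_sInf q q.rhoStar
  obtain ⟨t⟩ := T.nonempty
  rw [Query.fhw, hT]
  exact (q.rhoStar_nonneg _).trans (T.le_iSup q.rhoStar t)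

theorem Query.one_le_fhw (q : Query V m) (a : V) : 1 ≤ q.fhw := by
  obtain ⟨n, T, hT⟩ := exists_ghd_eq_sInf q q.rhoStar
  obtain ⟨⟨t, ht⟩⟩ := (T.running a).nonempty
  rw [Query.fhw, hT]
  exact (q.one_le_rhoStar ht).trans (T.le_iSup q.rhoStar t)

theorem Inst.agm_le_one (I : Inst q D) (h : I.IN ≤ 1) (X : Finset V) : I.agm X ≤ 1 := by
  refine (I.agm_le (q.fracCover_one X)).trans (Finset.prod_le_one (fun i _ => by positivity) ?_)
  intro i _
  rw [Real.rpow_one]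
  exact_mod_cast (I.card_le_IN i).trans h

theorem Inst.logb_agm_le (I : Inst q D) (h : 1 < I.IN) (X : Finset V) :
    Real.logb I.IN (I.agm X) ≤ q.rhoStar X := by
  have hIN : (1 : ℝ) < I.IN := by exact_mod_cast h
  refine le_csInf ⟨_, _, q.fracCover_one X, rfl⟩ ?_
  rintro _ ⟨w, hw, rfl⟩
  rw [Real.logb_le_iff_le_rpow hIN (by linarith [I.one_le_agm X]),
    Real.rpow_sum_of_pos (by linarith)]
  refine (I.agm_le hw).trans (Finset.prod_le_prod (fun i _ => by positivity) fun i _ => ?_)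
  exact Real.rpow_le_rpow (by positivity) (by exact_mod_cast I.card_le_IN i) (hw.1 i)

theorem Inst.agm_le_rpow (I : Inst q D) (h : 1 < I.IN) {X : Finset V} {x : ℝ}
    (hx : Real.logb I.IN (I.agm X) ≤ x) : I.agm X ≤ (I.IN : ℝ) ^ x :=
  (Real.logb_le_iff_le_rpow (by exact_mod_cast h) (by linarith [I.one_le_agm X])).1 hx

theorem Inst.relations_eq_zero (I : Inst q D) (h : I.IN = 0) : m = 0 := by
  by_contra hm
  have := I.one_le_IN ⟨0, Nat.pos_of_ne_zero hm⟩
  rw [h] at this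
  norm_num at this

theorem Query.rhoStar_of_relations_eq_zero (q : Query V 0) (X : Finset V) : q.rhoStar X = 0 := by
  have : {x : ℝ | ∃ w, q.FracCover X w ∧ x = ∑ i, w i} = {0} := by
    ext x
    simp only [Set.mem_ofPred_eq, Set.mem_singleton_iff, Finset.univ_eq_empty, Finset.sum_empty]
    exact ⟨fun ⟨_, _, h⟩ => h, fun h => ⟨_, q.fracCover_one X, h⟩⟩
  rw [Query.rhoStar, this, csInf_singleton]

/-- Degenerate bases: for `IN = 0` all logarithms are 0 by convention and `0 ^ 0 = 1`; for `IN = 1`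
the power is 1. -/
theorem Inst.rpow_fhw_of_IN_le_one (I : Inst q D) (h : I.IN ≤ 1) :
    (I.IN : ℝ) ^ I.fhw = 1 := by
  rcases Nat.le_one_iff_eq_zero_or_eq_one.1 h with h0 | h1
  · obtain ⟨n, T, hT⟩ := exists_ghd_eq_sInf q fun X => Real.logb I.IN (I.agm X)
    have : I.fhw = 0 := by
      rw [Inst.fhw, hT]
      simp [h0]
    rw [this, Real.rpow_zero]
  · rw [h1, Nat.cast_one, Real.one_rpow]

theorem Inst.rpow_query_fhw_of_IN_le_one (I : Inst q D) (h : I.IN ≤ 1) :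
    (I.IN : ℝ) ^ q.fhw = 1 := by
  rcases Nat.le_one_iff_eq_zero_or_eq_one.1 h with h0 | h1
  · obtain rfl := I.relations_eq_zero h0
    obtain ⟨n, T, hT⟩ := exists_ghd_eq_sInf q q.rhoStar
    have : q.fhw = 0 := by
      rw [Query.fhw, hT]
      simp [q.rhoStar_of_relations_eq_zero]
    rw [this, Real.rpow_zero]
  · rw [h1, Nat.cast_one, Real.one_rpow]

theorem Inst.one_le_rpow_query_fhw (I : Inst q D) : 1 ≤ (I.IN : ℝ) ^ q.fhw := by
  rcases Nat.lt_or_ge 1 I.IN with h | h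
  · exact Real.one_le_rpow (by exact_mod_cast h.le) q.fhw_nonneg
  · exact (I.rpow_query_fhw_of_IN_le_one h).ge

/-- This lets the linear term be dropped from the first bound. If there is an attribute, a bag
containing it forces width at least 1. If there is none, each relation has at most one tuple and `IN
≤ m`, whence the factor `m + 1`. -/
theorem Inst.IN_le_rpow_query_fhw (I : Inst q D) :
    (I.IN : ℝ) ≤ (m + 1) * (I.IN : ℝ) ^ q.fhw := by
  have h1 := I.one_le_rpow_query_fhw
  rcases isEmpty_or_nonempty V with hV | ⟨⟨a⟩⟩
  · have : I.IN ≤ m := by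
      rw [Inst.IN]
      refine (Finset.sum_le_card_nsmul _ _ 1 fun i _ => ?_).trans_eq (by simp)
      exact Finset.card_le_one_of_subsingleton _
    have : (I.IN : ℝ) ≤ m := by exact_mod_cast this
    have : (0 : ℝ) ≤ m := Nat.cast_nonneg _
    nlinarith
  · have h2 : (I.IN : ℝ) ≤ (I.IN : ℝ) ^ q.fhw := by
      rcases Nat.lt_or_ge 1 I.IN with h | h
      · conv_lhs => rw [← Real.rpow_one (I.IN : ℝ)]
        exact Real.rpow_le_rpow_of_exponent_le (by exact_mod_cast h.le) (q.one_le_fhw a)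
      · exact le_trans (by exact_mod_cast h) h1
    have : (0 : ℝ) ≤ m := Nat.cast_nonneg _
    nlinarith

end Widths

/-! ### The three claims. -/

theorem mainTheorem10 {V : Type*} [Fintype V] [DecidableEq V] {m : ℕ} (q : Query V m) :
    -- DARTS, with any repertoire that includes all combinations of Split and Light transforms
    (∃ K₀ : ℕ, ∀ K ≥ K₀, ∃ (C : ℝ) (k : ℕ), ∀ rep : Set (Plan V), {p | p.SplitLight} ⊆ rep →
      ∀ (D : Type*) [DecidableEq D] (I : Inst q D),
        (runOut (dartsChoice q D K rep) I : Set (Tup V D)) = joinSet q I.rows ∧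
        (runSteps (dartsChoice q D K rep) I : ℝ) ≤
          C * Real.log (I.IN + 2) ^ k * ((I.IN : ℝ) ^ q.fhw + I.OUT) ∧
        (runSteps (dartsChoice q D K rep) I : ℝ) ≤
          C * Real.log (I.IN + 2) ^ k * (I.IN + (I.IN : ℝ) ^ I.fhw + I.OUT)) ∧
    -- repeated Split on ears
    (q.AlphaAcyclic →
      (∃ p : Plan V, p.EarPlan q.schemas) ∧
      ∀ p : Plan V, p.EarPlan q.schemas → ∃ (C : ℝ) (k : ℕ),
        ∀ (D : Type*) [DecidableEq D] (I : Inst q D),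
          (runOut (fun _ => p) I : Set (Tup V D)) = joinSet q I.rows ∧
          (runSteps (fun _ => p) I : ℝ) ≤
            C * Real.log (I.IN + 2) ^ k * (I.IN + I.OUT)) ∧
    -- a single Light transform
    (∃ (C : ℝ) (k : ℕ), ∀ (D : Type*) [DecidableEq D] (I : Inst q D),
      (∀ c ∈ I.liveConfigs, dbpBound (I.parts c) Finset.univ ≤ I.agm Finset.univ) ∧
      (runOut (fun _ => .light Finset.univ .done) I : Set (Tup V D)) = joinSet q I.rows ∧
      (runSteps (fun _ => .light Finset.univ .done) I : ℝ) ≤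
        C * Real.log (I.IN + 2) ^ k * (I.IN + I.agm Finset.univ)) := by
  refine ⟨?_, fun hα => ?_, light_run q⟩
  · obtain ⟨K₀, hK₀⟩ := darts_run q
    refine ⟨K₀, fun K hK => ?_⟩
    obtain ⟨C, k, hC, h⟩ := hK₀ K hK
    refine ⟨C * (m + 1), k, fun rep hrep D _ I => ?_⟩
    obtain ⟨hout, hsteps⟩ := h rep hrep D I
    have hm : (0 : ℝ) ≤ m := Nat.cast_nonneg _
    have hL : (0 : ℝ) ≤ Real.log (I.IN + 2) := by linarith [half_le_log I.IN]
    have hO : (0 : ℝ) ≤ I.OUT := Nat.cast_nonneg _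
    have hIN : (0 : ℝ) ≤ I.IN := Nat.cast_nonneg _
    refine ⟨hout, ?_, ?_⟩
    · obtain ⟨B, hB, hle⟩ := exists_goodBags_le_sInf q q.rhoStar
      have h1 := I.one_le_rpow_query_fhw
      refine (hsteps B ((m + 1) * (I.IN : ℝ) ^ q.fhw) hB (by nlinarith) I.IN_le_rpow_query_fhw
        fun b hb => ?_).trans (mul_mul_le_of_le hC (by positivity) (by nlinarith))
      have h2 : I.agm b ≤ (I.IN : ℝ) ^ q.fhw := by
        rcases Nat.lt_or_ge 1 I.IN with h3 | h3
        · exact I.agm_le_rpow h3 ((I.logb_agm_le h3 b).trans (hle b hb))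
        · exact (I.agm_le_one h3 b).trans h1
      nlinarith
    · obtain ⟨B, hB, hle⟩ := exists_goodBags_le_sInf q fun X => Real.logb I.IN (I.agm X)
      have hagm : ∀ b ∈ B, I.agm b ≤ (I.IN : ℝ) ^ I.fhw := fun b hb => by
        rcases Nat.lt_or_ge 1 I.IN with h3 | h3
        · exact I.agm_le_rpow h3 (hle b hb)
        · rw [I.rpow_fhw_of_IN_le_one h3]; exact I.agm_le_one h3 b
      have h0 : 0 ≤ (I.IN : ℝ) ^ I.fhw := by positivity
      refine (hsteps B (I.IN + (I.IN : ℝ) ^ I.fhw) hB ?_ (by linarith) fun b hb => by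
        linarith [hagm b hb]).trans (mul_mul_le_of_le hC (by positivity) (by nlinarith))
      rcases Nat.lt_or_ge 1 I.IN with h3 | h3
      · have : (1 : ℝ) ≤ I.IN := by exact_mod_cast h3.le
        linarith
      · rw [I.rpow_fhw_of_IN_le_one h3]; linarith
  · obtain ⟨T, hT, hrun⟩ := hα
    have hm : 0 < m := Fin.pos_iff_nonempty.2 hT.connected.nonempty
    refine ⟨Acyc.exists_earPlan ?_, fun p hp => earPlan_run hm hp⟩
    rw [q.coe_schemas]
    exact Acyc.of_tree T hT q.schema hrun
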